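/- Let $N\ge \ell\ge 1$ be integers and let $V:\mathbb{R}\to\mathbb{R}$ be a continuous function such that $\int_{\mathbb{R}} |x|^k e^{-NV(x)}\,dx<\infty$ for every integer $k\ge 0$. Let $A_N$ be a random $N\times N$ Hermitian matrix whose law is proportional to $e^{-N\operatorname{tr}V(A)}\,dA$, where $dA=\prod_i dA_{ii}\prod_{i<j}d(\Re A_{ij})\,d(\Im A_{ij})$ is Lebesgue measure on Hermitian matrices. Let $\pi_n$ be the monic orthogonal polynomial of degree $n$ with respect to the weight $e^{-NV(x)}$ on $\mathbb{R}$, let $\gamma_n>0$ be defined by $\int_{\mathbb R}\pi_n(x)^2e^{-NV(x)}dx=\gamma_n^{-2}$, and for $q\in\mathbb{C}\setminus\mathbb{R}$ let $$h_n(q)=\frac{1}{2\pi i}\int_{\mathbb{R}}\frac{\pi_n(x)}{x-q}\,e^{-NV(x)}\,dx .$$ Put $\tilde\pi_N=-2\pi i\,\gamma_{N-1}^2\,\pi_{N-1}$ and $\tilde h_N=-2\pi i\,\gamma_{N-1}^2\,h_{N-1}$. For $\mathbf{q}=(q_1,\dots,q_\ell)$ let $\mathrm{V}(\mathbf{q})=(q_i^{\,j-1})_{1\le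 i,j\le \ell}$, $\Delta(\mathbf{q})=\det \mathrm{V}(\mathbf{q})$, and $f(\mathbf{q})=\operatorname{diag}(f(q_1),\dots,f(q_\ell))$ for a function $f$. Let $\mathbf{p}=(p_1,\dots,p_\ell)$ and $\mathbf{q}=(q_1,\dots,q_\ell)$ be two tuples of points of $\mathbb{C}\setminus\mathbb{R}$, the entries of each tuple being pairwise distinct. Then the law of $A_N$ is well defined (the measure $e^{-N\operatorname{tr}V(A)}dA$ has finite, positive total mass), the ratio below is integrable, and $$\mathbb{E}\left[\frac{\prod_{i=1}^{\ell}\det(p_i-A_N)}{\prod_{j=1}^{\ell}\det(q_j-A_N)}\right]=\frac{1}{\Delta(\mathbf{q})\Delta(\mathbf{p})}\,\det\begin{pmatrix}\tilde h_N(\mathbf{q})\mathrm{V}(\mathbf{q}) & h_N(\mathbf{q})\mathrm{V}(\mathbf{q})\\ \tilde\pi_N(\mathbf{p})\mathrm{V}(\mathbf{p}) & \pi_N(\mathbf{p})\mathrm{V}(\mathbf{p})\end{pmatrix}.$$ -/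

import Mathlib

open MeasureTheory Polynomial
open scoped ENNReal Matrix

noncomputable section

namespace UnitaryEnsemble

/-! ### The random matrix -/

/-- Coordinates on the real vector space of `N × N` Hermitian matrices: the (real) diagonal entries
and the (complex) entries strictly above the diagonal. Its `volume` is the Lebesgue measure
`∏ i, dA_ii ∏ i < j, d(Re A_ij) d(Im A_ij)`. -/
abbrev HermCoord (N : ℕ) : Type :=
  (Fin N → ℝ) × ({ij : Fin N × Fin N // ij.1 < ij.2} → ℂ)

/-- The Hermitian matrix with the given coordinates. -/
def toMatrix {N : ℕ} (c : HermCoord N) : Matrix (Fin N) (Fin N) ℂ :=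
  Matrix.of fun i j =>
    if h : i < j then c.2 ⟨(i, j), h⟩
    else if h : j < i then star (c.2 ⟨(j, i), h⟩)
    else (c.1 i : ℂ)

theorem toMatrix_isHermitian {N : ℕ} (c : HermCoord N) : (toMatrix c).IsHermitian := by
  ext i j
  rcases lt_trichotomy i j with h | h | h
  · simp [toMatrix, h, h.not_gt]
  · subst h
    simp [toMatrix]
  · simp [toMatrix, h, h.not_gt]

/-- `tr V(A)`, where `V(A)` is given by the functional calculus of the Hermitian matrix `A`
(this trace is real). -/
def trPotential {N : ℕ} (V : ℝ → ℝ) (c : HermCoord N) : ℝ :=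
  ((toMatrix_isHermitian c).cfc V).trace.re

/-- The measure `e^{-N tr V(A)} dA` on Hermitian matrices. -/
def gibbsMeasure (N : ℕ) (V : ℝ → ℝ) : Measure (HermCoord N) :=
  (volume : Measure (HermCoord N)).withDensity fun c =>
    ENNReal.ofReal (Real.exp (-((N : ℝ) * trPotential V c)))

/-- The law of the random matrix `A_N`: the probability measure proportional to
`e^{-N tr V(A)} dA`. -/
def law (N : ℕ) (V : ℝ → ℝ) : Measure (HermCoord N) :=
  (gibbsMeasure N V Set.univ)⁻¹ • gibbsMeasure N V

/-- `det (z - A)`. -/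
def charDet {N : ℕ} (z : ℂ) (A : Matrix (Fin N) (Fin N) ℂ) : ℂ :=
  (Matrix.scalar (Fin N) z - A).det

/-- `∏ i, det (p i - A) / ∏ j, det (q j - A)`. -/
def charRatio {N l : ℕ} (p q : Fin l → ℂ) (A : Matrix (Fin N) (Fin N) ℂ) : ℂ :=
  (∏ i, charDet (p i) A) / ∏ j, charDet (q j) A

/-! ### Orthogonal polynomials -/

/-- The weight `e^{-N V(x)}` on the real line. -/
def weight (N : ℕ) (V : ℝ → ℝ) (x : ℝ) : ℝ :=
  Real.exp (-((N : ℝ) * V x))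

/-- `∫ f(x) g(x) e^{-N V(x)} dx`. -/
def wInner (N : ℕ) (V : ℝ → ℝ) (f g : ℝ[X]) : ℝ :=
  ∫ x : ℝ, f.eval x * g.eval x * weight N V x

/-- The monic orthogonal polynomial `π_n` of degree `n` with respect to `e^{-N V(x)}`, obtained
from the monomials by Gram-Schmidt orthogonalization. -/
def monicOP (N : ℕ) (V : ℝ → ℝ) (n : ℕ) : ℝ[X] :=
  X ^ n - ∑ k : Fin n,
    C (wInner N V (X ^ n) (monicOP N V k) / wInner N V (monicOP N V k) (monicOP N V k)) *
      monicOP N V k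
termination_by n
decreasing_by all_goals exact k.2

/-- The normalizing constant `γ_n > 0`, with `∫ π_n(x)² e^{-N V(x)} dx = γ_n⁻²`. -/
def gam (N : ℕ) (V : ℝ → ℝ) (n : ℕ) : ℝ :=
  (√(wInner N V (monicOP N V n) (monicOP N V n)))⁻¹

/-- `π_n` as a function of a complex variable. -/
def piFun (N : ℕ) (V : ℝ → ℝ) (n : ℕ) (z : ℂ) : ℂ :=
  aeval z (monicOP N V n)

/-- The Cauchy transform `h_n(z) = (2πi)⁻¹ ∫ π_n(x) / (x - z) e^{-N V(x)} dx`. -/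
def hFun (N : ℕ) (V : ℝ → ℝ) (n : ℕ) (z : ℂ) : ℂ :=
  1 / (2 * (Real.pi : ℂ) * Complex.I) *
    ∫ x : ℝ, (((monicOP N V n).eval x : ℝ) : ℂ) / ((x : ℂ) - z) * (weight N V x : ℂ)

/-- `π̃_N(z) = -2πi γ_{N-1}² π_{N-1}(z)`, for `N ≥ 1`. -/
def piTilde (N : ℕ) (V : ℝ → ℝ) (z : ℂ) : ℂ :=
  -2 * (Real.pi : ℂ) * Complex.I * (gam N V (N - 1) : ℂ) ^ 2 * piFun N V (N - 1) z

/-- `h̃_N(z) = -2πi γ_{N-1}² h_{N-1}(z)`, for `N ≥ 1`. -/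
def hTilde (N : ℕ) (V : ℝ → ℝ) (z : ℂ) : ℂ :=
  -2 * (Real.pi : ℂ) * Complex.I * (gam N V (N - 1) : ℂ) ^ 2 * hFun N V (N - 1) z

/-! ### The block matrix -/

/-- `f(q) V(q)`, where `f(q) = diag(f(q_1), …, f(q_l))` and `V(q)` is the Vandermonde matrix with
rows `(1, q_i, …, q_i^{l-1})`. -/
def diagVandermonde {l : ℕ} (f : ℂ → ℂ) (q : Fin l → ℂ) : Matrix (Fin l) (Fin l) ℂ :=
  Matrix.diagonal (fun i => f (q i)) * Matrix.vandermonde q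

/-- The `2l × 2l` matrix with blocks `h̃_N(q)V(q)`, `h_N(q)V(q)` in the first row and
`π̃_N(p)V(p)`, `π_N(p)V(p)` in the second. -/
def blockMatrix (N : ℕ) (V : ℝ → ℝ) {l : ℕ} (p q : Fin l → ℂ) :
    Matrix (Fin l ⊕ Fin l) (Fin l ⊕ Fin l) ℂ :=
  Matrix.fromBlocks
    (diagVandermonde (hTilde N V) q) (diagVandermonde (hFun N V N) q)
    (diagVandermonde (piTilde N V) p) (diagVandermonde (piFun N V N) p)

/-! ### The polynomials `monicOP` are the monic orthogonal polynomials -/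

theorem monicOP_monic (N : ℕ) (V : ℝ → ℝ) (n : ℕ) :
    (monicOP N V n).Monic ∧ (monicOP N V n).natDegree = n := by
  induction n using Nat.strong_induction_on with
  | _ n ih =>
    have hdeg : (∑ k : Fin n,
        C (wInner N V (X ^ n) (monicOP N V k) / wInner N V (monicOP N V k) (monicOP N V k)) *
          monicOP N V k).degree < (n : WithBot ℕ) := by
      refine (degree_sum_le _ _).trans_lt ((Finset.sup_lt_iff (WithBot.bot_lt_coe n)).2 ?_)
      intro k _
      rw [← smul_eq_C_mul]
      refine (degree_smul_le _ _).trans_lt ?_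
      rw [degree_eq_natDegree (ih k k.2).1.ne_zero, (ih k k.2).2]
      exact Nat.cast_lt.2 k.2
    rw [monicOP]
    refine ⟨monic_X_pow_sub hdeg, ?_⟩
    rw [sub_eq_add_neg, natDegree_add_eq_left_of_degree_lt, natDegree_X_pow]
    rw [degree_neg, degree_X_pow]
    exact hdeg

theorem integrable_wInner {N : ℕ} {V : ℝ → ℝ}
    (hmom : ∀ k : ℕ, Integrable (fun x : ℝ => x ^ k * Real.exp (-((N : ℝ) * V x))))
    (f g : ℝ[X]) : Integrable (fun x : ℝ => f.eval x * g.eval x * weight N V x) := by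
  have h : ∀ r : ℝ[X], Integrable (fun x : ℝ => r.eval x * weight N V x) := by
    intro r
    simp only [eval_eq_sum_range, Finset.sum_mul]
    refine integrable_finsetSum _ fun k _ => ?_
    simpa [weight, mul_assoc] using (hmom k).const_mul (r.coeff k)
  simpa using h (f * g)

theorem wInner_self_pos {N : ℕ} {V : ℝ → ℝ}
    (hmom : ∀ k : ℕ, Integrable (fun x : ℝ => x ^ k * Real.exp (-((N : ℝ) * V x))))
    {f : ℝ[X]} (hf : f ≠ 0) : 0 < wInner N V f f := by
  have hw : ∀ x, 0 < weight N V x := fun x => Real.exp_pos _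
  refine (integral_pos_iff_support_of_nonneg
    (fun x => mul_nonneg (mul_self_nonneg _) (hw x).le) (integrable_wInner hmom f f)).2 ?_
  have hs : ((f.rootSet ℝ)ᶜ) ⊆
      Function.support (fun x : ℝ => f.eval x * f.eval x * weight N V x) := by
    intro x hx
    have : f.eval x ≠ 0 := by
      intro h0
      exact hx ((mem_rootSet_of_ne hf).2 (by simpa using h0))
    exact mul_ne_zero (mul_ne_zero this this) (hw x).ne'
  refine lt_of_lt_of_le ?_ (measure_mono hs)
  have h0 : volume (f.rootSet ℝ) = 0 := (f.rootSet_finite ℝ).measure_zero _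
  have h1 := measure_univ_le_add_compl (μ := (volume : Measure ℝ)) (f.rootSet ℝ)
  rw [h0, zero_add, Real.volume_univ] at h1
  exact lt_of_lt_of_le ENNReal.zero_lt_top h1

/-- `∫ π_n π_m e^{-N V} dx = γ_n⁻² δ_{nm}`, whenever `e^{-N V}` has finite moments. -/
theorem wInner_monicOP {N : ℕ} {V : ℝ → ℝ}
    (hmom : ∀ k : ℕ, Integrable (fun x : ℝ => x ^ k * Real.exp (-((N : ℝ) * V x))))
    (n m : ℕ) :
    wInner N V (monicOP N V n) (monicOP N V m) = if n = m then (gam N V n ^ 2)⁻¹ else 0 := by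
  have hcomm : ∀ f g, wInner N V f g = wInner N V g f := fun f g => by
    simp only [wInner, mul_comm (eval _ f)]
  have hlt : ∀ n m, m < n → wInner N V (monicOP N V n) (monicOP N V m) = 0 := by
    intro n
    induction n using Nat.strong_induction_on with
    | _ n ih =>
      intro m hm
      have hortho : ∀ k : Fin n, (k : ℕ) ≠ m →
          wInner N V (monicOP N V k) (monicOP N V m) = 0 := by
        intro k hk
        rcases lt_or_gt_of_ne hk with h | h
        · rw [hcomm]
          exact ih m hm k h
        · exact ih k k.2 m h
      have hexp : wInner N V (monicOP N V n) (monicOP N V m) =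
          wInner N V (X ^ n) (monicOP N V m) - ∑ k : Fin n,
            wInner N V (X ^ n) (monicOP N V k) / wInner N V (monicOP N V k) (monicOP N V k) *
              wInner N V (monicOP N V k) (monicOP N V m) := by
        have hsum : ∀ c : Fin n → ℝ, wInner N V (X ^ n - ∑ k, C (c k) * monicOP N V k)
            (monicOP N V m) = wInner N V (X ^ n) (monicOP N V m) -
              ∑ k, c k * wInner N V (monicOP N V k) (monicOP N V m) := by
          intro c
          simp only [wInner, ← integral_const_mul]
          rw [← integral_finsetSum _ fun k _ => (integrable_wInner hmom _ _).const_mul _,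
            ← integral_sub (integrable_wInner hmom _ _)
              (integrable_finsetSum _ fun k _ => (integrable_wInner hmom _ _).const_mul _)]
          congr 1
          ext x
          simp only [eval_sub, eval_finsetSum, eval_mul, eval_C, sub_mul, Finset.sum_mul]
          simp only [mul_assoc]
        conv_lhs => rw [monicOP.eq_1 N V n]
        exact hsum _
      rw [hexp, Finset.sum_eq_single (⟨m, hm⟩ : Fin n)]
      · rw [div_mul_cancel₀ _ (wInner_self_pos hmom (monicOP_monic N V m).1.ne_zero).ne', sub_self]
      · intro k _ hk
        rw [hortho k (fun h => hk (Fin.ext h)), mul_zero]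
      · simp
  split_ifs with h
  · subst h
    rw [gam, inv_pow, inv_inv,
      Real.sq_sqrt (wInner_self_pos hmom (monicOP_monic N V n).1.ne_zero).le]
  · rcases lt_or_gt_of_ne h with h | h
    · rw [hcomm]
      exact hlt m n h
    · exact hlt n m h

end UnitaryEnsemble

end

noncomputable section

namespace UnitaryEnsemble

/-! ### Interlacing and bordered characteristic polynomials -/

/-! Both sides reduce to integrals over eigenvalues. Write N = m + l, w = e^{-NV}, ν_n = γ_n⁻², and
Δ for the Vandermonde determinant.

Weyl's formula says that on functions of the characteristic polynomial, dA acts as a constant times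
Δ(x)² dx. It is proved by induction on the size, without integrating over the unitary group. A
matrix of size n + 1 is a border (v, a) around a block B. Unitary invariance of dv lets B be
replaced by diag(μ) (`IsClassFun.lintegral_bordMatrix`), and then only a and the |v_i|² matter;
Lebesgue measure in v_i becomes π times Lebesgue measure in |v_i|². The points x interlacing with μ
correspond bijectively to these border parameters (`image_borderCoord`), with Jacobian Δ(x)/Δ(μ) up
to sign (`det_borderJacobian`). Induction supplies Δ(μ)²; the Jacobian consumes one factor, and
integrating the other over the μ interlacing with x gives Δ(x)/n!
(`lintegral_vandermonde_interlacing`). Together with the Jacobian's Δ(x) this is Δ(x)².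

Up to sign, Δ(q)Δ(p) times the weighted eigenvalue density times the ratio is a product of two
determinants (`det_mul_det_eq_density_mul_ratio`). One is a Cauchy–Vandermonde determinant with
columns π_0, …, π_{m-1} and 1/(x - q_j); the other evaluates π_0, …, π_{N+l-1} at the points x and
p. Andréief's identity makes the integral N! times one determinant, from which orthogonality splits
off ν_0 ⋯ ν_{m-1} (`ratio_integral`). What remains is the 2l × 2l determinant of the Cauchy
transforms at q and the values at p of π_m, …, π_{m+2l-1}. The same identity without the ratio gives
the partition function N! ν_0 ⋯ ν_{N-1}.

The span of these 2l polynomials also has the basis π_{N-1}x^k, π_N x^k for k < l. The change of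
basis is triangular, with determinant ∏ ν_{N-1}/ν_{N-1-k} (`det_shiftedCoeff`). By orthogonality the
Cauchy transform of π_n x^k at q is q^k times that of π_n, so the new entries are those of the block
matrix up to row and column factors (`det_blockMatrix`). All norms and signs then cancel. -/

/-- The characteristic polynomial of the bordered matrix with diagonal block `diag μ`, corner
`y_last`, and squared moduli `y_i` of the border entries. -/
def borderPoly {N : ℕ} (μ : Fin N → ℝ) (y : Fin (N + 1) → ℝ) : ℝ[X] :=
  (X - C (y (Fin.last N))) * ∏ i, (X - C (μ i)) -
    ∑ i : Fin N, C (y i.castSucc) * ∏ k ∈ Finset.univ.erase i, (X - C (μ k))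

/-- The border parameters for which the bordered matrix has eigenvalues `x`. -/
def borderCoord {N : ℕ} (μ : Fin N → ℝ) (x : Fin (N + 1) → ℝ) : Fin (N + 1) → ℝ :=
  Fin.snoc (α := fun _ => ℝ)
    (fun i => (-∏ k ∈ Finset.univ.erase i, (μ i - μ k))⁻¹ * ∏ j, (μ i - x j))
    (∑ j, x j - ∑ i, μ i)

/-- The points `x` strictly interlacing with `μ`. -/
def interlacing {N : ℕ} (μ : Fin N → ℝ) : Set (Fin (N + 1) → ℝ) :=
  {x | ∀ i : Fin N, x i.castSucc < μ i ∧ μ i < x i.succ}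

theorem strictMono_of_mem_interlacing {N : ℕ} {μ : Fin N → ℝ} {x : Fin (N + 1) → ℝ}
    (hx : x ∈ interlacing μ) : StrictMono x :=
  Fin.strictMono_iff_lt_succ.2 fun i => (hx i).1.trans (hx i).2

theorem strictMono_of_interlacing {N : ℕ} {μ : Fin N → ℝ} {x : Fin (N + 1) → ℝ}
    (hx : x ∈ interlacing μ) : StrictMono μ := by
  intro i j hij
  exact ((hx i).2.trans_le ((strictMono_of_mem_interlacing hx).monotone
    (Fin.succ_le_castSucc_iff.2 hij))).trans (hx j).1

theorem isOpen_interlacing {N : ℕ} (μ : Fin N → ℝ) : IsOpen (interlacing μ) := by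
  have : interlacing μ = ⋂ i : Fin N, {x | x i.castSucc < μ i ∧ μ i < x i.succ} := by
    ext x; simp [interlacing]
  rw [this]
  exact isOpen_iInter_of_finite fun i =>
    (isOpen_lt (continuous_apply _) continuous_const).inter
      (isOpen_lt continuous_const (continuous_apply _))

theorem prod_erase_sub_ne_zero {N : ℕ} {μ : Fin N → ℝ} (hμ : Function.Injective μ) (i : Fin N) :
    ∏ k ∈ Finset.univ.erase i, (μ i - μ k) ≠ 0 :=
  Finset.prod_ne_zero_iff.2 fun _ hk =>
    sub_ne_zero.2 fun h => Finset.ne_of_mem_erase hk (hμ h).symm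

theorem eval_borderPoly {N : ℕ} (μ : Fin N → ℝ) (y : Fin (N + 1) → ℝ) (i : Fin N) :
    (borderPoly μ y).eval (μ i) =
      -(y i.castSucc * ∏ k ∈ Finset.univ.erase i, (μ i - μ k)) := by
  have h0 : ∏ k, (μ i - μ k) = 0 := Finset.prod_eq_zero (Finset.mem_univ i) (sub_self _)
  have h1 : ∀ j ∈ Finset.univ, j ≠ i →
      y j.castSucc * ∏ k ∈ Finset.univ.erase j, (μ i - μ k) = 0 := fun j _ hj => by
    rw [Finset.prod_eq_zero (Finset.mem_erase.2 ⟨hj.symm, Finset.mem_univ i⟩) (sub_self _),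
      mul_zero]
  simp only [borderPoly, eval_sub, eval_mul, eval_prod, eval_X, eval_C, eval_finsetSum, h0]
  rw [Finset.sum_eq_single i h1 (by simp)]
  simp

theorem degree_borderPoly_tail_lt {N : ℕ} (μ : Fin N → ℝ) (y : Fin N → ℝ) :
    (∑ i : Fin N, C (y i) * ∏ k ∈ Finset.univ.erase i, (X - C (μ k))).degree < (N : WithBot ℕ) := by
  refine (degree_sum_le _ _).trans_lt ((Finset.sup_lt_iff (WithBot.bot_lt_coe N)).2 fun i _ => ?_)
  rw [← smul_eq_C_mul]
  refine (degree_smul_le _ _).trans_lt ?_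
  rw [degree_prod]
  simp only [degree_X_sub_C, Finset.sum_const, Finset.card_erase_of_mem (Finset.mem_univ i),
    Finset.card_univ, Fintype.card_fin, nsmul_eq_mul, mul_one]
  exact Nat.cast_lt.2 (Nat.sub_lt (Fin.pos i) one_pos)

theorem borderPoly_monic_natDegree {N : ℕ} (μ : Fin N → ℝ) (y : Fin (N + 1) → ℝ) :
    (borderPoly μ y).Monic ∧ (borderPoly μ y).natDegree = N + 1 := by
  have hm : ((X - C (y (Fin.last N))) * ∏ i, (X - C (μ i))).Monic :=
    (monic_X_sub_C _).mul (monic_prod_X_sub_C _ _)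
  have hd : ((X - C (y (Fin.last N))) * ∏ i, (X - C (μ i))).natDegree = N + 1 := by
    rw [(monic_X_sub_C _).natDegree_mul (monic_prod_X_sub_C _ _), natDegree_X_sub_C,
      natDegree_prod_of_monic _ _ fun i _ => monic_X_sub_C _]
    simp [add_comm]
  have hlt : (∑ i : Fin N, C (y i.castSucc) * ∏ k ∈ Finset.univ.erase i, (X - C (μ k))).degree <
      ((X - C (y (Fin.last N))) * ∏ i, (X - C (μ i))).degree := by
    rw [degree_eq_natDegree hm.ne_zero, hd]
    refine (degree_borderPoly_tail_lt μ fun i => y i.castSucc).trans ?_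
    exact_mod_cast Nat.lt_succ_self N
  exact ⟨hm.sub_of_left hlt,
    by rw [borderPoly, natDegree_eq_of_degree_eq (degree_sub_eq_left_of_degree_lt hlt), hd]⟩

theorem nextCoeff_borderPoly {N : ℕ} (μ : Fin N → ℝ) (y : Fin (N + 1) → ℝ) :
    (borderPoly μ y).coeff N = -y (Fin.last N) - ∑ i, μ i := by
  have hd : ((X - C (y (Fin.last N))) * ∏ i, (X - C (μ i))).natDegree = N + 1 := by
    rw [(monic_X_sub_C _).natDegree_mul (monic_prod_X_sub_C _ _), natDegree_X_sub_C,
      natDegree_prod_of_monic _ _ fun i _ => monic_X_sub_C _]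
    simp [add_comm]
  have h1 : ((X - C (y (Fin.last N))) * ∏ i, (X - C (μ i))).coeff N =
      -y (Fin.last N) - ∑ i, μ i := by
    have := (monic_X_sub_C (y (Fin.last N))).nextCoeff_mul (monic_prod_X_sub_C μ Finset.univ)
    rw [nextCoeff_of_natDegree_pos (by omega), hd, prod_X_sub_C_nextCoeff, nextCoeff_X_sub_C] at this
    simpa [sub_eq_add_neg] using this
  rw [borderPoly, coeff_sub, h1,
    coeff_eq_zero_of_degree_lt (degree_borderPoly_tail_lt μ fun i => y i.castSucc), sub_zero]

/-- Lagrange interpolation: both polynomials are monic of degree N + 1 and, by the choice of corner,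
have the same coefficient of X^N. Their difference has degree below N and vanishes at the N distinct
points μ_i. -/
theorem borderPoly_borderCoord {N : ℕ} {μ : Fin N → ℝ} (hμ : Function.Injective μ)
    (x : Fin (N + 1) → ℝ) : borderPoly μ (borderCoord μ x) = ∏ j, (X - C (x j)) := by
  have hd : (∏ j, (X - C (x j))).natDegree = N + 1 := by
    rw [natDegree_prod_of_monic _ _ fun i _ => monic_X_sub_C _]; simp
  have hm := monic_prod_X_sub_C x Finset.univ
  obtain ⟨hm', hd'⟩ := borderPoly_monic_natDegree μ (borderCoord μ x)
  refine eq_of_degree_sub_lt_of_eval_finset_eq (Finset.univ.image μ) ?_ ?_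
  · rw [Finset.card_image_of_injective _ hμ, Finset.card_univ, Fintype.card_fin,
      degree_lt_iff_coeff_zero]
    intro m hm1
    rw [coeff_sub, sub_eq_zero]
    rcases hm1.eq_or_lt with h | h
    · subst h
      have h2 := prod_X_sub_C_nextCoeff (s := Finset.univ) x
      rw [nextCoeff_of_natDegree_pos (by omega), hd] at h2
      rw [nextCoeff_borderPoly]
      simp only [Nat.add_sub_cancel] at h2
      rw [h2]
      simp [borderCoord]
    · rcases (Nat.succ_le_of_lt h).eq_or_lt with h | h
      · rw [← h]
        have e1 := hm'.coeff_natDegree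
        have e2 := hm.coeff_natDegree
        rw [hd'] at e1
        rw [hd] at e2
        exact e1.trans e2.symm
      · rw [coeff_eq_zero_of_natDegree_lt (hd'.trans_lt h),
          coeff_eq_zero_of_natDegree_lt (hd.trans_lt h)]
  · intro z hz
    obtain ⟨i, -, rfl⟩ := Finset.mem_image.1 hz
    rw [eval_borderPoly]
    have := prod_erase_sub_ne_zero hμ i
    simp only [borderCoord, Fin.snoc_castSucc, eval_prod, eval_sub, eval_X, eval_C]
    field_simp

/-- The border parameters determine the polynomial, hence its set of roots, and an interlacing tuple
lists that set in increasing order. -/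
theorem borderCoord_injOn {N : ℕ} {μ : Fin N → ℝ} (hμ : Function.Injective μ) :
    Set.InjOn (borderCoord μ) (interlacing μ) := by
  intro x hx x' hx' h
  have h1 : ∏ j, (X - C (x j)) = ∏ j, (X - C (x' j)) := by
    rw [← borderPoly_borderCoord hμ, ← borderPoly_borderCoord hμ, h]
  refine ((strictMono_of_mem_interlacing hx).range_inj (strictMono_of_mem_interlacing hx')).1 ?_
  ext z
  have h2 := congrArg (eval z) h1
  simp only [eval_prod, eval_sub, eval_X, eval_C] at h2
  have h3 : ∀ x : Fin (N + 1) → ℝ, z ∈ Set.range x ↔ ∏ j, (z - x j) = 0 := fun x => by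
    rw [Finset.prod_eq_zero_iff]
    simp [sub_eq_zero, eq_comm]
  rw [h3, h3, h2]

/-- Exactly the N - 1 - i factors with k > i are negative. -/
theorem sign_prod_erase_sub {N : ℕ} {μ : Fin N → ℝ} (hμ : StrictMono μ) (i : Fin N) :
    0 < (-1 : ℝ) ^ (N - 1 - i : ℕ) * ∏ k ∈ Finset.univ.erase i, (μ i - μ k) := by
  have h : Finset.univ.erase i = Finset.Iio i ∪ Finset.Ioi i := by
    ext k
    simp [lt_or_lt_iff_ne]
  have hdisj : Disjoint (Finset.Iio i) (Finset.Ioi i) := by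
    rw [Finset.disjoint_left]
    intro k hk hk'
    exact lt_asymm (Finset.mem_Iio.1 hk) (Finset.mem_Ioi.1 hk')
  rw [h, Finset.prod_union hdisj, mul_left_comm]
  refine mul_pos (Finset.prod_pos fun k hk => sub_pos.2 (hμ (Finset.mem_Iio.1 hk))) ?_
  have : ∏ k ∈ Finset.Ioi i, (μ i - μ k) =
      (-1) ^ (N - 1 - i : ℕ) * ∏ k ∈ Finset.Ioi i, (μ k - μ i) := by
    rw [← Fin.card_Ioi, ← Finset.prod_const, ← Finset.prod_mul_distrib]
    exact Finset.prod_congr rfl fun k _ => by ring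
  rw [this, ← mul_assoc, ← mul_pow]
  simpa using Finset.prod_pos fun k hk => sub_pos.2 (hμ (Finset.mem_Ioi.1 hk))

theorem prod_Ioi_sub_pos {N : ℕ} {x : Fin N → ℝ} (hx : StrictMono x) :
    0 < (Matrix.vandermonde x).det := by
  rw [Matrix.det_vandermonde]
  exact Finset.prod_pos fun i _ => Finset.prod_pos fun j hj => sub_pos.2 (hx (Finset.mem_Ioi.1 hj))

theorem interlacing_sign {N : ℕ} {μ : Fin N → ℝ} {x : Fin (N + 1) → ℝ}
    (hx : x ∈ interlacing μ) (i : Fin N) :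
    0 < (-1 : ℝ) ^ (N - i : ℕ) * ∏ j, (μ i - x j) := by
  have hm := strictMono_of_mem_interlacing hx
  have h : (Finset.univ : Finset (Fin (N + 1))) = Finset.Iic i.castSucc ∪ Finset.Ioi i.castSucc := by
    ext k
    simp [le_or_gt]
  have hdisj : Disjoint (Finset.Iic i.castSucc) (Finset.Ioi i.castSucc) := by
    rw [Finset.disjoint_left]
    intro k hk hk'
    exact (Finset.mem_Iic.1 hk).not_gt (Finset.mem_Ioi.1 hk')
  rw [h, Finset.prod_union hdisj, mul_left_comm]
  refine mul_pos (Finset.prod_pos fun k hk => sub_pos.2 ?_) ?_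
  · exact (hm.monotone (Finset.mem_Iic.1 hk)).trans_lt (hx i).1
  have : ∏ k ∈ Finset.Ioi i.castSucc, (μ i - x k) =
      (-1) ^ (N - i : ℕ) * ∏ k ∈ Finset.Ioi i.castSucc, (x k - μ i) := by
    have hc : (Finset.Ioi i.castSucc).card = N - i := by simp
    rw [← hc, ← Finset.prod_const, ← Finset.prod_mul_distrib]
    exact Finset.prod_congr rfl fun k _ => by ring
  rw [this, ← mul_assoc, ← mul_pow]
  simpa using Finset.prod_pos fun k hk => sub_pos.2
    ((hx i).2.trans_le (hm.monotone (Fin.castSucc_lt_iff_succ_le.1 (Finset.mem_Ioi.1 hk))))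

/-- Interlacing puts N - i of the x_j above μ_i, against N - 1 - i of the other μ_k. The two
products therefore have opposite signs, and the minus sign in `borderCoord` makes the quotient
positive. -/
theorem borderCoord_pos {N : ℕ} {μ : Fin N → ℝ} {x : Fin (N + 1) → ℝ}
    (hx : x ∈ interlacing μ) (i : Fin N) : 0 < borderCoord μ x i.castSucc := by
  have h1 := sign_prod_erase_sub (strictMono_of_interlacing hx) i
  have h2 := interlacing_sign hx i
  have h3 := div_pos h2 h1
  have h4 : N - (i : ℕ) = (N - 1 - i) + 1 := by omega
  rw [h4, pow_succ, mul_assoc, mul_div_mul_left _ _ (by simp)] at h3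
  simp only [borderCoord, Fin.snoc_castSucc]
  refine h3.trans_eq ?_
  rw [inv_neg, div_eq_mul_inv]
  ring

/-! ### Interlacing roots from positive border parameters -/

theorem exists_root_of_sign_change {P : ℝ[X]} {a b : ℝ} (hab : a < b)
    (h : P.eval a * P.eval b < 0) : ∃ z ∈ Set.Ioo a b, P.eval z = 0 := by
  have hc : ContinuousOn (fun z => P.eval z) (Set.Icc a b) := P.continuous.continuousOn
  rcases mul_neg_iff.1 h with ⟨ha, hb⟩ | ⟨ha, hb⟩
  · exact intermediate_value_Ioo' hab.le hc ⟨hb, ha⟩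
  · exact intermediate_value_Ioo hab.le hc ⟨ha, hb⟩

theorem borderPoly_injective {N : ℕ} {μ : Fin N → ℝ} (hμ : Function.Injective μ) :
    Function.Injective (borderPoly μ) := by
  intro y y' h
  ext j
  induction j using Fin.lastCases with
  | last =>
    have := congrArg (fun P => P.coeff N) h
    simpa [nextCoeff_borderPoly] using this
  | cast i =>
    have := congrArg (eval (μ i)) h
    rw [eval_borderPoly, eval_borderPoly, neg_inj] at this
    exact mul_right_cancel₀ (prod_erase_sub_ne_zero hμ i) this

theorem exists_large_eval_pos {P : ℝ[X]} {n : ℕ} (hm : P.Monic) (hn : P.natDegree = n + 1) (M : ℝ) :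
    ∃ b, M < b ∧ 0 < P.eval b := by
  have h := P.tendsto_atTop_of_leadingCoeff_nonneg
    (natDegree_pos_iff_degree_pos.1 (by omega)) (by rw [hm.leadingCoeff]; exact zero_le_one)
  exact ((Filter.eventually_gt_atTop M).and (h.eventually_gt_atTop 0)).exists

/-- Reflection: (-1)^(n+1) P(-X) is again monic of degree n + 1, so its behaviour at +∞ gives that
of P at -∞. -/
theorem exists_small_eval_sign {P : ℝ[X]} {n : ℕ} (hm : P.Monic) (hn : P.natDegree = n + 1)
    (M : ℝ) : ∃ a, a < M ∧ 0 < (-1) ^ (n + 1) * P.eval a := by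
  have hX : (-X : ℝ[X]).natDegree = 1 := by simp
  have hc : (C ((-1 : ℝ) ^ (n + 1)) * P.comp (-X)).Monic := by
    rw [Monic, leadingCoeff_mul, leadingCoeff_C, leadingCoeff_comp (by simp), hm.leadingCoeff, hn]
    simp [← mul_pow]
  have hd : (C ((-1 : ℝ) ^ (n + 1)) * P.comp (-X)).natDegree = n + 1 := by
    rw [natDegree_C_mul (by simp), natDegree_comp, hX, hn, mul_one]
  obtain ⟨b, hb, hb'⟩ := exists_large_eval_pos hc hd (-M)
  exact ⟨-b, by linarith, by simpa using hb'⟩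

/-- When all y_i are positive, the values of the border polynomial at the μ_i alternate in sign, and
its signs near ±∞ continue the pattern. The intermediate value theorem gives a root in each of the N
+ 1 gaps; these exhaust the degree. -/
theorem image_borderCoord {N : ℕ} {μ : Fin N → ℝ} (hμ : StrictMono μ) :
    borderCoord μ '' interlacing μ = {y | ∀ i : Fin N, 0 < y i.castSucc} := by
  ext y
  constructor
  · rintro ⟨x, hx, rfl⟩ i
    exact borderCoord_pos hx i
  intro hy
  obtain ⟨hm, hd⟩ := borderPoly_monic_natDegree μ y
  set P := borderPoly μ y with hP
  obtain ⟨M, hM⟩ := (Set.finite_range fun i => |μ i|).bddAbove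
  have hM' : ∀ i, |μ i| ≤ M := fun i => hM ⟨i, rfl⟩
  -- The maximum with 0 matters only for N = 0: then M may be negative, and a < b would not follow
  -- from a < -M and M < b.
  obtain ⟨b, hb, hb'⟩ := exists_large_eval_pos hm hd (max M 0)
  obtain ⟨a, ha, ha'⟩ := exists_small_eval_sign hm hd (-(max M 0))
  have hbm : ∀ i, μ i < b := fun i =>
    ((le_abs_self _).trans ((hM' i).trans (le_max_left _ _))).trans_lt hb
  have ham : ∀ i, a < μ i := fun i =>
    ha.trans_le ((neg_le_neg ((hM' i).trans (le_max_left _ _))).trans (neg_abs_le _))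
  -- The sentinels a and b below and above all μ_i make the N + 1 gaps consecutive intervals of one
  -- sequence.
  let ν : Fin (N + 2) → ℝ := Fin.cons (α := fun _ => ℝ) a (Fin.snoc (α := fun _ => ℝ) μ b)
  have hν : StrictMono ν := by
    rw [Fin.strictMono_iff_lt_succ]
    intro j
    induction j using Fin.cases with
    | zero =>
      simp only [ν, Fin.castSucc_zero, Fin.cons_zero, Fin.cons_succ]
      -- The successor of a in the sequence is b when N = 0 and the first μ otherwise, hence the
      -- split on whether index 0 is the last one.
      generalize h0 : (0 : Fin (N + 1)) = j
      induction j using Fin.lastCases with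
      | last =>
        have h1 := le_max_right M 0
        simp only [Fin.snoc_last]
        linarith
      | cast i => simpa using ham i
    | succ i =>
      rw [← Fin.succ_castSucc]
      simp only [ν, Fin.cons_succ, Fin.snoc_castSucc]
      generalize h0 : i.succ = j
      induction j using Fin.lastCases with
      | last => simpa using hbm i
      | cast k =>
        simp only [Fin.snoc_castSucc]
        apply hμ
        have := congrArg Fin.val h0
        simp only [Fin.val_succ, Fin.val_castSucc] at this
        exact Fin.lt_def.2 (by omega)
  have hs : ∀ j : Fin (N + 2), 0 < (-1 : ℝ) ^ (N + 1 - j : ℕ) * P.eval (ν j) := by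
    intro j
    induction j using Fin.cases with
    | zero => simpa [ν] using ha'
    | succ j =>
      induction j using Fin.lastCases with
      | last => simpa [ν] using hb'
      | cast i =>
        have h1 := mul_pos (hy i) (sign_prod_erase_sub hμ i)
        have h2 : N + 1 - ((i.castSucc.succ : Fin (N + 2)) : ℕ) = (N - 1 - i) + 1 := by
          simp only [Fin.val_succ, Fin.val_castSucc]; omega
        rw [h2]
        simp only [ν, Fin.cons_succ, Fin.snoc_castSucc, hP, eval_borderPoly]
        refine h1.trans_eq ?_
        ring
  have hroot : ∀ j : Fin (N + 1), ∃ z ∈ Set.Ioo (ν j.castSucc) (ν j.succ), P.eval z = 0 := by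
    intro j
    refine exists_root_of_sign_change (hν (Fin.castSucc_lt_succ)) ?_
    have h1 := mul_pos (hs j.castSucc) (hs j.succ)
    have h2 : N + 1 - (j.castSucc : ℕ) = (N + 1 - (j.succ : ℕ)) + 1 := by
      simp only [Fin.val_succ, Fin.val_castSucc]; omega
    rw [h2, pow_succ] at h1
    have h3 : ((-1 : ℝ) ^ (N + 1 - (j.succ : ℕ))) * ((-1 : ℝ) ^ (N + 1 - (j.succ : ℕ))) = 1 := by
      rw [← mul_pow]; simp
    have h4 : ((-1 : ℝ) ^ (N + 1 - (j.succ : ℕ)) * -1 * P.eval (ν j.castSucc)) *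
      ((-1 : ℝ) ^ (N + 1 - (j.succ : ℕ)) * P.eval (ν j.succ)) =
      -(((-1 : ℝ) ^ (N + 1 - (j.succ : ℕ))) * ((-1 : ℝ) ^ (N + 1 - (j.succ : ℕ))) *
        (P.eval (ν j.castSucc) * P.eval (ν j.succ))) := by ring
    rw [h4, h3, one_mul] at h1
    linarith
  choose x hx hx0 using hroot
  have hxI : x ∈ interlacing μ := fun i => by
    constructor
    · simpa [ν] using (hx i.castSucc).2
    · have := (hx i.succ).1
      rw [← Fin.succ_castSucc] at this
      simpa [ν] using this
  refine ⟨x, hxI, borderPoly_injective hμ.injective ?_⟩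
  rw [borderPoly_borderCoord hμ.injective]
  have hdvd : ∏ j, (X - C (x j)) ∣ P :=
    Finset.prod_dvd_of_coprime
      (fun i _ j _ hij =>
        pairwise_coprime_X_sub_C (strictMono_of_mem_interlacing hxI).injective hij)
      fun j _ => dvd_iff_isRoot.2 (hx0 j)
  refine (eq_of_monic_of_dvd_of_natDegree_le (monic_prod_X_sub_C _ _) hm hdvd ?_).symm
  rw [natDegree_prod_of_monic _ _ fun i _ => monic_X_sub_C _, hd]
  simp

/-! ### The Jacobian of the border parameters -/

/-- The Jacobian matrix of `borderCoord μ`. -/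
def borderJacobian {N : ℕ} (μ : Fin N → ℝ) (x : Fin (N + 1) → ℝ) :
    Matrix (Fin (N + 1)) (Fin (N + 1)) ℝ :=
  Matrix.of (Fin.snoc (α := fun _ => Fin (N + 1) → ℝ)
    (fun i m => (∏ k ∈ Finset.univ.erase i, (μ i - μ k))⁻¹ *
      ∏ j ∈ Finset.univ.erase m, (μ i - x j))
    fun _ => 1)

theorem hasFDerivAt_borderCoord {N : ℕ} (μ : Fin N → ℝ) (x : Fin (N + 1) → ℝ) :
    HasFDerivAt (borderCoord μ)
      (LinearMap.toContinuousLinearMap (Matrix.toLin' (borderJacobian μ x))) x := by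
  rw [hasFDerivAt_pi']
  intro j
  induction j using Fin.lastCases with
  | last =>
    simp only [borderCoord, Fin.snoc_last]
    have h : HasFDerivAt (fun x : Fin (N + 1) → ℝ => ∑ j, x j - ∑ i, μ i)
        (∑ j, ContinuousLinearMap.proj (R := ℝ) (φ := fun _ : Fin (N + 1) => ℝ) j) x :=
      (HasFDerivAt.fun_sum fun j _ => hasFDerivAt_apply j x).sub_const _
    refine h.congr_fderiv ?_
    ext v
    simp [borderJacobian, Matrix.mulVec, dotProduct]
  | cast i =>
    simp only [borderCoord, Fin.snoc_castSucc]
    have h := (HasFDerivAt.finsetProd (u := Finset.univ)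
      (g := fun (j : Fin (N + 1)) (x : Fin (N + 1) → ℝ) => μ i - x j)
      (g' := fun j => -ContinuousLinearMap.proj (R := ℝ) (φ := fun _ : Fin (N + 1) => ℝ) j) (x := x)
      fun j _ => (hasFDerivAt_apply (𝕜 := ℝ) (F' := fun _ : Fin (N + 1) => ℝ) j x).const_sub (μ i)).const_mul
        ((-∏ k ∈ Finset.univ.erase i, (μ i - μ k))⁻¹)
    refine h.congr_fderiv ?_
    ext v
    simp [borderJacobian, Matrix.mulVec, dotProduct, Finset.mul_sum, mul_assoc, inv_neg]

/-- Each unordered pair of indices occurs twice, once in each order, with opposite signs. -/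
theorem prod_prod_erase_sub {n : ℕ} (x : Fin n → ℝ) :
    |∏ i, ∏ j ∈ Finset.univ.erase i, (x i - x j)| = |(Matrix.vandermonde x).det| ^ 2 := by
  have h : ∀ i : Fin n, Finset.univ.erase i = Finset.Iio i ∪ Finset.Ioi i := fun i => by
    ext k
    simp [lt_or_lt_iff_ne]
  have hdisj : ∀ i : Fin n, Disjoint (Finset.Iio i) (Finset.Ioi i) := fun i => by
    rw [Finset.disjoint_left]
    intro k hk hk'
    exact lt_asymm (Finset.mem_Iio.1 hk) (Finset.mem_Ioi.1 hk')
  simp only [h, Finset.prod_union (hdisj _), Finset.prod_mul_distrib]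
  have h1 : ∏ i, ∏ j ∈ Finset.Iio i, (x i - x j) = (Matrix.vandermonde x).det := by
    rw [Matrix.det_vandermonde]
    exact Finset.prod_comm' (by simp)
  have h2 : |∏ i, ∏ j ∈ Finset.Ioi i, (x i - x j)| = |(Matrix.vandermonde x).det| := by
    rw [Matrix.det_vandermonde]
    simp only [Finset.abs_prod, abs_sub_comm]
  rw [abs_mul, h1, h2, sq]

/-- The columns of the Jacobian are scaled values at the μ_i of the polynomials ∏_{j ≠ m} (X - x_j).
It thus factors as (row scaling) · (evaluation matrix E) · (coefficient matrix K), with determinants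
of absolute value Δ(μ)⁻², |Δ(μ)| and |Δ(x)|. -/
theorem det_borderJacobian {N : ℕ} {μ : Fin N → ℝ} (hμ : Function.Injective μ)
    {x : Fin (N + 1) → ℝ} (hx : Function.Injective x) :
    |(borderJacobian μ x).det| * |(Matrix.vandermonde μ).det| = |(Matrix.vandermonde x).det| := by
  set Lg : Fin (N + 1) → ℝ[X] := fun m => ∏ j ∈ Finset.univ.erase m, (X - C (x j)) with hLg
  set K : Matrix (Fin (N + 1)) (Fin (N + 1)) ℝ := Matrix.of fun k m => (Lg m).coeff k with hK
  have hdeg : ∀ m, (Lg m).natDegree = N := fun m => by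
    rw [natDegree_prod_of_monic _ _ fun i _ => monic_X_sub_C _]
    simp
  have hmon : ∀ m, (Lg m).coeff N = 1 := fun m => by
    have := (monic_prod_X_sub_C x (Finset.univ.erase m)).coeff_natDegree
    rwa [hdeg m] at this
  have heval : ∀ z m, ∑ k : Fin (N + 1), z ^ (k : ℕ) * (Lg m).coeff k =
      ∏ j ∈ Finset.univ.erase m, (z - x j) := fun z m => by
    rw [Fin.sum_univ_eq_sum_range (fun k => z ^ k * (Lg m).coeff k)]
    have h := eval_eq_sum_range (p := Lg m) z
    rw [hdeg m] at h
    simp only [mul_comm (z ^ _)]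
    rw [← h]
    simp only [hLg, eval_prod, eval_sub, eval_X, eval_C]
  -- Evaluating the same polynomials at the x_i gives a diagonal matrix, of determinant ±Δ(x)²;
  -- dividing by Δ(x) yields |det K|.
  have hdiag : Matrix.vandermonde x * K =
      Matrix.diagonal fun m => ∏ j ∈ Finset.univ.erase m, (x m - x j) := by
    ext i m
    rw [Matrix.mul_apply]
    simp only [Matrix.vandermonde_apply, hK, Matrix.of_apply, heval]
    rcases eq_or_ne i m with rfl | h
    · simp
    · rw [Matrix.diagonal_apply_ne _ h]
      exact Finset.prod_eq_zero (Finset.mem_erase.2 ⟨h, Finset.mem_univ _⟩) (sub_self _)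
  have hV := (Matrix.det_vandermonde_ne_zero_iff.2 hx)
  have hdetK : |K.det| = |(Matrix.vandermonde x).det| := by
    have h := congrArg abs (congrArg Matrix.det hdiag)
    rw [Matrix.det_mul, Matrix.det_diagonal, abs_mul, prod_prod_erase_sub, sq] at h
    exact mul_left_cancel₀ (abs_ne_zero.2 hV) h
  set d : Fin (N + 1) → ℝ := Fin.snoc (α := fun _ => ℝ)
    (fun i => (∏ k ∈ Finset.univ.erase i, (μ i - μ k))⁻¹) 1 with hdd
  -- The last row is the point at infinity (1 : 0): it reads off the leading coefficient, which is 1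
  -- and matches the row of ones coming from the trace.
  set E : Matrix (Fin (N + 1)) (Fin (N + 1)) ℝ :=
    Matrix.projVandermonde (Fin.snoc (α := fun _ => ℝ) μ 1)
      (Fin.snoc (α := fun _ => ℝ) (fun _ => 1) 0) with hE
  have hfac : borderJacobian μ x = Matrix.diagonal d * (E * K) := by
    ext i m
    rw [Matrix.diagonal_mul, Matrix.mul_apply]
    induction i using Fin.lastCases with
    | last =>
      simp only [borderJacobian, Matrix.of_apply, Fin.snoc_last, hdd, hE, hK,
        Matrix.projVandermonde_apply, one_pow, one_mul]
      rw [Finset.sum_eq_single (Fin.last N)]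
      · simp [hmon]
      · intro k _ hk
        have : (Fin.rev k : ℕ) ≠ 0 := by
          intro h0
          apply hk
          ext
          rw [Fin.val_rev] at h0
          simp only [Fin.val_last]
          omega
        rw [zero_pow this, zero_mul]
      · simp
    | cast i =>
      simp only [borderJacobian, Matrix.of_apply, Fin.snoc_castSucc, hdd, hE, hK,
        Matrix.projVandermonde_apply, one_pow, mul_one, heval]
  have hdetE : E.det = (Matrix.vandermonde μ).det := by
    rw [hE, Matrix.det_projVandermonde, Fin.prod_univ_castSucc, Matrix.det_vandermonde]
    have h0 : Finset.Ioi (Fin.last N) = ∅ := by ext; simp [Fin.le_last]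
    rw [h0, Finset.prod_empty, mul_one]
    refine Finset.prod_congr rfl fun i _ => ?_
    have h1 : Finset.Ioi i.castSucc =
        insert (Fin.last N) ((Finset.Ioi i).map Fin.castSuccEmb) := by
      ext k
      induction k using Fin.lastCases <;> simp [Fin.castSucc_lt_last, Fin.le_last]
    rw [h1, Finset.prod_insert (by simp), Finset.prod_map]
    simp
  have hdetd : |∏ i, d i| * |(Matrix.vandermonde μ).det| ^ 2 = 1 := by
    have hne := (Matrix.det_vandermonde_ne_zero_iff.2 hμ)
    rw [Fin.prod_univ_castSucc]
    simp only [hdd, Fin.snoc_castSucc, Fin.snoc_last, mul_one, Finset.prod_inv_distrib]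
    rw [abs_inv, prod_prod_erase_sub]
    exact inv_mul_cancel₀ (pow_ne_zero _ (abs_ne_zero.2 hne))
  rw [hfac, Matrix.det_mul, Matrix.det_mul, Matrix.det_diagonal, abs_mul, abs_mul, hdetE, hdetK]
  linear_combination |(Matrix.vandermonde x).det| * hdetd

/-- Change of variables along `borderCoord μ`. The denominator Δ(μ) of the Jacobian is moved to the
left, which avoids division in `ℝ≥0∞`. -/
theorem lintegral_border {N : ℕ} {μ : Fin N → ℝ} (hμ : StrictMono μ)
    (g : (Fin (N + 1) → ℝ) → ℝ≥0∞) :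
    ENNReal.ofReal (Matrix.vandermonde μ).det * ∫⁻ y in {y | ∀ i : Fin N, 0 < y i.castSucc}, g y =
      ∫⁻ x in interlacing μ,
        ENNReal.ofReal (Matrix.vandermonde x).det * g (borderCoord μ x) := by
  rw [← image_borderCoord hμ, lintegral_image_eq_lintegral_abs_det_fderiv_mul volume
    (isOpen_interlacing μ).measurableSet
    (fun x _ => (hasFDerivAt_borderCoord μ x).hasFDerivWithinAt) (borderCoord_injOn hμ.injective),
    ← lintegral_const_mul' _ _ ENNReal.ofReal_ne_top]
  refine setLIntegral_congr_fun (isOpen_interlacing μ).measurableSet fun x hx => ?_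
  have hm := strictMono_of_mem_interlacing hx
  have h := det_borderJacobian hμ.injective hm.injective
  rw [abs_of_pos (prod_Ioi_sub_pos hμ), abs_of_pos (prod_Ioi_sub_pos hm)] at h
  simp only [ContinuousLinearMap.det, LinearMap.coe_toContinuousLinearMap, LinearMap.det_toLin']
  rw [← mul_assoc, ← ENNReal.ofReal_mul (prod_Ioi_sub_pos hμ).le, mul_comm (Matrix.det _), h]
/-! ### Bordered Hermitian matrices -/

/-- The bordered matrix `[[B, v], [v*, a]]`. -/
def bordMatrix {N : ℕ} (B : Matrix (Fin N) (Fin N) ℂ) (v : Fin N → ℂ) (a : ℝ) :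
    Matrix (Fin (N + 1)) (Fin (N + 1)) ℂ :=
  Matrix.reindex finSumFinEquiv finSumFinEquiv
    (Matrix.fromBlocks B (Matrix.replicateCol (Fin 1) v) (Matrix.replicateRow (Fin 1) (star v))
      (Matrix.diagonal fun _ => (a : ℂ)))

theorem bordMatrix_isHermitian {N : ℕ} {B : Matrix (Fin N) (Fin N) ℂ} (hB : B.IsHermitian)
    (v : Fin N → ℂ) (a : ℝ) : (bordMatrix B v a).IsHermitian := by
  refine Matrix.IsHermitian.submatrix (Matrix.IsHermitian.fromBlocks hB ?_ ?_) _
  · ext; simp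
  · ext i j
    simp [Subsingleton.elim i j]

/-- The coordinates of a bordered matrix. -/
def bordCoord {N : ℕ} (b : HermCoord N) (z : (Fin N → ℂ) × ℝ) : HermCoord (N + 1) :=
  (Fin.snoc (α := fun _ => ℝ) b.1 z.2, fun ij =>
    Fin.lastCases (motive := fun j => ij.1.1 < j → ℂ)
      (fun h => z.1 (ij.1.1.castLT h))
      (fun j h => b.2 ⟨(ij.1.1.castLT (h.trans (Fin.castSucc_lt_last j)), j), h⟩) ij.1.2 ij.2)

theorem toMatrix_bordCoord {N : ℕ} (b : HermCoord N) (z : (Fin N → ℂ) × ℝ) :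
    toMatrix (bordCoord b z) = bordMatrix (toMatrix b) z.1 z.2 := by
  have e : ∀ i : Fin N, finSumFinEquiv.symm i.castSucc = (Sum.inl i : Fin N ⊕ Fin 1) :=
    fun i => finSumFinEquiv_symm_apply_castAdd i
  ext i j
  induction i using Fin.lastCases with
  | last =>
    induction j using Fin.lastCases with
    | last => simp [toMatrix, bordCoord, bordMatrix]
    | cast j =>
      have h : ¬ Fin.last N < j.castSucc := (Fin.castSucc_lt_last j).not_gt
      simp [toMatrix, bordCoord, bordMatrix, h, Fin.castSucc_lt_last, e]
  | cast i =>
    induction j using Fin.lastCases with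
    | last => simp [toMatrix, bordCoord, bordMatrix, Fin.castSucc_lt_last, e]
    | cast j =>
      rcases lt_trichotomy i j with h | h | h
      · simp [toMatrix, bordCoord, bordMatrix, e, h]
      · subst h
        simp [toMatrix, bordCoord, bordMatrix, e]
      · simp [toMatrix, bordCoord, bordMatrix, e, h, h.not_gt]

/-- The pairs `i < j` in `Fin (N + 1)`: either `j` is not the last index, or it is. -/
def upperPairEquiv (N : ℕ) :
    {ij : Fin N × Fin N // ij.1 < ij.2} ⊕ Fin N ≃
      {ij : Fin (N + 1) × Fin (N + 1) // ij.1 < ij.2} :=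
  Equiv.ofBijective
    (Sum.elim (fun ij => ⟨(ij.1.1.castSucc, ij.1.2.castSucc), ij.2⟩)
      fun i => ⟨(i.castSucc, Fin.last N), Fin.castSucc_lt_last i⟩) <| by
    constructor
    · rintro (⟨⟨i, j⟩, h⟩ | i) (⟨⟨i', j'⟩, h'⟩ | i') he
      · simpa using he
      · simp [(Fin.castSucc_lt_last _).ne] at he
      · simp [(Fin.castSucc_lt_last _).ne'] at he
      · simpa using he
    · rintro ⟨⟨i, j⟩, h⟩
      have hi : i < Fin.last N := lt_of_lt_of_le h (Fin.le_last j)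
      obtain ⟨i, rfl⟩ := Fin.exists_castSucc_eq.2 hi.ne
      induction j using Fin.lastCases with
      | last => exact ⟨Sum.inr i, rfl⟩
      | cast j => exact ⟨Sum.inl ⟨(i, j), h⟩, rfl⟩

theorem measurePreserving_bordCoord (N : ℕ) :
    MeasurePreserving (fun w : HermCoord N × ((Fin N → ℂ) × ℝ) => bordCoord w.1 w.2)
      volume volume := by
  have h1 := (MeasurePreserving.symm _
    (volume_preserving_piFinSuccAbove (fun _ : Fin (N + 1) => ℝ) (Fin.last N)))
  have h2 := (volume_measurePreserving_piCongrLeft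
    (fun _ : {ij : Fin (N + 1) × Fin (N + 1) // ij.1 < ij.2} => ℂ) (upperPairEquiv N)).comp
      (volume_measurePreserving_sumPiEquivProdPi_symm (fun _ => ℂ))
  -- Only a regrouping of product factors: the corner joins the old diagonal, and the border vector
  -- joins the old off-diagonal entries.
  have s1 : MeasurePreserving (fun w : HermCoord N × ((Fin N → ℂ) × ℝ) =>
      ((w.2.2, w.1.1), (w.1.2, w.2.1))) volume volume := by
    have a1 := volume_preserving_prodAssoc (α₁ := Fin N → ℝ)
      (β₁ := {ij : Fin N × Fin N // ij.1 < ij.2} → ℂ) (γ₁ := (Fin N → ℂ) × ℝ)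
    have a2 := (MeasurePreserving.id (volume : Measure (Fin N → ℝ))).prod
      (MeasurePreserving.symm _ (volume_preserving_prodAssoc
        (α₁ := {ij : Fin N × Fin N // ij.1 < ij.2} → ℂ) (β₁ := Fin N → ℂ) (γ₁ := ℝ)))
    have a3 := (MeasurePreserving.id (volume : Measure (Fin N → ℝ))).prod
      (Measure.measurePreserving_swap
        (μ := (volume : Measure (({ij : Fin N × Fin N // ij.1 < ij.2} → ℂ) × (Fin N → ℂ))))
        (ν := (volume : Measure ℝ)))
    have a4 := MeasurePreserving.symm _ (volume_preserving_prodAssoc (α₁ := Fin N → ℝ)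
      (β₁ := ℝ) (γ₁ := ({ij : Fin N × Fin N // ij.1 < ij.2} → ℂ) × (Fin N → ℂ)))
    have a5 := (Measure.measurePreserving_swap (μ := (volume : Measure (Fin N → ℝ)))
        (ν := (volume : Measure ℝ))).prod (MeasurePreserving.id
        (volume : Measure (({ij : Fin N × Fin N // ij.1 < ij.2} → ℂ) × (Fin N → ℂ))))
    exact a5.comp (a4.comp (a3.comp (a2.comp a1)))
  have key := (h1.prod h2).comp s1
  have he : (fun w : HermCoord N × ((Fin N → ℂ) × ℝ) => bordCoord w.1 w.2) =
      (Prod.map (MeasurableEquiv.piFinSuccAbove (fun _ : Fin (N + 1) => ℝ) (Fin.last N)).symm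
        (MeasurableEquiv.piCongrLeft
            (fun _ : {ij : Fin (N + 1) × Fin (N + 1) // ij.1 < ij.2} => ℂ) (upperPairEquiv N) ∘
          (MeasurableEquiv.sumPiEquivProdPi fun _ => ℂ).symm)) ∘
        fun w => ((w.2.2, w.1.1), (w.1.2, w.2.1)) := by
    funext w
    refine Prod.ext ?_ ?_
    · funext j
      induction j using Fin.lastCases <;> simp [bordCoord, MeasurableEquiv.piFinSuccAbove]
    · funext ij
      obtain ⟨k, rfl⟩ := (upperPairEquiv N).surjective ij
      simp only [Function.comp_apply, Prod.map_snd, MeasurableEquiv.piCongrLeft,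
        MeasurableEquiv.coe_mk, Equiv.piCongrLeft_apply_apply]
      rcases k with k | k
      · change (bordCoord w.1 w.2).2 ⟨(k.1.1.castSucc, k.1.2.castSucc), k.2⟩ = w.1.2 k
        simp [bordCoord]
      · change (bordCoord w.1 w.2).2 ⟨(k.castSucc, Fin.last N), Fin.castSucc_lt_last k⟩ = w.2.1 k
        simp [bordCoord]
  rw [he]
  exact key

theorem charpoly_conj_unitary {n : Type*} [Fintype n] [DecidableEq n] (W M : Matrix n n ℂ)
    (hW : Wᴴ * W = 1) : (W * M * Wᴴ).charpoly = M.charpoly := by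
  rw [Matrix.charpoly_mul_comm, ← mul_assoc, hW, one_mul]

/-- Conjugation by the unitary diag(U, 1) moves U from the block to the border vector. -/
theorem charpoly_bordMatrix_conj {N : ℕ} {U : Matrix (Fin N) (Fin N) ℂ} (hU : Uᴴ * U = 1)
    (B : Matrix (Fin N) (Fin N) ℂ) (v : Fin N → ℂ) (a : ℝ) :
    (bordMatrix (U * B * Uᴴ) v a).charpoly = (bordMatrix B (Uᴴ *ᵥ v) a).charpoly := by
  have hU' : U * Uᴴ = 1 := mul_eq_one_comm.1 hU
  rw [bordMatrix, bordMatrix, Matrix.charpoly_reindex, Matrix.charpoly_reindex]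
  have hW : (Matrix.fromBlocks U 0 0 (1 : Matrix (Fin 1) (Fin 1) ℂ))ᴴ *
      Matrix.fromBlocks U 0 0 1 = 1 := by
    simp [Matrix.fromBlocks_conjTranspose, Matrix.fromBlocks_multiply, hU]
  have hv : v = U *ᵥ (Uᴴ *ᵥ v) := by rw [Matrix.mulVec_mulVec, hU', Matrix.one_mulVec]
  rw [← charpoly_conj_unitary _ (Matrix.fromBlocks B _ _ _) hW]
  congr 1
  simp only [Matrix.fromBlocks_conjTranspose, Matrix.fromBlocks_multiply, Matrix.zero_mul,
    Matrix.mul_zero, add_zero, zero_add, Matrix.conjTranspose_zero, Matrix.conjTranspose_one,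
    Matrix.one_mul, Matrix.mul_one]
  congr 1
  · conv_lhs => rw [hv]
    rfl
  · conv_lhs => rw [hv]
    ext i j
    simp only [Matrix.replicateRow_apply, Pi.star_apply, Matrix.mul_apply,
      Matrix.conjTranspose_apply]
    rw [Matrix.mulVec, dotProduct, star_sum]
    exact Finset.sum_congr rfl fun k _ => by rw [star_mul', mul_comm]

/-- Schur complement of z - diag(μ), valid for z outside the μ_i; the remaining infinitely many z
determine a polynomial identity. -/
theorem charpoly_bordMatrix_diagonal {N : ℕ} (μ : Fin N → ℝ) (v : Fin N → ℂ) (a : ℝ) :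
    (bordMatrix (Matrix.diagonal fun i => (μ i : ℂ)) v a).charpoly =
      (borderPoly μ (Fin.snoc (α := fun _ => ℝ) (fun i => Complex.normSq (v i)) a)).map
        (algebraMap ℝ ℂ) := by
  refine eq_of_infinite_eval_eq _ _ (Set.Infinite.mono (s := (Set.range fun i => (μ i : ℂ))ᶜ) ?_
    (Set.finite_range _).infinite_compl)
  intro z hz
  have hz' : ∀ i, z - μ i ≠ 0 := fun i h => hz ⟨i, (sub_eq_zero.1 h).symm⟩
  have hs : Matrix.scalar (Fin N ⊕ Fin 1) z - Matrix.fromBlocks (Matrix.diagonal fun i => (μ i : ℂ))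
      (Matrix.replicateCol (Fin 1) v) (Matrix.replicateRow (Fin 1) (star v))
      (Matrix.diagonal fun _ => (a : ℂ)) =
      Matrix.fromBlocks (Matrix.diagonal fun i => z - μ i) (-Matrix.replicateCol (Fin 1) v)
        (-Matrix.replicateRow (Fin 1) (star v)) (Matrix.diagonal fun _ => z - (a : ℂ)) := by
    ext (i | i) (j | j)
    · by_cases h : i = j <;> simp [h]
    · simp
    · simp
    · simp [Subsingleton.elim i j]
  let : Invertible (Matrix.diagonal fun i => z - (μ i : ℂ)) :=
    ⟨Matrix.diagonal fun i => (z - (μ i : ℂ))⁻¹, by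
      rw [Matrix.diagonal_mul_diagonal, ← Matrix.diagonal_one]
      exact congrArg _ (funext fun i => inv_mul_cancel₀ (hz' i)), by
      rw [Matrix.diagonal_mul_diagonal, ← Matrix.diagonal_one]
      exact congrArg _ (funext fun i => mul_inv_cancel₀ (hz' i))⟩
  have hinv : ⅟(Matrix.diagonal fun i => z - (μ i : ℂ)) =
    Matrix.diagonal fun i => (z - (μ i : ℂ))⁻¹ := rfl
  change eval z _ = eval z _
  rw [bordMatrix, Matrix.charpoly_reindex, Matrix.eval_charpoly, hs, Matrix.det_fromBlocks₁₁,
    Matrix.det_diagonal, hinv, Matrix.det_fin_one]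
  have hsum : ((-Matrix.replicateRow (Fin 1) (star v) * (Matrix.diagonal fun i => (z - (μ i : ℂ))⁻¹) *
      -Matrix.replicateCol (Fin 1) v) : Matrix (Fin 1) (Fin 1) ℂ) 0 0 =
      ∑ i, (Complex.normSq (v i) : ℂ) * (z - μ i)⁻¹ := by
    rw [Matrix.mul_apply]
    refine Finset.sum_congr rfl fun i _ => ?_
    rw [Matrix.mul_diagonal]
    simp only [Matrix.neg_apply, Matrix.replicateRow_apply, Matrix.replicateCol_apply,
      Pi.star_apply, Complex.normSq_eq_conj_mul_self]
    simp only [RCLike.star_def]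
    ring
  rw [Matrix.sub_apply, hsum, Matrix.diagonal_apply_eq]
  simp only [borderPoly, Polynomial.map_sub, Polynomial.map_mul, Polynomial.map_prod,
    Polynomial.map_sum, map_X, map_C, eval_sub, eval_mul, eval_prod, eval_finsetSum, eval_X, eval_C,
    Fin.snoc_last, Fin.snoc_castSucc, Complex.coe_algebraMap]
  rw [mul_sub, Finset.mul_sum, mul_comm (z - (a : ℂ))]
  congr 1
  refine Finset.sum_congr rfl fun i _ => ?_
  rw [← Finset.mul_prod_erase Finset.univ _ (Finset.mem_univ i)]
  have := hz' i
  field_simp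

/-! ### Pushforward of Lebesgue measure under squared moduli -/

/-- In polar coordinates with s = r², the element r dr dθ is ds dθ/2, and θ ranges over an interval
of length 2π. -/
theorem lintegral_comp_normSq {f : ℝ → ℝ≥0∞} (hf : Measurable f) :
    ∫⁻ z : ℂ, f (Complex.normSq z) = ENNReal.ofReal Real.pi * ∫⁻ r in Set.Ioi (0 : ℝ), f r := by
  have himg : (fun r : ℝ => r ^ 2) '' Set.Ioi 0 = Set.Ioi 0 := by
    ext r
    constructor
    · rintro ⟨s, hs, rfl⟩
      exact pow_pos (Set.mem_Ioi.1 hs) 2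
    · intro hr
      exact ⟨√r, Real.sqrt_pos.2 hr, Real.sq_sqrt (le_of_lt hr)⟩
  have hcv := lintegral_image_eq_lintegral_abs_deriv_mul (s := Set.Ioi (0 : ℝ))
    (f := fun r : ℝ => r ^ 2) (f' := fun r => 2 * r) measurableSet_Ioi
    (fun x _ => by simpa using (hasDerivAt_pow 2 x).hasDerivWithinAt)
    (fun x hx y hy h => (sq_eq_sq₀ (le_of_lt hx) (le_of_lt hy)).1 h) f
  rw [himg] at hcv
  rw [hcv, ← Complex.lintegral_comp_polarCoord_symm, polarCoord_target, Measure.volume_eq_prod,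
    ← Measure.prod_restrict, lintegral_prod]
  · have hn : ∀ r θ : ℝ, Complex.normSq (Complex.polarCoord.symm (r, θ)) = r ^ 2 := fun r θ => by
      rw [Complex.normSq_eq_norm_sq, Complex.norm_polarCoord_symm, sq_abs]
    simp only [hn, lintegral_const, Measure.restrict_apply_univ, Real.volume_Ioo, smul_eq_mul]
    rw [← lintegral_const_mul _ (by fun_prop)]
    refine setLIntegral_congr_fun measurableSet_Ioi fun r hr => ?_
    have hr' : (0 : ℝ) < r := hr
    have h2 : ENNReal.ofReal r * ENNReal.ofReal (Real.pi - -Real.pi) =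
        ENNReal.ofReal Real.pi * ENNReal.ofReal |2 * r| := by
      rw [← ENNReal.ofReal_mul hr'.le, ← ENNReal.ofReal_mul Real.pi_pos.le,
        abs_of_pos (by positivity)]
      congr 1
      ring
    calc ENNReal.ofReal r * f (r ^ 2) * ENNReal.ofReal (Real.pi - -Real.pi)
        = (ENNReal.ofReal r * ENNReal.ofReal (Real.pi - -Real.pi)) * f (r ^ 2) := by ring
      _ = _ := by rw [h2, mul_assoc]
  · have : Measurable fun p : ℝ × ℝ => Complex.polarCoord.symm p := by
      simp only [Complex.polarCoord_symm_apply]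
      fun_prop
    have hn : Measurable Complex.normSq := Complex.continuous_normSq.measurable
    exact (ENNReal.measurable_ofReal.comp measurable_fst).mul
      (hf.comp (hn.comp this)) |>.aemeasurable

theorem map_normSq_volume : Measure.map Complex.normSq volume =
    ENNReal.ofReal Real.pi • (volume : Measure ℝ).restrict (Set.Ioi 0) := by
  have hn : Measurable Complex.normSq := Complex.continuous_normSq.measurable
  ext s hs
  rw [← lintegral_indicator_one hs, lintegral_map (measurable_one.indicator hs) hn,
    lintegral_comp_normSq (measurable_one.indicator hs), lintegral_indicator_one hs,
    Measure.smul_apply, smul_eq_mul]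

theorem map_pi_normSq_volume (N : ℕ) :
    Measure.map (fun (v : Fin N → ℂ) i => Complex.normSq (v i)) volume =
      ENNReal.ofReal Real.pi ^ N •
        (volume : Measure (Fin N → ℝ)).restrict (Set.univ.pi fun _ => Set.Ioi 0) := by
  have hn : Measurable Complex.normSq := Complex.continuous_normSq.measurable
  have : SigmaFinite (Measure.map Complex.normSq volume) := by
    rw [map_normSq_volume]
    exact SMul.sigmaFinite (Real.toNNReal Real.pi)
  rw [volume_pi, Measure.pi_map_pi (fun _ => hn.aemeasurable)]
  refine Measure.pi_eq fun s hs => ?_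
  rw [Measure.smul_apply, volume_pi, Measure.restrict_pi_pi, Measure.pi_pi, map_normSq_volume]
  simp [Finset.prod_mul_distrib]

theorem lintegral_border_normSq {N : ℕ} {g : (Fin (N + 1) → ℝ) → ℝ≥0∞} (hg : Measurable g) :
    ∫⁻ z : (Fin N → ℂ) × ℝ,
        g (Fin.snoc (α := fun _ => ℝ) (fun i => Complex.normSq (z.1 i)) z.2) =
      ENNReal.ofReal Real.pi ^ N * ∫⁻ y in {y | ∀ i : Fin N, 0 < y i.castSucc}, g y := by
  have hsn : Measurable fun w : (Fin N → ℝ) × ℝ => Fin.snoc (α := fun _ => ℝ) w.1 w.2 := by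
    refine measurable_pi_lambda _ fun j => ?_
    induction j using Fin.lastCases with
    | last => simpa using measurable_snd
    | cast i => simpa using (measurable_pi_apply i).fun_comp measurable_fst
  have hn : Measurable fun (v : Fin N → ℂ) i => Complex.normSq (v i) :=
    (continuous_pi fun i => Complex.continuous_normSq.comp (continuous_apply i)).measurable
  have hS : MeasurableSet (Set.univ.pi fun _ : Fin N => Set.Ioi (0 : ℝ)) :=
    MeasurableSet.univ_pi fun _ => measurableSet_Ioi
  have hT : MeasurableSet {y : Fin (N + 1) → ℝ | ∀ i : Fin N, 0 < y i.castSucc} := by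
    simp only [Set.ofPred_forall]
    exact MeasurableSet.iInter fun i => measurableSet_lt measurable_const (measurable_pi_apply _)
  have hmp := MeasurePreserving.symm _
    (volume_preserving_piFinSuccAbove (fun _ : Fin (N + 1) => ℝ) (Fin.last N))
  have hswap : ∀ w : ℝ × (Fin N → ℝ),
      (MeasurableEquiv.piFinSuccAbove (fun _ : Fin (N + 1) => ℝ) (Fin.last N)).symm w =
        Fin.snoc (α := fun _ => ℝ) w.2 w.1 := fun w => by
    ext j
    induction j using Fin.lastCases <;> simp [MeasurableEquiv.piFinSuccAbove]
  rw [Measure.volume_eq_prod, lintegral_prod_symm']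
  swap
  · exact hg.comp (hsn.comp ((hn.comp measurable_fst).prodMk measurable_snd))
  have h1 : ∀ a : ℝ, ∫⁻ v : Fin N → ℂ,
      g (Fin.snoc (α := fun _ => ℝ) (fun i => Complex.normSq (v i)) a) =
      ENNReal.ofReal Real.pi ^ N * ∫⁻ r : Fin N → ℝ, (Set.univ.pi fun _ => Set.Ioi 0).indicator
        (fun r => g (Fin.snoc (α := fun _ => ℝ) r a)) r := fun a => by
    have hm : Measurable fun r : Fin N → ℝ => g (Fin.snoc (α := fun _ => ℝ) r a) :=
      hg.comp (hsn.comp (measurable_id.prodMk measurable_const))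
    rw [lintegral_indicator hS, ← smul_eq_mul, ← lintegral_smul_measure, ← map_pi_normSq_volume,
      lintegral_map hm hn]
  simp only [h1]
  have hind : ∀ (a : ℝ) (r : Fin N → ℝ), (Set.univ.pi fun _ => Set.Ioi 0).indicator
      (fun r => g (Fin.snoc (α := fun _ => ℝ) r a)) r =
      {y : Fin (N + 1) → ℝ | ∀ i : Fin N, 0 < y i.castSucc}.indicator g
        (Fin.snoc (α := fun _ => ℝ) r a) := fun a r => by
    by_cases h : ∀ i, 0 < r i
    · rw [Set.indicator_of_mem (by simpa using h), Set.indicator_of_mem (by simpa using h)]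
    · rw [Set.indicator_of_notMem (by simpa using h), Set.indicator_of_notMem (by simpa using h)]
  simp only [hind]
  have hgi := hg.indicator hT
  rw [lintegral_const_mul', ← lintegral_indicator hT, ← hmp.lintegral_comp hgi,
    Measure.volume_eq_prod, lintegral_prod]
  · simp only [hswap]
  · simp only [hswap]
    exact (hgi.comp (hsn.comp (measurable_snd.prodMk measurable_fst))).aemeasurable
  · exact ENNReal.pow_ne_top ENNReal.ofReal_ne_top

/-- The real determinant of a complex linear map is the squared modulus of its complex determinant,
here 1. -/
theorem measurePreserving_mulVec_unitary {N : ℕ} {U : Matrix (Fin N) (Fin N) ℂ}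
    (hU : Uᴴ * U = 1) : MeasurePreserving (fun v : Fin N → ℂ => U *ᵥ v) volume volume := by
  have hdet : LinearMap.det ((Matrix.toLin' U).restrictScalars ℝ) = 1 := by
    rw [LinearMap.det_restrictScalars, LinearMap.det_toLin', Algebra.norm_complex_apply]
    have := congrArg Matrix.det hU
    rw [Matrix.det_mul, Matrix.det_conjTranspose, Matrix.det_one] at this
    exact_mod_cast (Complex.normSq_eq_conj_mul_self).trans this
  refine ⟨?_, ?_⟩
  · exact (Continuous.matrix_mulVec continuous_const continuous_id).measurable
  · have := Measure.map_linearMap_addHaar_eq_smul_addHaar (volume : Measure (Fin N → ℂ))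
      (f := (Matrix.toLin' U).restrictScalars ℝ) (by rw [hdet]; exact one_ne_zero)
    rw [hdet, inv_one, abs_one, ENNReal.ofReal_one, one_smul] at this
    exact this
/-! ### Integration over interlacing points -/

/-- Subtracting from each row of the Vandermonde matrix its predecessor clears the column of ones
below its first entry; expand along that column. -/
theorem det_sub_pred_pow {N : ℕ} (x : Fin (N + 1) → ℝ) :
    (Matrix.of fun i j : Fin N => x i.succ ^ (j + 1 : ℕ) - x i.castSucc ^ (j + 1 : ℕ)).det =
      (Matrix.vandermonde x).det := by
  set B : Matrix (Fin (N + 1)) (Fin (N + 1)) ℝ := Matrix.of (Fin.cons (fun j => x 0 ^ (j : ℕ))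
    fun i j => x i.succ ^ (j : ℕ) - x i.castSucc ^ (j : ℕ)) with hB
  have h : (Matrix.vandermonde x).det = B.det :=
    Matrix.det_eq_of_forall_row_eq_smul_add_pred (fun _ => 1) (fun j => by simp [hB])
      fun i j => by simp [hB]
  rw [h, Matrix.det_succ_column_zero, Fin.sum_univ_succ, Finset.sum_eq_zero fun i _ => by
    simp [hB]]
  simp only [hB, Fin.val_zero, pow_zero, Matrix.of_apply, Fin.cons_zero, mul_one, one_mul,
    Fin.succAbove_zero, add_zero]
  rfl

/-- The admissible μ form a box. By Leibniz and Fubini, column j of the Vandermonde matrix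
integrates to differences of powers j + 1 divided by j + 1; the divisors multiply to N!, and the
rest is `det_sub_pred_pow`. -/
theorem lintegral_vandermonde_interlacing {N : ℕ} {x : Fin (N + 1) → ℝ} (hx : StrictMono x) :
    ∫⁻ μ in {μ : Fin N → ℝ | x ∈ interlacing μ}, ENNReal.ofReal (Matrix.vandermonde μ).det =
      ENNReal.ofReal ((Matrix.vandermonde x).det / N.factorial) := by
  have hset : {μ : Fin N → ℝ | x ∈ interlacing μ} =
      Set.univ.pi fun i : Fin N => Set.Ioo (x i.castSucc) (x i.succ) := by
    ext μ
    simp [interlacing, Set.mem_pi]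
  have hmeas : MeasurableSet {μ : Fin N → ℝ | x ∈ interlacing μ} := by
    rw [hset]
    exact MeasurableSet.univ_pi fun _ => measurableSet_Ioo
  have hm1 : ∀ (i : Fin N) (k : ℕ),
      Integrable (fun t : ℝ => t ^ k) (volume.restrict (Set.Ioo (x i.castSucc) (x i.succ))) :=
    fun i k => ((continuous_pow k).continuousOn.integrableOn_compact isCompact_Icc).mono_set
      Set.Ioo_subset_Icc_self
  have hm2 : ∀ (i : Fin N) (k : ℕ), ∫ t in Set.Ioo (x i.castSucc) (x i.succ), t ^ k =
      (x i.succ ^ (k + 1) - x i.castSucc ^ (k + 1)) / (k + 1) := fun i k => by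
    rw [← integral_Ioc_eq_integral_Ioo,
      ← intervalIntegral.integral_of_le (hx Fin.castSucc_lt_succ).le, integral_pow]
  have hrestr : (volume : Measure (Fin N → ℝ)).restrict {μ | x ∈ interlacing μ} =
      Measure.pi fun i => (volume : Measure ℝ).restrict (Set.Ioo (x i.castSucc) (x i.succ)) := by
    rw [hset, volume_pi, Measure.restrict_pi_pi]
  have hdet : ∀ μ : Fin N → ℝ, (Matrix.vandermonde μ).det =
      ∑ σ : Equiv.Perm (Fin N), ((Equiv.Perm.sign σ : ℤ) : ℝ) * ∏ i, μ i ^ (σ i : ℕ) := fun μ => by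
    rw [← Matrix.det_transpose, Matrix.det_apply']
    rfl
  have hint : ∀ σ : Equiv.Perm (Fin N), Integrable (fun μ : Fin N → ℝ =>
      ((Equiv.Perm.sign σ : ℤ) : ℝ) * ∏ i, μ i ^ (σ i : ℕ)) (Measure.pi fun i : Fin N =>
        (volume : Measure ℝ).restrict (Set.Ioo (x i.castSucc) (x i.succ))) := fun σ =>
    (Integrable.fintype_prod_dep (f := fun (i : Fin N) (t : ℝ) => t ^ (σ i : ℕ))
      fun i => hm1 i _).const_mul _
  rw [← ofReal_integral_eq_lintegral_ofReal]
  · congr 1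
    rw [hrestr]
    simp only [hdet]
    rw [integral_finsetSum _ fun σ _ => hint σ]
    simp only [integral_const_mul]
    have hp : ∀ σ : Equiv.Perm (Fin N), ∫ μ : Fin N → ℝ, ∏ i, μ i ^ (σ i : ℕ) ∂(Measure.pi
        fun i : Fin N => (volume : Measure ℝ).restrict (Set.Ioo (x i.castSucc) (x i.succ))) =
        (∏ i : Fin N, (x i.succ ^ ((σ i : ℕ) + 1) - x i.castSucc ^ ((σ i : ℕ) + 1))) *
          (N.factorial : ℝ)⁻¹ := fun σ => by
      rw [integral_fintype_prod_eq_prod (fun (i : Fin N) (t : ℝ) => t ^ (σ i : ℕ))]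
      simp only [hm2, div_eq_mul_inv, Finset.prod_mul_distrib]
      congr 1
      rw [Equiv.prod_comp σ fun i : Fin N => ((i : ℕ) + 1 : ℝ)⁻¹, Finset.prod_inv_distrib,
        Fin.prod_univ_eq_prod_range (fun i => (i + 1 : ℝ)) N, ← Finset.prod_range_add_one_eq_factorial]
      push_cast
      rfl
    simp only [hp, ← mul_assoc, ← Finset.sum_mul]
    rw [div_eq_mul_inv, ← det_sub_pred_pow, ← Matrix.det_transpose, Matrix.det_apply']
    rfl
  · rw [hrestr]
    simp only [hdet]
    exact integrable_finsetSum _ fun σ _ => hint σ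
  · exact (ae_restrict_iff' hmeas).2 (Filter.Eventually.of_forall fun μ hμ =>
      (prod_Ioi_sub_pos (strictMono_of_interlacing hμ)).le)

/-! ### Integration of class functions over Hermitian matrices -/

/-- A measurable function of Hermitian matrices that depends only on the characteristic
polynomial. -/
structure IsClassFun {N : ℕ} (F : Matrix (Fin N) (Fin N) ℂ → ℝ≥0∞) : Prop where
  measurable : Measurable fun c : HermCoord N => F (toMatrix c)
  congr_charpoly : ∀ A B : Matrix (Fin N) (Fin N) ℂ, A.IsHermitian → B.IsHermitian →
    A.charpoly = B.charpoly → F A = F B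

theorem toMatrix_diagonal {N : ℕ} (x : Fin N → ℝ) :
    toMatrix (x, 0) = Matrix.diagonal fun i => (x i : ℂ) := by
  ext i j
  rcases lt_trichotomy i j with h | h | h
  · simp [toMatrix, h, h.ne]
  · subst h
    simp [toMatrix]
  · simp [toMatrix, h, h.not_gt, h.ne']

theorem exists_toMatrix_eq {N : ℕ} {A : Matrix (Fin N) (Fin N) ℂ} (hA : A.IsHermitian) :
    ∃ c : HermCoord N, toMatrix c = A := by
  refine ⟨(fun i => (A i i).re, fun ij => A ij.1.1 ij.1.2), ?_⟩
  ext i j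
  rcases lt_trichotomy i j with h | h | h
  · simp [toMatrix, h]
  · subst h
    simpa [toMatrix] using hA.coe_re_apply_self i
  · simpa [toMatrix, h, h.not_gt] using hA.apply i j

theorem isHermitian_diagonal_ofReal {N : ℕ} (x : Fin N → ℝ) :
    (Matrix.diagonal fun i => (x i : ℂ)).IsHermitian := by
  rw [← toMatrix_diagonal]
  exact toMatrix_isHermitian _

theorem measurable_vandermonde_det {N : ℕ} :
    Measurable fun x : Fin N → ℝ => (Matrix.vandermonde x).det := by
  simp only [Matrix.det_vandermonde]
  fun_prop

theorem IsClassFun.measurable_diagonal {N : ℕ} {F : Matrix (Fin N) (Fin N) ℂ → ℝ≥0∞}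
    (hF : IsClassFun F) : Measurable fun x : Fin N → ℝ => F (Matrix.diagonal fun i => (x i : ℂ)) := by
  simp only [← toMatrix_diagonal]
  exact hF.measurable.comp (measurable_id.prodMk measurable_const)

theorem IsClassFun.measurable_bordMatrix {N : ℕ} {F : Matrix (Fin (N + 1)) (Fin (N + 1)) ℂ → ℝ≥0∞}
    (hF : IsClassFun F) : Measurable fun w : HermCoord N × ((Fin N → ℂ) × ℝ) =>
      F (bordMatrix (toMatrix w.1) w.2.1 w.2.2) := by
  simp only [← toMatrix_bordCoord]
  exact hF.measurable.comp (measurePreserving_bordCoord N).measurable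

theorem IsClassFun.measurable_bordMatrix_comp {N : ℕ}
    {F : Matrix (Fin (N + 1)) (Fin (N + 1)) ℂ → ℝ≥0∞} (hF : IsClassFun F) {α : Type*}
    [MeasurableSpace α] (b : HermCoord N) {v : α → Fin N → ℂ} {a : α → ℝ} (hv : Measurable v)
    (ha : Measurable a) : Measurable fun t => F (bordMatrix (toMatrix b) (v t) (a t)) := by
  have h : Measurable fun t => (b, v t, a t) := measurable_const.prodMk (hv.prodMk ha)
  have := hF.measurable_bordMatrix.comp h
  exact this

/-- Equal characteristic polynomials give the same ordered eigenvalues, so both matrices diagonalize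
to the same D and the eigenvector unitaries compose. -/
theorem exists_unitary_conj {N : ℕ} {A B : Matrix (Fin N) (Fin N) ℂ} (hA : A.IsHermitian)
    (hB : B.IsHermitian) (h : A.charpoly = B.charpoly) :
    ∃ U : Matrix (Fin N) (Fin N) ℂ, Uᴴ * U = 1 ∧ A = U * B * Uᴴ := by
  have he := (hA.eigenvalues_eq_eigenvalues_iff hB).2 h
  have h1 := hA.spectral_theorem
  have h2 := hB.spectral_theorem
  rw [Unitary.conjStarAlgAut_apply] at h1 h2
  rw [he] at h1
  set D : Matrix (Fin N) (Fin N) ℂ := Matrix.diagonal (RCLike.ofReal ∘ hB.eigenvalues)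
  set P : Matrix (Fin N) (Fin N) ℂ := (hA.eigenvectorUnitary : Matrix (Fin N) (Fin N) ℂ)
  set Q : Matrix (Fin N) (Fin N) ℂ := (hB.eigenvectorUnitary : Matrix (Fin N) (Fin N) ℂ)
  have hP : Pᴴ * P = 1 := Unitary.coe_star_mul_self hA.eigenvectorUnitary
  have hQ : Qᴴ * Q = 1 := Unitary.coe_star_mul_self hB.eigenvectorUnitary
  have hQ' : Q * Qᴴ = 1 := mul_eq_one_comm.1 hQ
  refine ⟨P * Qᴴ, ?_, ?_⟩
  · rw [Matrix.conjTranspose_mul, Matrix.conjTranspose_conjTranspose, mul_assoc,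
      ← mul_assoc Pᴴ, hP, one_mul, hQ']
  · have h3 : Qᴴ * B * Q = D := by
      conv_lhs => rw [h2]
      rw [Matrix.star_eq_conjTranspose, ← mul_assoc, ← mul_assoc, hQ, one_mul, mul_assoc, hQ, mul_one]
    rw [Matrix.conjTranspose_mul, Matrix.conjTranspose_conjTranspose]
    conv_lhs => rw [h1, ← h3]
    simp only [Matrix.star_eq_conjTranspose, mul_assoc]

/-- Integration over the last row and column turns a class function into a class function. -/
theorem IsClassFun.lintegral_bordMatrix {N : ℕ} {F : Matrix (Fin (N + 1)) (Fin (N + 1)) ℂ → ℝ≥0∞}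
    (hF : IsClassFun F) :
    IsClassFun fun B => ∫⁻ z : (Fin N → ℂ) × ℝ, F (bordMatrix B z.1 z.2) := by
  refine ⟨hF.measurable_bordMatrix.lintegral_prod_right', fun A B hA hB h => ?_⟩
  obtain ⟨U, hU, rfl⟩ := exists_unitary_conj hA hB h
  obtain ⟨b, rfl⟩ := exists_toMatrix_eq hB
  have hU' : Uᴴᴴ * Uᴴ = 1 := by
    rw [Matrix.conjTranspose_conjTranspose]
    exact mul_eq_one_comm.1 hU
  -- The substitution v ↦ Uᴴ v absorbs the conjugating unitary.
  have hmp := (measurePreserving_mulVec_unitary hU').prod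
    (MeasurePreserving.id (volume : Measure ℝ))
  have hm : Measurable fun z : (Fin N → ℂ) × ℝ => F (bordMatrix (toMatrix b) z.1 z.2) :=
    hF.measurable_bordMatrix_comp b measurable_fst measurable_snd
  have := hmp.lintegral_comp hm
  rw [Measure.volume_eq_prod, ← this]
  refine lintegral_congr fun z => ?_
  exact hF.congr_charpoly _ _ (bordMatrix_isHermitian hA _ _)
    (bordMatrix_isHermitian hB _ _) (charpoly_bordMatrix_conj hU _ _ _)

/-- Inductive step over a fixed spectrum μ: of the factor Δ(μ)² supplied by induction, one Δ(μ) is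
traded for Δ(x) through the Jacobian and the other survives for the integration over μ. -/
theorem IsClassFun.lintegral_bordMatrix_diagonal {N : ℕ}
    {F : Matrix (Fin (N + 1)) (Fin (N + 1)) ℂ → ℝ≥0∞} (hF : IsClassFun F)
    {μ : Fin N → ℝ} (hμ : StrictMono μ) :
    ENNReal.ofReal ((Matrix.vandermonde μ).det ^ 2) *
      ∫⁻ z : (Fin N → ℂ) × ℝ, F (bordMatrix (Matrix.diagonal fun i => (μ i : ℂ)) z.1 z.2) =
    ENNReal.ofReal Real.pi ^ N * ∫⁻ x in interlacing μ,
      ENNReal.ofReal (Matrix.vandermonde μ).det * (ENNReal.ofReal (Matrix.vandermonde x).det *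
        F (Matrix.diagonal fun i => (x i : ℂ))) := by
  -- The phases of v do not affect the spectrum, so v may be replaced by the vector of its moduli.
  set g : (Fin (N + 1) → ℝ) → ℝ≥0∞ := fun y =>
    F (bordMatrix (Matrix.diagonal fun i => (μ i : ℂ)) (fun i => (√(y i.castSucc) : ℂ))
      (y (Fin.last N))) with hg
  have hgm : Measurable g := by
    simp only [hg, ← toMatrix_diagonal]
    refine hF.measurable_bordMatrix_comp _ ?_ ?_
    · refine measurable_pi_lambda _ fun i => Complex.measurable_ofReal.comp ?_
      exact Real.continuous_sqrt.measurable.comp (measurable_pi_apply _)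
    · exact measurable_pi_apply _
  have hD := isHermitian_diagonal_ofReal μ
  have h1 : ∀ z : (Fin N → ℂ) × ℝ, F (bordMatrix (Matrix.diagonal fun i => (μ i : ℂ)) z.1 z.2) =
      g (Fin.snoc (α := fun _ => ℝ) (fun i => Complex.normSq (z.1 i)) z.2) := fun z => by
    refine hF.congr_charpoly _ _ (bordMatrix_isHermitian hD _ _) (bordMatrix_isHermitian hD _ _) ?_
    rw [charpoly_bordMatrix_diagonal, charpoly_bordMatrix_diagonal]
    simp [Complex.normSq_ofReal, Real.mul_self_sqrt (Complex.normSq_nonneg _)]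
  have h2 : ∀ x ∈ interlacing μ, g (borderCoord μ x) = F (Matrix.diagonal fun i => (x i : ℂ)) := by
    intro x hx
    refine hF.congr_charpoly _ _ (bordMatrix_isHermitian hD _ _) (isHermitian_diagonal_ofReal x) ?_
    have h3 : (Fin.snoc (α := fun _ => ℝ)
        (fun i : Fin N => Complex.normSq (√(borderCoord μ x i.castSucc) : ℂ))
        (borderCoord μ x (Fin.last N))) = borderCoord μ x := by
      ext j
      induction j using Fin.lastCases with
      | last => simp
      | cast i => simp [Complex.normSq_ofReal, Real.mul_self_sqrt (borderCoord_pos hx i).le]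
    rw [charpoly_bordMatrix_diagonal, h3, borderPoly_borderCoord hμ.injective,
      Matrix.charpoly_diagonal]
    simp [Polynomial.map_prod]
  simp only [h1]
  rw [lintegral_border_normSq hgm, sq, ENNReal.ofReal_mul (prod_Ioi_sub_pos hμ).le,
    lintegral_const_mul' _ _ ENNReal.ofReal_ne_top,
    setLIntegral_congr_fun (g := fun x => ENNReal.ofReal (Matrix.vandermonde x).det *
      g (borderCoord μ x)) (isOpen_interlacing μ).measurableSet
      fun x hx => by simp only [h2 x hx], ← lintegral_border hμ]
  ring

theorem measurableSet_strictMono (N : ℕ) : MeasurableSet {x : Fin N → ℝ | StrictMono x} := by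
  have : {x : Fin N → ℝ | StrictMono x} = ⋂ i, ⋂ j, ⋂ _ : i < j, {x | x i < x j} := by
    ext x
    simp [StrictMono]
  rw [this]
  exact MeasurableSet.iInter fun i => MeasurableSet.iInter fun j => MeasurableSet.iInter fun _ =>
    measurableSet_lt (measurable_pi_apply _) (measurable_pi_apply _)

theorem measurableSet_interlacing_pairs (N : ℕ) :
    MeasurableSet {w : (Fin N → ℝ) × (Fin (N + 1) → ℝ) | w.2 ∈ interlacing w.1} := by
  have : {w : (Fin N → ℝ) × (Fin (N + 1) → ℝ) | w.2 ∈ interlacing w.1} =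
      ⋂ i : Fin N, ({w | w.2 i.castSucc < w.1 i} ∩ {w | w.1 i < w.2 i.succ}) := by
    ext w
    simp [interlacing]
  rw [this]
  exact MeasurableSet.iInter fun i =>
    (measurableSet_lt (by fun_prop) (by fun_prop)).inter
      (measurableSet_lt (by fun_prop) (by fun_prop))

/-- Tonelli on the set of interlacing pairs. Interlacing forces both tuples to be increasing, so
each order restriction can be dropped or restored freely. -/
theorem lintegral_interlacing_swap {N : ℕ} {f : (Fin (N + 1) → ℝ) → ℝ≥0∞} (hf : Measurable f) :
    ∫⁻ μ in {μ : Fin N → ℝ | StrictMono μ}, ∫⁻ x in interlacing μ,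
      ENNReal.ofReal (Matrix.vandermonde μ).det * (ENNReal.ofReal (Matrix.vandermonde x).det * f x) =
    ENNReal.ofReal (N.factorial : ℝ)⁻¹ * ∫⁻ x in {x : Fin (N + 1) → ℝ | StrictMono x},
      ENNReal.ofReal ((Matrix.vandermonde x).det ^ 2) * f x := by
  set T : Set ((Fin N → ℝ) × (Fin (N + 1) → ℝ)) := {w | w.2 ∈ interlacing w.1} with hT
  have hTm : MeasurableSet T := measurableSet_interlacing_pairs N
  set h : (Fin N → ℝ) × (Fin (N + 1) → ℝ) → ℝ≥0∞ := fun w =>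
    ENNReal.ofReal (Matrix.vandermonde w.1).det *
      (ENNReal.ofReal (Matrix.vandermonde w.2).det * f w.2) with hh
  have hhm : Measurable h :=
    ((ENNReal.measurable_ofReal.comp measurable_vandermonde_det).comp measurable_fst).mul
      (((ENNReal.measurable_ofReal.comp measurable_vandermonde_det).mul hf).comp measurable_snd)
  have hl : ∀ μ : Fin N → ℝ, {μ : Fin N → ℝ | StrictMono μ}.indicator (fun μ =>
      ∫⁻ x in interlacing μ, h (μ, x)) μ = ∫⁻ x, T.indicator h (μ, x) := fun μ => by
    have : ∀ x, T.indicator h (μ, x) = (interlacing μ).indicator (fun x => h (μ, x)) x := fun x => by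
      by_cases hx : x ∈ interlacing μ
      · rw [Set.indicator_of_mem hx, Set.indicator_of_mem (show (μ, x) ∈ T from hx)]
      · rw [Set.indicator_of_notMem hx, Set.indicator_of_notMem (show (μ, x) ∉ T from hx)]
    simp only [this]
    rw [lintegral_indicator (isOpen_interlacing μ).measurableSet]
    by_cases hμ : StrictMono μ
    · rw [Set.indicator_of_mem (by exact hμ)]
    · rw [Set.indicator_of_notMem (by exact hμ)]
      have : interlacing μ = ∅ := Set.eq_empty_iff_forall_notMem.2 fun x hx =>
        hμ (strictMono_of_interlacing hx)
      rw [this, Measure.restrict_empty, lintegral_zero_measure]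
  have hr : ∀ x : Fin (N + 1) → ℝ, ∫⁻ μ, T.indicator h (μ, x) =
      {x : Fin (N + 1) → ℝ | StrictMono x}.indicator (fun x => ENNReal.ofReal (N.factorial : ℝ)⁻¹ *
        (ENNReal.ofReal ((Matrix.vandermonde x).det ^ 2) * f x)) x := fun x => by
    have hxm : MeasurableSet {μ : Fin N → ℝ | x ∈ interlacing μ} :=
      hTm.preimage (measurable_id.prodMk measurable_const)
    have : ∀ μ, T.indicator h (μ, x) =
        {μ : Fin N → ℝ | x ∈ interlacing μ}.indicator (fun μ => h (μ, x)) μ := fun μ => by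
      by_cases hx : x ∈ interlacing μ
      · rw [Set.indicator_of_mem (show (μ, x) ∈ T from hx),
          Set.indicator_of_mem (show μ ∈ {μ : Fin N → ℝ | x ∈ interlacing μ} from hx)]
      · rw [Set.indicator_of_notMem (show (μ, x) ∉ T from hx),
          Set.indicator_of_notMem (show μ ∉ {μ : Fin N → ℝ | x ∈ interlacing μ} from hx)]
    simp only [this]
    rw [lintegral_indicator hxm]
    by_cases hx : StrictMono x
    · rw [Set.indicator_of_mem (by exact hx)]
      simp only [hh]
      have hv : Measurable fun μ : Fin N → ℝ => ENNReal.ofReal (Matrix.vandermonde μ).det :=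
        ENNReal.measurable_ofReal.comp measurable_vandermonde_det
      rw [lintegral_mul_const _ hv,
        lintegral_vandermonde_interlacing hx, sq, ENNReal.ofReal_mul (prod_Ioi_sub_pos hx).le,
        div_eq_inv_mul, ENNReal.ofReal_mul (by positivity)]
      ring
    · rw [Set.indicator_of_notMem (by exact hx)]
      have : {μ : Fin N → ℝ | x ∈ interlacing μ} = ∅ := Set.eq_empty_iff_forall_notMem.2 fun μ hμ =>
        hx (strictMono_of_mem_interlacing hμ)
      rw [this, Measure.restrict_empty, lintegral_zero_measure]
  calc ∫⁻ μ in {μ : Fin N → ℝ | StrictMono μ}, ∫⁻ x in interlacing μ, h (μ, x)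
      = ∫⁻ μ, ∫⁻ x, T.indicator h (μ, x) := by
        rw [← lintegral_indicator (measurableSet_strictMono N)]
        simp only [hl]
    _ = ∫⁻ x, ∫⁻ μ, T.indicator h (μ, x) := lintegral_lintegral_swap (hhm.indicator hTm).aemeasurable
    _ = _ := by
        simp only [hr]
        rw [lintegral_indicator (measurableSet_strictMono _),
          lintegral_const_mul' _ _ ENNReal.ofReal_ne_top]

/-- Weyl's integration formula for Hermitian matrices, over increasing eigenvalues. -/
theorem exists_lintegral_classFun_strictMono (N : ℕ) : ∃ K : ℝ≥0∞, K ≠ 0 ∧ K ≠ ∞ ∧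
    ∀ F : Matrix (Fin N) (Fin N) ℂ → ℝ≥0∞, IsClassFun F →
      ∫⁻ c : HermCoord N, F (toMatrix c) = K * ∫⁻ x in {x : Fin N → ℝ | StrictMono x},
        ENNReal.ofReal ((Matrix.vandermonde x).det ^ 2) *
          F (Matrix.diagonal fun i => (x i : ℂ)) := by
  induction N with
  | zero =>
    refine ⟨1, one_ne_zero, ENNReal.one_ne_top, fun F _ => ?_⟩
    have hS : {x : Fin 0 → ℝ | StrictMono x} = Set.univ := by
      ext x
      simp [Subsingleton.strictMono]
    have hF : ∀ A, F A = F 0 := fun A => congrArg F (Subsingleton.elim _ _)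
    simp only [hS, Measure.restrict_univ, hF, lintegral_const, Matrix.det_isEmpty, one_pow,
      ENNReal.ofReal_one, one_mul]
    have h1 : (volume : Measure (HermCoord 0)) Set.univ = 1 := by
      rw [Measure.volume_eq_prod, ← Set.univ_prod_univ, Measure.prod_prod, volume_pi, volume_pi,
        Measure.pi_of_empty, Measure.pi_of_empty]
      simp
    have h2 : (volume : Measure (Fin 0 → ℝ)) Set.univ = 1 := by
      rw [volume_pi, Measure.pi_of_empty]
      simp
    rw [h1, h2]
  | succ N ih =>
    obtain ⟨K, hK0, hK, h⟩ := ih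
    refine ⟨K * (ENNReal.ofReal Real.pi ^ N * ENNReal.ofReal (N.factorial : ℝ)⁻¹), ?_, ?_,
      fun F hF => ?_⟩
    · refine mul_ne_zero hK0 (mul_ne_zero (pow_ne_zero _ ?_) ?_)
      · exact (ENNReal.ofReal_pos.2 Real.pi_pos).ne'
      · exact (ENNReal.ofReal_pos.2 (by positivity)).ne'
    · exact ENNReal.mul_ne_top hK (ENNReal.mul_ne_top (ENNReal.pow_ne_top ENNReal.ofReal_ne_top)
        ENNReal.ofReal_ne_top)
    · have e1 : ∫⁻ c : HermCoord (N + 1), F (toMatrix c) =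
          ∫⁻ b : HermCoord N, ∫⁻ z : (Fin N → ℂ) × ℝ, F (bordMatrix (toMatrix b) z.1 z.2) := by
        rw [← (measurePreserving_bordCoord N).lintegral_comp hF.measurable, Measure.volume_eq_prod,
          lintegral_prod]
        · simp only [toMatrix_bordCoord]
        · exact (hF.measurable.comp (measurePreserving_bordCoord N).measurable).aemeasurable
      -- The inductive hypothesis applies because integrating out the border leaves a class function
      -- of the block.
      rw [e1, h _ hF.lintegral_bordMatrix,
        setLIntegral_congr_fun (measurableSet_strictMono N)
          fun μ hμ => hF.lintegral_bordMatrix_diagonal hμ,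
        lintegral_const_mul' _ _ (ENNReal.pow_ne_top ENNReal.ofReal_ne_top),
        lintegral_interlacing_swap hF.measurable_diagonal]
      ring
/-! ### Integration of class functions over all eigenvalue tuples -/

theorem IsClassFun.diagonal_comp_perm {N : ℕ} {F : Matrix (Fin N) (Fin N) ℂ → ℝ≥0∞}
    (hF : IsClassFun F) (x : Fin N → ℝ) (σ : Equiv.Perm (Fin N)) :
    F (Matrix.diagonal fun i => (x (σ i) : ℂ)) = F (Matrix.diagonal fun i => (x i : ℂ)) := by
  refine hF.congr_charpoly _ _ (isHermitian_diagonal_ofReal fun i => x (σ i))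
    (isHermitian_diagonal_ofReal x) ?_
  rw [Matrix.charpoly_diagonal, Matrix.charpoly_diagonal]
  exact Equiv.prod_comp σ fun i => (X - C (x i : ℂ))

theorem vandermonde_det_sq_comp_perm {N : ℕ} (x : Fin N → ℝ) (σ : Equiv.Perm (Fin N)) :
    (Matrix.vandermonde fun i => x (σ i)).det ^ 2 = (Matrix.vandermonde x).det ^ 2 := by
  have h : (Matrix.vandermonde fun i => x (σ i)) = (Matrix.vandermonde x).submatrix σ id := rfl
  rw [h, Matrix.det_permute, mul_pow]
  have : (((Equiv.Perm.sign σ : ℤˣ) : ℤ) : ℝ) ^ 2 = 1 := by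
    rcases Int.units_eq_one_or (Equiv.Perm.sign σ) with h | h <;> simp [h]
  rw [this, one_mul]

theorem measurePreserving_comp_perm {N : ℕ} (σ : Equiv.Perm (Fin N)) :
    MeasurePreserving (fun (x : Fin N → ℝ) i => x (σ i)) volume volume := by
  have h := volume_measurePreserving_piCongrLeft (fun _ : Fin N => ℝ) σ.symm
  have he : (fun (x : Fin N → ℝ) i => x (σ i)) =
      MeasurableEquiv.piCongrLeft (fun _ : Fin N => ℝ) σ.symm := by
    funext x i
    obtain ⟨j, rfl⟩ := σ.symm.surjective i
    simp [MeasurableEquiv.piCongrLeft, Equiv.piCongrLeft_apply_apply]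
  rw [he]
  exact h

/-- An injective tuple is put in increasing order by exactly one permutation; on the other tuples f
vanishes. -/
theorem lintegral_eq_factorial_mul_strictMono {N : ℕ} {f : (Fin N → ℝ) → ℝ≥0∞} (hf : Measurable f)
    (hsymm : ∀ (x : Fin N → ℝ) (σ : Equiv.Perm (Fin N)), f (fun i => x (σ i)) = f x)
    (h0 : ∀ x, ¬ Function.Injective x → f x = 0) :
    ∫⁻ x, f x = N.factorial * ∫⁻ x in {x : Fin N → ℝ | StrictMono x}, f x := by
  set S : Set (Fin N → ℝ) := {x | StrictMono x} with hS
  have hSm : MeasurableSet S := measurableSet_strictMono N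
  have hpt : ∀ x, f x = ∑ σ : Equiv.Perm (Fin N), S.indicator f (fun i => x (σ i)) := by
    intro x
    by_cases hx : Function.Injective x
    · have hs : StrictMono fun i => x (Tuple.sort x i) :=
        (Tuple.monotone_sort x).strictMono_of_injective (hx.comp (Tuple.sort x).injective)
      rw [Finset.sum_eq_single (Tuple.sort x)]
      · rw [Set.indicator_of_mem (by exact hs), hsymm]
      · intro τ _ hτ
        refine Set.indicator_of_notMem (fun hmem => hτ ?_) _
        have h1 : StrictMono fun i => x (τ i) := hmem
        have h2 : (fun i => x (τ i)) = fun i => x (Tuple.sort x i) :=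
          (h1.range_inj hs).1 (by
            rw [show (fun i => x (τ i)) = x ∘ τ from rfl,
              show (fun i => x (Tuple.sort x i)) = x ∘ Tuple.sort x from rfl,
              Set.range_comp, Set.range_comp, τ.range_eq_univ, (Tuple.sort x).range_eq_univ])
        exact Equiv.ext fun i => hx (congrFun h2 i)
      · simp
    · rw [h0 x hx, Finset.sum_eq_zero]
      intro σ _
      rw [Set.indicator_apply_eq_zero]
      intro _
      rw [hsymm, h0 x hx]
  have hfS : Measurable (S.indicator f) := hf.indicator hSm
  simp_rw [hpt]
  rw [lintegral_finsetSum]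
  · have : ∀ σ : Equiv.Perm (Fin N), ∫⁻ x : Fin N → ℝ, S.indicator f (fun i => x (σ i)) =
        ∫⁻ x in S, f x := fun σ => by
      rw [(measurePreserving_comp_perm σ).lintegral_comp hfS, lintegral_indicator hSm]
    simp only [this, Finset.sum_const, Finset.card_univ, Fintype.card_perm, Fintype.card_fin,
      nsmul_eq_mul]
    congr 1
    refine lintegral_congr fun x => ?_
    rw [← hpt]
  · exact fun σ _ => hfS.comp (measurePreserving_comp_perm σ).measurable

/-- Weyl's integration formula for Hermitian matrices. -/
theorem exists_lintegral_classFun (N : ℕ) : ∃ K : ℝ≥0∞, K ≠ 0 ∧ K ≠ ∞ ∧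
    ∀ F : Matrix (Fin N) (Fin N) ℂ → ℝ≥0∞, IsClassFun F →
      ∫⁻ c : HermCoord N, F (toMatrix c) = K * ∫⁻ x : Fin N → ℝ,
        ENNReal.ofReal ((Matrix.vandermonde x).det ^ 2) *
          F (Matrix.diagonal fun i => (x i : ℂ)) := by
  obtain ⟨K, hK0, hK, h⟩ := exists_lintegral_classFun_strictMono N
  have hN0 : (N.factorial : ℝ≥0∞) ≠ 0 := by exact_mod_cast N.factorial_ne_zero
  have hN : (N.factorial : ℝ≥0∞) ≠ ∞ := ENNReal.natCast_ne_top _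
  refine ⟨K * (N.factorial : ℝ≥0∞)⁻¹, mul_ne_zero hK0 (ENNReal.inv_ne_zero.2 hN),
    ENNReal.mul_ne_top hK (ENNReal.inv_ne_top.2 hN0), fun F hF => ?_⟩
  rw [h F hF, lintegral_eq_factorial_mul_strictMono
    (f := fun x : Fin N → ℝ => ENNReal.ofReal ((Matrix.vandermonde x).det ^ 2) *
      F (Matrix.diagonal fun i => (x i : ℂ)))]
  · rw [mul_assoc, ← mul_assoc (N.factorial : ℝ≥0∞)⁻¹, ENNReal.inv_mul_cancel hN0 hN, one_mul]
  · exact (ENNReal.measurable_ofReal.comp (measurable_vandermonde_det.pow_const 2)).mul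
      hF.measurable_diagonal
  · intro x σ
    simp only [vandermonde_det_sq_comp_perm x σ, hF.diagonal_comp_perm x σ]
  · intro x hx
    have : (Matrix.vandermonde x).det = 0 := by
      by_contra h
      exact hx (Matrix.det_vandermonde_ne_zero_iff.1 h)
    simp [this]

/-! ### The trace of the potential -/

theorem trace_cfc_re {N : ℕ} {A : Matrix (Fin N) (Fin N) ℂ} (hA : A.IsHermitian) (V : ℝ → ℝ) :
    (hA.cfc V).trace.re = ∑ i, V (hA.eigenvalues i) := by
  rw [Matrix.IsHermitian.cfc, Unitary.conjStarAlgAut_apply, Matrix.trace_mul_comm, ← mul_assoc,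
    Unitary.coe_star_mul_self, one_mul, Matrix.trace_diagonal]
  simp

/-- This form shows that the trace depends only on the characteristic polynomial, which makes the
Gibbs density a class function. -/
theorem trace_cfc_re_eq_roots {N : ℕ} {A : Matrix (Fin N) (Fin N) ℂ} (hA : A.IsHermitian)
    (V : ℝ → ℝ) : (hA.cfc V).trace.re = (A.charpoly.roots.map fun z => V z.re).sum := by
  rw [trace_cfc_re, hA.roots_charpoly_eq_eigenvalues, Multiset.map_map]
  rfl

theorem trace_cfc_diagonal_re {N : ℕ} (x : Fin N → ℝ) (V : ℝ → ℝ) :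
    ((isHermitian_diagonal_ofReal x).cfc V).trace.re = ∑ i, V (x i) := by
  have h : (∏ i, (X - C (x i : ℂ))).roots = Finset.univ.val.map fun i => (x i : ℂ) := by
    have := roots_multiset_prod_X_sub_C (Finset.univ.val.map fun i => (x i : ℂ))
    rw [Multiset.map_map] at this
    exact this
  rw [trace_cfc_re_eq_roots, Matrix.charpoly_diagonal, h, Multiset.map_map]
  rfl

theorem continuous_toMatrix (N : ℕ) : Continuous (toMatrix : HermCoord N → _) := by
  refine continuous_matrix fun i j => ?_
  unfold toMatrix
  simp only [Matrix.of_apply]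
  split_ifs <;> fun_prop

theorem continuous_trPotential_polynomial {N : ℕ} (P : ℝ[X]) :
    Continuous (trPotential (N := N) fun t => P.eval t) := by
  have h : ∀ c : HermCoord N, trPotential (fun t => P.eval t) c =
      (aeval (toMatrix c) P).trace.re := fun c => by
    have hsa : IsSelfAdjoint (toMatrix c) := toMatrix_isHermitian c
    rw [trPotential, ← Matrix.IsHermitian.cfc_eq, cfc_polynomial P (toMatrix c) hsa]
  have h' : trPotential (N := N) (fun t => P.eval t) =
      fun c => (aeval (toMatrix c) P).trace.re := funext h
  rw [h']
  exact Complex.continuous_re.comp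
    (((Polynomial.continuous_aeval P).comp (continuous_toMatrix N)).matrix_trace)

/-- Weierstrass: choose polynomials within 1/(n+1) of V on [-n, n]. Their traces are continuous in
the entries and converge pointwise, since each eigenvalue eventually lies in [-n, n]. -/
theorem measurable_trPotential {N : ℕ} {V : ℝ → ℝ} (hV : Continuous V) :
    Measurable (trPotential (N := N) V) := by
  have hP : ∀ n : ℕ, ∃ P : ℝ[X], ∀ t ∈ Set.Icc (-(n : ℝ)) n, |P.eval t - V t| < 1 / (n + 1) :=
    fun n => exists_polynomial_near_of_continuousOn _ _ V hV.continuousOn _ (by positivity)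
  choose P hP using hP
  refine measurable_of_tendsto_metrizable (fun n => (continuous_trPotential_polynomial (P n)).measurable)
    (tendsto_pi_nhds.2 fun c => ?_)
  simp only [trPotential, trace_cfc_re]
  refine tendsto_finsetSum _ fun i _ => ?_
  set t := (toMatrix_isHermitian c).eigenvalues i
  rw [tendsto_iff_dist_tendsto_zero]
  refine squeeze_zero' (Filter.Eventually.of_forall fun _ => dist_nonneg) ?_
    tendsto_one_div_add_atTop_nhds_zero_nat
  filter_upwards [Filter.eventually_ge_atTop ⌈|t|⌉₊] with n hn
  have h1 : |t| ≤ n := (Nat.le_ceil _).trans (by exact_mod_cast hn)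
  rw [Real.dist_eq]
  exact (hP n t (abs_le.1 h1)).le

/-! ### The law of the eigenvalues -/

/-- `exp (-N tr V(A))` for Hermitian `A`, and `0` otherwise. -/
def gibbsDensity (N : ℕ) (V : ℝ → ℝ) (A : Matrix (Fin N) (Fin N) ℂ) : ℝ≥0∞ :=
  open Classical in
  if hA : A.IsHermitian then
    ENNReal.ofReal (Real.exp (-((N : ℝ) * (hA.cfc V).trace.re)))
  else 0

theorem gibbsDensity_toMatrix {N : ℕ} (V : ℝ → ℝ) (c : HermCoord N) :
    gibbsDensity N V (toMatrix c) =
      ENNReal.ofReal (Real.exp (-((N : ℝ) * trPotential V c))) := by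
  rw [gibbsDensity, dif_pos (toMatrix_isHermitian c), trPotential]

theorem gibbsDensity_diagonal {N : ℕ} (V : ℝ → ℝ) (x : Fin N → ℝ) :
    gibbsDensity N V (Matrix.diagonal fun i => (x i : ℂ)) =
      ENNReal.ofReal (∏ i, weight N V (x i)) := by
  rw [gibbsDensity, dif_pos (isHermitian_diagonal_ofReal x), trace_cfc_diagonal_re]
  simp only [weight]
  rw [← Real.exp_sum, Finset.sum_neg_distrib, Finset.mul_sum]

theorem measurable_gibbsDensity_toMatrix {N : ℕ} {V : ℝ → ℝ} (hV : Continuous V) :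
    Measurable fun c : HermCoord N => gibbsDensity N V (toMatrix c) := by
  simp only [gibbsDensity_toMatrix]
  exact ENNReal.measurable_ofReal.comp
    (Real.measurable_exp.comp ((measurable_trPotential hV).const_mul _).neg)

theorem IsClassFun.mul_gibbsDensity {N : ℕ} {V : ℝ → ℝ} (hV : Continuous V)
    {F : Matrix (Fin N) (Fin N) ℂ → ℝ≥0∞} (hF : IsClassFun F) :
    IsClassFun fun A => gibbsDensity N V A * F A := by
  refine ⟨(measurable_gibbsDensity_toMatrix hV).mul hF.measurable, fun A B hA hB h => ?_⟩
  simp only [hF.congr_charpoly A B hA hB h, gibbsDensity, dif_pos hA, dif_pos hB,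
    trace_cfc_re_eq_roots, h]

/-- The unnormalized joint law of the eigenvalues. -/
def eigenvalueMeasure (N : ℕ) (V : ℝ → ℝ) : Measure (Fin N → ℝ) :=
  volume.withDensity fun x =>
    ENNReal.ofReal ((Matrix.vandermonde x).det ^ 2 * ∏ i, weight N V (x i))

theorem measurable_eigenvalueDensity {N : ℕ} {V : ℝ → ℝ} (hV : Continuous V) :
    Measurable fun x : Fin N → ℝ => (Matrix.vandermonde x).det ^ 2 * ∏ i, weight N V (x i) := by
  refine (measurable_vandermonde_det.pow_const 2).mul (Continuous.measurable ?_)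
  unfold weight
  fun_prop

theorem exists_lintegral_gibbsMeasure {N : ℕ} {V : ℝ → ℝ} (hV : Continuous V) :
    ∃ K : ℝ≥0∞, K ≠ 0 ∧ K ≠ ∞ ∧ ∀ F : Matrix (Fin N) (Fin N) ℂ → ℝ≥0∞, IsClassFun F →
      ∫⁻ c, F (toMatrix c) ∂(gibbsMeasure N V) =
        K * ∫⁻ x, F (Matrix.diagonal fun i => (x i : ℂ)) ∂(eigenvalueMeasure N V) := by
  obtain ⟨K, hK0, hK, h⟩ := exists_lintegral_classFun N
  refine ⟨K, hK0, hK, fun F hF => ?_⟩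
  have h1 := measurable_gibbsDensity_toMatrix (N := N) hV
  simp only [gibbsDensity_toMatrix] at h1
  have h3 : Measurable fun x : Fin N → ℝ =>
      ENNReal.ofReal ((Matrix.vandermonde x).det ^ 2 * ∏ i, weight N V (x i)) :=
    ENNReal.measurable_ofReal.comp (measurable_eigenvalueDensity hV)
  rw [gibbsMeasure, lintegral_withDensity_eq_lintegral_mul _ h1 hF.measurable, eigenvalueMeasure,
    lintegral_withDensity_eq_lintegral_mul _ h3 hF.measurable_diagonal]
  have h2 := h _ (hF.mul_gibbsDensity hV)
  simp only [gibbsDensity_toMatrix, gibbsDensity_diagonal, ← mul_assoc] at h2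
  simp only [← ENNReal.ofReal_mul (sq_nonneg _)] at h2
  exact h2

/-- The law of a spectral statistic of the random matrix is computed from the joint law of the
eigenvalues. -/
theorem isProbabilityMeasure_law_and_map {N : ℕ} {V : ℝ → ℝ} (hV : Continuous V)
    (h0 : eigenvalueMeasure N V Set.univ ≠ 0) (htop : eigenvalueMeasure N V Set.univ ≠ ∞) :
    IsProbabilityMeasure (law N V) ∧ ∀ R : Matrix (Fin N) (Fin N) ℂ → ℂ,
      Measurable (fun c : HermCoord N => R (toMatrix c)) →
      (∀ A B : Matrix (Fin N) (Fin N) ℂ, A.charpoly = B.charpoly → R A = R B) →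
      (law N V).map (fun c => R (toMatrix c)) = (eigenvalueMeasure N V Set.univ)⁻¹ •
        (eigenvalueMeasure N V).map fun x => R (Matrix.diagonal fun i => (x i : ℂ)) := by
  obtain ⟨K, hK0, hK, h⟩ := exists_lintegral_gibbsMeasure (N := N) hV
  have hone : IsClassFun fun _ : Matrix (Fin N) (Fin N) ℂ => (1 : ℝ≥0∞) :=
    ⟨measurable_const, fun _ _ _ _ _ => rfl⟩
  have hZ : gibbsMeasure N V Set.univ = K * eigenvalueMeasure N V Set.univ := by
    simpa using h _ hone
  have hZ0 : gibbsMeasure N V Set.univ ≠ 0 := by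
    rw [hZ]
    exact mul_ne_zero hK0 h0
  have hZtop : gibbsMeasure N V Set.univ ≠ ∞ := by
    rw [hZ]
    exact ENNReal.mul_ne_top hK htop
  refine ⟨⟨?_⟩, fun R hR hRc => ?_⟩
  · rw [law, Measure.smul_apply, smul_eq_mul, ENNReal.inv_mul_cancel hZ0 hZtop]
  · have hRd : Measurable fun x : Fin N → ℝ => R (Matrix.diagonal fun i => (x i : ℂ)) := by
      simp only [← toMatrix_diagonal]
      exact hR.comp (measurable_id.prodMk measurable_const)
    ext s hs
    -- Testing on indicators of {R ∈ s} identifies the two laws; the unknown Weyl constant K cancels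
    -- in the normalization.
    have hF : IsClassFun fun A => s.indicator (fun _ => (1 : ℝ≥0∞)) (R A) :=
      ⟨(measurable_const.indicator hs).comp hR, fun A B _ _ hAB => by rw [hRc A B hAB]⟩
    have h1 := h _ hF
    rw [← lintegral_map (f := s.indicator fun _ => (1 : ℝ≥0∞)) (measurable_const.indicator hs) hR,
      ← lintegral_map (f := s.indicator fun _ => (1 : ℝ≥0∞)) (measurable_const.indicator hs) hRd,
      lintegral_indicator_const hs, lintegral_indicator_const hs, one_mul, one_mul] at h1
    rw [law, Measure.map_smul, Measure.smul_apply, Measure.smul_apply, smul_eq_mul, smul_eq_mul, h1,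
      hZ, ENNReal.mul_inv (Or.inl hK0) (Or.inl hK), mul_mul_mul_comm,
      ENNReal.inv_mul_cancel hK0 hK, one_mul]

/-! ### Ratios of characteristic polynomials -/

theorem charDet_eq_eval_charpoly {N : ℕ} (z : ℂ) (A : Matrix (Fin N) (Fin N) ℂ) :
    charDet z A = A.charpoly.eval z := (Matrix.eval_charpoly A z).symm

theorem charRatio_congr_charpoly {N l : ℕ} (p q : Fin l → ℂ) {A B : Matrix (Fin N) (Fin N) ℂ}
    (h : A.charpoly = B.charpoly) : charRatio p q A = charRatio p q B := by
  simp only [charRatio, charDet_eq_eval_charpoly, h]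

theorem charRatio_diagonal {N l : ℕ} (p q : Fin l → ℂ) (x : Fin N → ℝ) :
    charRatio p q (Matrix.diagonal fun i => (x i : ℂ)) =
      ∏ k, ((∏ i, (p i - x k)) / ∏ j, (q j - x k)) := by
  simp only [charRatio, charDet_eq_eval_charpoly, Matrix.charpoly_diagonal, eval_prod, eval_sub,
    eval_X, eval_C, Finset.prod_div_distrib]
  congr 1 <;> exact Finset.prod_comm

theorem measurable_charRatio {N l : ℕ} (p q : Fin l → ℂ) :
    Measurable fun c : HermCoord N => charRatio p q (toMatrix c) := by
  have h : ∀ z : ℂ, Measurable fun c : HermCoord N => charDet z (toMatrix c) := fun z =>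
    (Continuous.matrix_det (continuous_const.sub (continuous_toMatrix N))).measurable
  exact (Finset.measurable_fun_prod _ fun i _ => h (p i)).div
    (Finset.measurable_fun_prod _ fun j _ => h (q j))

/-- The normalized density of the eigenvalues determines the expectation of the ratio. -/
theorem law_charRatio {N l : ℕ} {V : ℝ → ℝ} (hV : Continuous V) (p q : Fin l → ℂ) {Z : ℝ} {I : ℂ}
    (hZ : 0 < Z)
    (hint : Integrable fun x : Fin N → ℝ => (Matrix.vandermonde x).det ^ 2 * ∏ i, weight N V (x i))
    (hZint : ∫ x : Fin N → ℝ, (Matrix.vandermonde x).det ^ 2 * ∏ i, weight N V (x i) = Z)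
    (hR : Integrable fun x : Fin N → ℝ =>
      (((Matrix.vandermonde x).det ^ 2 * ∏ i, weight N V (x i) : ℝ) : ℂ) *
        ∏ k, ((∏ i, (p i - x k)) / ∏ j, (q j - x k)))
    (hRint : ∫ x : Fin N → ℝ, (((Matrix.vandermonde x).det ^ 2 * ∏ i, weight N V (x i) : ℝ) : ℂ) *
        ∏ k, ((∏ i, (p i - x k)) / ∏ j, (q j - x k)) = I) :
    IsProbabilityMeasure (law N V) ∧
    Integrable (fun c => charRatio p q (toMatrix c)) (law N V) ∧
    ∫ c, charRatio p q (toMatrix c) ∂(law N V) = I / Z := by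
  have hnn : ∀ x : Fin N → ℝ, 0 ≤ (Matrix.vandermonde x).det ^ 2 * ∏ i, weight N V (x i) :=
    fun x => mul_nonneg (sq_nonneg _) (Finset.prod_nonneg fun i _ => (Real.exp_pos _).le)
  have hE : eigenvalueMeasure N V Set.univ = ENNReal.ofReal Z := by
    rw [eigenvalueMeasure, withDensity_apply _ MeasurableSet.univ, Measure.restrict_univ,
      ← ofReal_integral_eq_lintegral_ofReal hint (Filter.Eventually.of_forall hnn), hZint]
  have h0 : eigenvalueMeasure N V Set.univ ≠ 0 := by
    rw [hE]
    exact (ENNReal.ofReal_pos.2 hZ).ne'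
  have htop : eigenvalueMeasure N V Set.univ ≠ ∞ := by
    rw [hE]
    exact ENNReal.ofReal_ne_top
  obtain ⟨hprob, hmap⟩ := isProbabilityMeasure_law_and_map hV h0 htop
  have hm := measurable_charRatio (N := N) p q
  have hmap := hmap (charRatio p q) hm fun A B => charRatio_congr_charpoly p q
  have hmd : Measurable fun x : Fin N → ℝ => charRatio p q (Matrix.diagonal fun i => (x i : ℂ)) := by
    simp only [← toMatrix_diagonal]
    exact hm.comp (measurable_id.prodMk measurable_const)
  have hmdens : Measurable fun x : Fin N → ℝ =>
      Real.toNNReal ((Matrix.vandermonde x).det ^ 2 * ∏ i, weight N V (x i)) :=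
    (measurable_eigenvalueDensity hV).real_toNNReal
  have hsm : ∀ x : Fin N → ℝ,
      Real.toNNReal ((Matrix.vandermonde x).det ^ 2 * ∏ i, weight N V (x i)) •
        charRatio p q (Matrix.diagonal fun i => (x i : ℂ)) =
      (((Matrix.vandermonde x).det ^ 2 * ∏ i, weight N V (x i) : ℝ) : ℂ) *
        ∏ k, ((∏ i, (p i - x k)) / ∏ j, (q j - x k)) := fun x => by
    rw [charRatio_diagonal, NNReal.smul_def, Real.coe_toNNReal _ (hnn x), Complex.real_smul]
  have hdef : eigenvalueMeasure N V = volume.withDensity fun x =>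
      ((Real.toNNReal ((Matrix.vandermonde x).det ^ 2 * ∏ i, weight N V (x i)) : NNReal) : ℝ≥0∞) :=
    rfl
  have hRe : Integrable (fun x : Fin N → ℝ => charRatio p q (Matrix.diagonal fun i => (x i : ℂ)))
      (eigenvalueMeasure N V) := by
    rw [hdef, integrable_withDensity_iff_integrable_smul hmdens]
    simp only [hsm]
    exact hR
  have hIe : ∫ x, charRatio p q (Matrix.diagonal fun i => (x i : ℂ)) ∂(eigenvalueMeasure N V) = I := by
    rw [hdef, integral_withDensity_eq_integral_smul hmdens]
    simp only [hsm]
    exact hRint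
  -- Integrability and expectation depend only on the law of the ratio on ℂ, which is known from the
  -- eigenvalues, so both are transported as statements about the identity function.
  have hmap_int : Integrable id ((law N V).map fun c => charRatio p q (toMatrix c)) := by
    rw [hmap]
    exact ((integrable_map_measure measurable_id.aestronglyMeasurable hmd.aemeasurable).2
      hRe).smul_measure (ENNReal.inv_ne_top.2 h0)
  refine ⟨hprob, (integrable_map_measure measurable_id.aestronglyMeasurable hm.aemeasurable).1
    hmap_int, ?_⟩
  have h1 := integral_map (f := id) hm.aemeasurable (μ := law N V)
    measurable_id.aestronglyMeasurable
  simp only [id_eq] at h1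
  rw [← h1, hmap, integral_smul_measure,
    integral_map (f := fun y => y) hmd.aemeasurable measurable_id.aestronglyMeasurable, hIe, hE,
    ENNReal.toReal_inv, ENNReal.toReal_ofReal hZ.le, Complex.real_smul, Complex.ofReal_inv,
    div_eq_inv_mul]
/-! ### Determinants of monic families and the Cauchy–Vandermonde determinant -/

/-- Passing from monomials to monic polynomials of the same degrees is unitriangular. The
equivalence e orders the family by degree. -/
theorem det_eval_monic_family {R ι : Type*} [CommRing R] [Fintype ι] [DecidableEq ι] {n : ℕ}
    (e : ι ≃ Fin n) (y : ι → R) (ψ : ι → R[X]) (hm : ∀ a, (ψ a).Monic)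
    (hd : ∀ a, (ψ a).natDegree = e a) :
    (Matrix.of fun b a => (ψ a).eval (y b)).det =
      (Matrix.vandermonde fun i => y (e.symm i)).det := by
  rw [Matrix.det_eval_matrixOfPolynomials_eq_det_vandermonde _ (fun i => ψ (e.symm i))
    (fun i => by rw [hd, Equiv.apply_symm_apply]) fun i => hm _, ← Matrix.det_submatrix_equiv_self e.symm]
  rfl

/-- The bijection `Fin m ⊕ Fin l ≃ Fin (m + l)` reversing the second summand. -/
def revSumEquiv (m l : ℕ) : Fin m ⊕ Fin l ≃ Fin (m + l) :=
  ((Equiv.refl _).sumCongr Fin.revPerm).trans finSumFinEquiv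

@[simp] theorem revSumEquiv_inl {m l : ℕ} (a : Fin m) : (revSumEquiv m l (Sum.inl a) : ℕ) = a := by
  simp [revSumEquiv]

@[simp] theorem revSumEquiv_inr {m l : ℕ} (k : Fin l) :
    (revSumEquiv m l (Sum.inr k) : ℕ) = m + (l - 1 - k) := by
  simp [revSumEquiv, Nat.sub_sub, add_comm]

/-- The bijection `Fin m ⊕ Fin l ≃ Fin (m + l)` swapping the two summands and reversing the
second one. -/
def swapSumEquiv (m l : ℕ) : Fin m ⊕ Fin l ≃ Fin (m + l) :=
  (((Equiv.sumComm _ _).trans (Fin.revPerm.sumCongr (Equiv.refl _))).trans finSumFinEquiv).trans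
    (finCongr (add_comm l m))

@[simp] theorem swapSumEquiv_inl {m l : ℕ} (a : Fin m) :
    (swapSumEquiv m l (Sum.inl a) : ℕ) = l + a := by
  simp [swapSumEquiv, add_comm]

@[simp] theorem swapSumEquiv_inr {m l : ℕ} (k : Fin l) :
    (swapSumEquiv m l (Sum.inr k) : ℕ) = l - 1 - k := by
  simp [swapSumEquiv, Nat.sub_sub, add_comm]

theorem sign_finCycle {n : ℕ} (k : Fin n) :
    Equiv.Perm.sign (finCycle k) = ((-1) ^ (n - 1)) ^ (k : ℕ) := by
  have h : finCycle k = finRotate n ^ (k : ℕ) := by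
    apply Equiv.ext
    intro i
    rw [Equiv.Perm.coe_pow, finCycle_eq_finRotate_iterate]
  rw [h, map_pow, sign_finRotate]

/-- The two enumerations differ by a cyclic shift by m, of sign (-1)^(m(m+l-1)). This equals
(-1)^(ml), since the exponents differ by the even number m(m-1). -/
theorem det_vandermonde_swapSum {m l : ℕ} (hl : 1 ≤ l) (x : Fin (m + l) → ℂ) :
    (Matrix.vandermonde fun i => x (revSumEquiv m l ((swapSumEquiv m l).symm i))).det =
      (-1) ^ (m * l) * (Matrix.vandermonde x).det := by
  have hm : m < m + l := by omega
  have : NeZero (m + l) := ⟨by omega⟩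
  have he : ∀ c, revSumEquiv m l c = finCycle ⟨m, hm⟩ (swapSumEquiv m l c) := by
    intro c
    ext
    rw [finCycle_apply, Fin.val_add]
    rcases c with a | k
    · rw [revSumEquiv_inl, swapSumEquiv_inl, show l + (a : ℕ) + m = a + (m + l) by ring,
        Nat.add_mod_right, Nat.mod_eq_of_lt (by omega)]
    · rw [revSumEquiv_inr, swapSumEquiv_inr, Nat.mod_eq_of_lt (by dsimp only; omega)]
      dsimp only
      ring
  have h : (Matrix.vandermonde fun i => x (revSumEquiv m l ((swapSumEquiv m l).symm i))) =
      (Matrix.vandermonde x).submatrix (finCycle ⟨m, hm⟩) id := by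
    ext i j
    simp [he]
  have hp : Even (m * (m + l - 1) + m * l) := by
    obtain ⟨l, rfl⟩ : ∃ k, l = k + 1 := ⟨l - 1, by omega⟩
    have h1 : m + (l + 1) - 1 = m + l := by omega
    rw [h1, show m * (m + l) + m * (l + 1) = m * (m + 1) + 2 * (m * l) by ring]
    exact (Nat.even_mul_succ_self m).add (even_two_mul _)
  have hs : (((Equiv.Perm.sign (finCycle (⟨m, hm⟩ : Fin (m + l))) : ℤˣ) : ℤ) : ℂ) = (-1) ^ (m * l) := by
    rw [sign_finCycle, ← pow_mul, mul_comm (m + l - 1)]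
    push_cast
    rcases Nat.even_or_odd (m * l) with h | h
    · rw [h.neg_one_pow, ((Nat.even_add.1 hp).2 h).neg_one_pow]
    · have h' : Odd (m * (m + l - 1)) := by
        rw [← Nat.not_even_iff_odd] at h ⊢
        exact fun h2 => h ((Nat.even_add.1 hp).1 h2)
      rw [h.neg_one_pow, h'.neg_one_pow]
  rw [h, Matrix.det_permute, hs]

/-- The determinant of a monic family of polynomials at the points `y` and `p`. -/
theorem det_eval_monic_family_sum {ι : Type*} [Fintype ι] [DecidableEq ι] {n l : ℕ}
    (e : ι ≃ Fin n) (y : ι → ℂ) (p : Fin l → ℂ) (ψ : ι ⊕ Fin l → ℂ[X]) (hm : ∀ c, (ψ c).Monic)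
    (hd1 : ∀ a, (ψ (Sum.inl a)).natDegree = e a) (hd2 : ∀ k, (ψ (Sum.inr k)).natDegree = n + k) :
    (Matrix.of fun r c => (ψ c).eval (Sum.elim y p r)).det =
      (Matrix.vandermonde fun i => y (e.symm i)).det * (∏ i, ∏ b, (p i - y b)) *
        (Matrix.vandermonde p).det := by
  set E : ι ⊕ Fin l ≃ Fin (n + l) := (e.sumCongr (Equiv.refl _)).trans finSumFinEquiv with hE
  have hE1 : ∀ a, (E (Sum.inl a) : ℕ) = e a := fun a => by simp [hE]
  have hE2 : ∀ k, (E (Sum.inr k) : ℕ) = n + k := fun k => by simp [hE]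
  have hcard : Fintype.card ι = n := by rw [Fintype.card_congr e, Fintype.card_fin]
  -- Only monicity and degrees matter, so the last l polynomials may be chosen to vanish at every
  -- y_b. The matrix becomes block triangular.
  set χ : ι ⊕ Fin l → ℂ[X] := Sum.elim (fun a => X ^ (e a : ℕ))
    fun k => X ^ (k : ℕ) * ∏ b, (X - C (y b)) with hχ
  have hχm : ∀ c, (χ c).Monic := by
    rintro (a | k)
    · exact monic_X_pow _
    · exact (monic_X_pow _).mul (monic_prod_X_sub_C _ _)
  have hχd : ∀ c, (χ c).natDegree = E c := by
    rintro (a | k)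
    · rw [hE1]; simp [hχ]
    · rw [hE2]
      simp only [hχ, Sum.elim_inr]
      rw [(monic_X_pow _).natDegree_mul (monic_prod_X_sub_C _ _), natDegree_X_pow,
        natDegree_prod_of_monic _ _ fun i _ => monic_X_sub_C _]
      simp [hcard, add_comm]
  have hψd : ∀ c, (ψ c).natDegree = E c := by
    rintro (a | k)
    · rw [hE1, hd1]
    · rw [hE2, hd2]
  rw [det_eval_monic_family E _ ψ hm hψd, ← det_eval_monic_family E _ χ hχm hχd]
  have hblock : (Matrix.of fun r c => (χ c).eval (Sum.elim y p r)) =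
      Matrix.fromBlocks (Matrix.of fun b a : ι => (X ^ (e a : ℕ) : ℂ[X]).eval (y b)) 0
        (Matrix.of fun (i : Fin l) (a : ι) => p i ^ (e a : ℕ))
        (Matrix.of fun i k : Fin l => (∏ b, (p i - y b)) * Matrix.vandermonde p i k) := by
    ext (b | i) (a | k)
    · simp [hχ]
    · simp only [hχ, Matrix.of_apply, Sum.elim_inl, Sum.elim_inr, eval_mul, eval_prod, eval_sub,
        eval_X, eval_C, Matrix.fromBlocks_apply₁₂, Matrix.zero_apply]
      rw [Finset.prod_eq_zero (Finset.mem_univ b) (sub_self _), mul_zero]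
    · simp [hχ]
    · simp [hχ, eval_prod, mul_comm]
  rw [hblock, Matrix.det_fromBlocks_zero₁₂, Matrix.det_mul_column,
    det_eval_monic_family e y (fun a => X ^ (e a : ℕ)) (fun a => monic_X_pow _)
      fun a => natDegree_X_pow _, mul_assoc]

/-- Partial fractions, read off from Lagrange interpolation of the constant 1 at the nodes q_j. -/
theorem prod_inv_sub_eq_sum {l : ℕ} {q : Fin l → ℂ} (hq : Function.Injective q) (k : Fin l) {z : ℂ}
    (hz : ∀ j, z ≠ q j) :
    ∏ j ∈ Finset.Iic k, (z - q j)⁻¹ =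
      ∑ j ∈ Finset.Iic k, Lagrange.nodalWeight (Finset.Iic k) q j * (z - q j)⁻¹ := by
  have h := Lagrange.eval_interpolate_not_at_node (s := Finset.Iic k) (v := q) (x := z) 1
    fun i _ => hz i
  rw [Lagrange.interpolate_one hq.injOn ⟨k, Finset.mem_Iic.2 le_rfl⟩, eval_one,
    Lagrange.eval_nodal] at h
  simp only [Pi.one_apply, mul_one] at h
  rw [Finset.prod_inv_distrib]
  refine inv_eq_of_mul_eq_one_right h.symm

/-- The Cauchy–Vandermonde determinant. -/
theorem det_cauchy_vandermonde {m l : ℕ} {q : Fin l → ℂ} (hq : Function.Injective q)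
    (y : Fin m ⊕ Fin l → ℂ) (hy : ∀ b j, y b ≠ q j) (ψ : Fin m → ℂ[X]) (hm : ∀ a, (ψ a).Monic)
    (hd : ∀ a, (ψ a).natDegree = a) :
    (∏ b, ∏ j, (y b - q j)) * (Matrix.of fun b a =>
        Sum.elim (fun a => (ψ a).eval (y b)) (fun j => (y b - q j)⁻¹) a).det =
      (Matrix.vandermonde q).det *
        (Matrix.vandermonde fun i => y ((swapSumEquiv m l).symm i)).det := by
  set M : Matrix (Fin m ⊕ Fin l) (Fin m ⊕ Fin l) ℂ := Matrix.of fun b a =>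
    Sum.elim (fun a => (ψ a).eval (y b)) (fun j => (y b - q j)⁻¹) a with hM
  -- These partial fraction coefficients turn the columns 1/(y - q_j) into ∏_{j ≤ k} 1/(y - q_j);
  -- the matrix is triangular with determinant 1/Δ(q).
  set c : Matrix (Fin l) (Fin l) ℂ := Matrix.of fun j k =>
    if j ≤ k then Lagrange.nodalWeight (Finset.Iic k) q j else 0 with hc
  have hcdet : (Matrix.vandermonde q).det * c.det = 1 := by
    have htri : c.BlockTriangular id := fun j k hjk => by
      simp only [hc, Matrix.of_apply]
      exact if_neg (not_le.2 hjk)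
    rw [Matrix.det_of_isUpperTriangular htri, Matrix.det_vandermonde]
    have h1 : ∀ k : Fin l, c k k = ∏ j ∈ Finset.Iio k, (q k - q j)⁻¹ := fun k => by
      have : (Finset.Iic k).erase k = Finset.Iio k := by
        ext j
        simp [lt_iff_le_and_ne, and_comm]
      simp only [hc, Matrix.of_apply]
      rw [if_pos le_rfl, Lagrange.nodalWeight, this]
    simp only [h1]
    have h2 : ∏ k : Fin l, ∏ j ∈ Finset.Iio k, (q k - q j)⁻¹ =
        ∏ i : Fin l, ∏ j ∈ Finset.Ioi i, (q j - q i)⁻¹ := Finset.prod_comm' (by simp)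
    rw [h2, ← Finset.prod_mul_distrib]
    refine Finset.prod_eq_one fun i _ => ?_
    rw [← Finset.prod_mul_distrib]
    exact Finset.prod_eq_one fun j hj =>
      mul_inv_cancel₀ (sub_ne_zero.2 fun h => (Finset.mem_Ioi.1 hj).ne' (hq h))
  -- Clearing the row denominators ∏_j (y - q_j) leaves monic polynomials of degrees l + a and l - 1
  -- - k, each degree below m + l once, in the order of `swapSumEquiv`.
  set χ : Fin m ⊕ Fin l → ℂ[X] := Sum.elim (fun a => (∏ j, (X - C (q j))) * ψ a)
    fun k => ∏ j ∈ Finset.Ioi k, (X - C (q j)) with hχ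
  have hχm : ∀ a, (χ a).Monic := by
    rintro (a | k)
    · exact (monic_prod_X_sub_C _ _).mul (hm a)
    · exact monic_prod_X_sub_C _ _
  have hχd : ∀ a, (χ a).natDegree = swapSumEquiv m l a := by
    rintro (a | k)
    · simp only [hχ, Sum.elim_inl]
      rw [swapSumEquiv_inl, (monic_prod_X_sub_C _ _).natDegree_mul (hm a), hd,
        natDegree_prod_of_monic _ _ fun i _ => monic_X_sub_C _]
      simp
    · simp only [hχ, Sum.elim_inr]
      rw [swapSumEquiv_inr, natDegree_prod_of_monic _ _ fun i _ => monic_X_sub_C _]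
      simp
  set W : Matrix (Fin m ⊕ Fin l) (Fin m ⊕ Fin l) ℂ := M * Matrix.fromBlocks 1 0 0 c with hW
  have hfac : (Matrix.of fun b a => (∏ j, (y b - q j)) * W b a) = Matrix.of fun b a => (χ a).eval (y b) := by
    ext b a
    have hne : ∀ j, y b - q j ≠ 0 := fun j => sub_ne_zero.2 (hy b j)
    rcases a with a | k
    · simp only [hW, Matrix.of_apply, Matrix.mul_apply, Fintype.sum_sum_type, Matrix.fromBlocks_apply₁₁,
        Matrix.fromBlocks_apply₂₁, Matrix.zero_apply, mul_zero, Finset.sum_const_zero, add_zero,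
        Matrix.one_apply, mul_ite, mul_one, Finset.sum_ite_eq', Finset.mem_univ, if_true]
      simp [hM, hχ, eval_prod]
    · simp only [hW, Matrix.of_apply, Matrix.mul_apply, Fintype.sum_sum_type, Matrix.fromBlocks_apply₁₂,
        Matrix.fromBlocks_apply₂₂, Matrix.zero_apply, mul_zero, Finset.sum_const_zero, zero_add,
        hM, hc, Sum.elim_inr, mul_ite, hχ, eval_prod, eval_sub, eval_X, eval_C]
      have h1 : ∑ j, (if j ≤ k then (y b - q j)⁻¹ * Lagrange.nodalWeight (Finset.Iic k) q j else 0) =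
          ∏ j ∈ Finset.Iic k, (y b - q j)⁻¹ := by
        rw [prod_inv_sub_eq_sum hq k (hy b), ← Finset.sum_filter]
        have : Finset.univ.filter (fun j => j ≤ k) = Finset.Iic k := by
          ext j
          simp
        rw [this]
        exact Finset.sum_congr rfl fun j _ => mul_comm _ _
      have h2 : (Finset.univ : Finset (Fin l)) = Finset.Iic k ∪ Finset.Ioi k := by
        ext j
        simp [le_or_gt]
      have h3 : Disjoint (Finset.Iic k) (Finset.Ioi k) := by
        rw [Finset.disjoint_left]
        intro j hj hj'
        exact (Finset.mem_Iic.1 hj).not_gt (Finset.mem_Ioi.1 hj')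
      rw [h1, h2, Finset.prod_union h3, mul_right_comm, ← Finset.prod_mul_distrib,
        Finset.prod_eq_one fun j _ => mul_inv_cancel₀ (hne j), one_mul]
  have hdet := congrArg Matrix.det hfac
  rw [Matrix.det_mul_column, hW, Matrix.det_mul, Matrix.det_fromBlocks_zero₂₁, Matrix.det_one, one_mul,
    det_eval_monic_family (swapSumEquiv m l) y χ hχm hχd] at hdet
  rw [← hdet]
  linear_combination (-(∏ b, ∏ j, (y b - q j)) * M.det) * hcdet

/-! ### Andréief's identity -/

/-- Andréief's integration identity, with additional constant rows in the second determinant. -/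
theorem andreief {ι κ : Type*} [Fintype ι] [DecidableEq ι] [Fintype κ] [DecidableEq κ]
    (φ : ι → ℝ → ℂ) (ψ : ι ⊕ κ → ℝ → ℂ) (P : κ → ι ⊕ κ → ℂ)
    (hint : ∀ a c, Integrable fun t => φ a t * ψ c t) :
    Integrable (fun y : ι → ℝ => (Matrix.of fun b a => φ a (y b)).det *
      (Matrix.of fun r c => Sum.elim (fun b => ψ c (y b)) (fun i => P i c) r).det) ∧
    ∫ y : ι → ℝ, (Matrix.of fun b a => φ a (y b)).det *
      (Matrix.of fun r c => Sum.elim (fun b => ψ c (y b)) (fun i => P i c) r).det =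
      (Fintype.card ι).factorial *
        (Matrix.of fun r c => Sum.elim (fun a => ∫ t, φ a t * ψ c t) (fun i => P i c) r).det := by
  have hexp : ∀ y : ι → ℝ, (Matrix.of fun b a => φ a (y b)).det *
      (Matrix.of fun r c => Sum.elim (fun b => ψ c (y b)) (fun i => P i c) r).det =
      ∑ σ : Equiv.Perm ι, ∑ τ : Equiv.Perm (ι ⊕ κ),
        (((Equiv.Perm.sign σ : ℤ) : ℂ) * ((Equiv.Perm.sign τ : ℤ) : ℂ) *
          ∏ i, P i (τ (Sum.inr i))) * ∏ b, (φ (σ b) (y b) * ψ (τ (Sum.inl b)) (y b)) := by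
    intro y
    rw [← Matrix.det_transpose, Matrix.det_apply', ← Matrix.det_transpose, Matrix.det_apply',
      Finset.sum_mul_sum]
    refine Finset.sum_congr rfl fun σ _ => Finset.sum_congr rfl fun τ _ => ?_
    simp only [Matrix.transpose_apply, Matrix.of_apply, Fintype.prod_sum_type, Sum.elim_inl,
      Sum.elim_inr, Finset.prod_mul_distrib]
    ring
  have hterm : ∀ (σ : Equiv.Perm ι) (τ : Equiv.Perm (ι ⊕ κ)), Integrable fun y : ι → ℝ =>
      (((Equiv.Perm.sign σ : ℤ) : ℂ) * ((Equiv.Perm.sign τ : ℤ) : ℂ) *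
        ∏ i, P i (τ (Sum.inr i))) * ∏ b, (φ (σ b) (y b) * ψ (τ (Sum.inl b)) (y b)) := fun σ τ =>
    (Integrable.fintype_prod_dep (f := fun b t => φ (σ b) t * ψ (τ (Sum.inl b)) t)
      fun b => hint _ _).const_mul _
  simp only [hexp]
  refine ⟨integrable_finsetSum _ fun σ _ => integrable_finsetSum _ fun τ _ => hterm σ τ, ?_⟩
  rw [integral_finsetSum _ fun σ _ => integrable_finsetSum _ fun τ _ => hterm σ τ]
  simp only [integral_finsetSum _ fun τ _ => hterm _ τ, integral_const_mul]
  set G : Matrix (ι ⊕ κ) (ι ⊕ κ) ℂ :=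
    Matrix.of fun r c => Sum.elim (fun a => ∫ t, φ a t * ψ c t) (fun i => P i c) r with hG
  -- For fixed σ the sum over τ is the determinant with rows permuted by σ, and the resulting sign
  -- cancels that of σ. All card(ι)! terms are therefore equal.
  have hσ : ∀ σ : Equiv.Perm ι, ∑ τ : Equiv.Perm (ι ⊕ κ),
      (((Equiv.Perm.sign σ : ℤ) : ℂ) * ((Equiv.Perm.sign τ : ℤ) : ℂ) *
        ∏ i, P i (τ (Sum.inr i))) * ∫ y : ι → ℝ, ∏ b, (φ (σ b) (y b) * ψ (τ (Sum.inl b)) (y b)) =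
      G.det := fun σ => by
    have h1 : ((Equiv.Perm.sign σ : ℤ) : ℂ) * (G.submatrix (σ.sumCongr (Equiv.refl κ)) id).det =
        G.det := by
      rw [Matrix.det_permute, Equiv.Perm.sign_sumCongr, Equiv.Perm.sign_refl, mul_one, ← mul_assoc]
      rcases Int.units_eq_one_or (Equiv.Perm.sign σ) with h | h <;> simp [h]
    rw [← h1, ← Matrix.det_transpose (G.submatrix _ _), Matrix.det_apply', Finset.mul_sum]
    refine Finset.sum_congr rfl fun τ _ => ?_
    rw [integral_fintype_prod_volume_eq_prod (fun b t => φ (σ b) t * ψ (τ (Sum.inl b)) t)]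
    simp only [hG, Matrix.transpose_apply, Matrix.submatrix_apply, Matrix.of_apply,
      Fintype.prod_sum_type, Equiv.sumCongr_apply, Sum.map_inl, Sum.map_inr, Sum.elim_inl,
      Sum.elim_inr, Equiv.refl_apply, id_eq]
    ring
  simp only [hσ, Finset.sum_const, Finset.card_univ, Fintype.card_perm, nsmul_eq_mul]
/-! ### Orthogonality and expansions -/

variable {N : ℕ} {V : ℝ → ℝ}

theorem integrable_eval_mul_weight
    (hmom : ∀ k : ℕ, Integrable (fun x : ℝ => x ^ k * Real.exp (-((N : ℝ) * V x)))) (f : ℝ[X]) :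
    Integrable fun x : ℝ => f.eval x * weight N V x := by
  simpa using integrable_wInner hmom f 1

/-- The moment functional `f ↦ ∫ f e^{-NV}`. -/
def momentFunctional
    (hmom : ∀ k : ℕ, Integrable (fun x : ℝ => x ^ k * Real.exp (-((N : ℝ) * V x)))) :
    ℝ[X] →ₗ[ℝ] ℝ where
  toFun f := ∫ x : ℝ, f.eval x * weight N V x
  map_add' f g := by
    simp only [eval_add, add_mul]
    exact integral_add (integrable_eval_mul_weight hmom f) (integrable_eval_mul_weight hmom g)
  map_smul' c f := by
    simp only [eval_smul, smul_eq_mul, mul_assoc, RingHom.id_apply]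
    exact integral_const_mul _ _

theorem wInner_eq_momentFunctional
    (hmom : ∀ k : ℕ, Integrable (fun x : ℝ => x ^ k * Real.exp (-((N : ℝ) * V x)))) (f g : ℝ[X]) :
    wInner N V f g = momentFunctional hmom (f * g) := by
  simp [wInner, momentFunctional]

theorem wInner_comm (f g : ℝ[X]) : wInner N V f g = wInner N V g f := by
  simp only [wInner, mul_comm (eval _ f)]

theorem wInner_mul_left (f g r : ℝ[X]) : wInner N V (f * r) g = wInner N V f (r * g) := by
  simp only [wInner, eval_mul, mul_assoc]

theorem wInner_add_right
    (hmom : ∀ k : ℕ, Integrable (fun x : ℝ => x ^ k * Real.exp (-((N : ℝ) * V x))))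
    (f g g' : ℝ[X]) : wInner N V f (g + g') = wInner N V f g + wInner N V f g' := by
  simp only [wInner_eq_momentFunctional hmom, mul_add, map_add]

theorem wInner_smul_right
    (hmom : ∀ k : ℕ, Integrable (fun x : ℝ => x ^ k * Real.exp (-((N : ℝ) * V x))))
    (f g : ℝ[X]) (c : ℝ) : wInner N V f (c • g) = c * wInner N V f g := by
  simp only [wInner_eq_momentFunctional hmom, mul_smul_comm, map_smul, smul_eq_mul]

theorem wInner_sum_right
    (hmom : ∀ k : ℕ, Integrable (fun x : ℝ => x ^ k * Real.exp (-((N : ℝ) * V x))))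
    {ι : Type*} (s : Finset ι) (f : ℝ[X]) (g : ι → ℝ[X]) :
    wInner N V f (∑ i ∈ s, g i) = ∑ i ∈ s, wInner N V f (g i) := by
  simp only [wInner_eq_momentFunctional hmom, Finset.mul_sum, map_sum]

theorem wInner_monicOP_self_pos
    (hmom : ∀ k : ℕ, Integrable (fun x : ℝ => x ^ k * Real.exp (-((N : ℝ) * V x)))) (n : ℕ) :
    0 < wInner N V (monicOP N V n) (monicOP N V n) :=
  wInner_self_pos hmom (monicOP_monic N V n).1.ne_zero

theorem wInner_monicOP_of_ne
    (hmom : ∀ k : ℕ, Integrable (fun x : ℝ => x ^ k * Real.exp (-((N : ℝ) * V x)))) {n m : ℕ}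
    (h : n ≠ m) : wInner N V (monicOP N V n) (monicOP N V m) = 0 := by
  rw [wInner_monicOP hmom, if_neg h]

theorem gam_sq
    (hmom : ∀ k : ℕ, Integrable (fun x : ℝ => x ^ k * Real.exp (-((N : ℝ) * V x)))) (n : ℕ) :
    gam N V n ^ 2 = (wInner N V (monicOP N V n) (monicOP N V n))⁻¹ := by
  rw [wInner_monicOP hmom, if_pos rfl, inv_inv]

theorem exists_eq_sum_monicOP (n : ℕ) (f : ℝ[X]) (hf : f.degree < n) :
    ∃ c : ℕ → ℝ, f = ∑ j ∈ Finset.range n, c j • monicOP N V j := by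
  induction n generalizing f with
  | zero =>
    refine ⟨0, ?_⟩
    simpa [Nat.WithBot.lt_zero_iff] using hf
  | succ n ih =>
    obtain ⟨hm, hd⟩ := monicOP_monic N V n
    have hlt : (f - f.coeff n • monicOP N V n).degree < n := by
      rw [degree_lt_iff_coeff_zero]
      intro k hk
      rw [coeff_sub, coeff_smul, smul_eq_mul]
      rcases hk.eq_or_lt with rfl | hk
      · have := hm.coeff_natDegree
        rw [hd] at this
        rw [this, mul_one, sub_self]
      · rw [(degree_lt_iff_coeff_zero f (n + 1)).1 hf k hk,
          coeff_eq_zero_of_natDegree_lt (hd.trans_lt hk), mul_zero, sub_zero]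
    obtain ⟨c, hc⟩ := ih _ hlt
    refine ⟨Function.update c n (f.coeff n), ?_⟩
    rw [Finset.sum_range_succ, Function.update_self, Finset.sum_congr rfl fun j hj => by
      rw [Function.update_of_ne (Finset.mem_range.1 hj).ne], ← hc]
    ring

theorem wInner_monicOP_of_degree_lt
    (hmom : ∀ k : ℕ, Integrable (fun x : ℝ => x ^ k * Real.exp (-((N : ℝ) * V x)))) {n : ℕ}
    {f : ℝ[X]} (hf : f.degree < n) : wInner N V (monicOP N V n) f = 0 := by
  obtain ⟨c, rfl⟩ := exists_eq_sum_monicOP (N := N) (V := V) n f hf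
  rw [wInner_sum_right hmom]
  refine Finset.sum_eq_zero fun j hj => ?_
  rw [wInner_smul_right hmom, wInner_monicOP_of_ne hmom (Finset.mem_range.1 hj).ne', mul_zero]

theorem wInner_monicOP_of_monic
    (hmom : ∀ k : ℕ, Integrable (fun x : ℝ => x ^ k * Real.exp (-((N : ℝ) * V x)))) {n : ℕ}
    {f : ℝ[X]} (hf : f.Monic) (hd : f.natDegree = n) :
    wInner N V (monicOP N V n) f = wInner N V (monicOP N V n) (monicOP N V n) := by
  obtain ⟨hm, hmd⟩ := monicOP_monic N V n
  have hlt : (f - monicOP N V n).degree < n := by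
    have h : f.degree = (monicOP N V n).degree := by
      rw [degree_eq_natDegree hf.ne_zero, degree_eq_natDegree hm.ne_zero, hd, hmd]
    have := degree_sub_lt_left h hf.ne_zero (hf.leadingCoeff.trans hm.leadingCoeff.symm)
    rwa [degree_eq_natDegree hf.ne_zero, hd] at this
  have h := wInner_monicOP_of_degree_lt hmom hlt
  have h2 : f = monicOP N V n + (f - monicOP N V n) := by ring
  conv_lhs => rw [h2]
  rw [wInner_add_right hmom, h, add_zero]

theorem eq_sum_monicOP
    (hmom : ∀ k : ℕ, Integrable (fun x : ℝ => x ^ k * Real.exp (-((N : ℝ) * V x)))) (n : ℕ)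
    (f : ℝ[X]) (hf : f.degree < n) :
    f = ∑ j ∈ Finset.range n, (wInner N V (monicOP N V j) f /
      wInner N V (monicOP N V j) (monicOP N V j)) • monicOP N V j := by
  obtain ⟨c, hc⟩ := exists_eq_sum_monicOP (N := N) (V := V) n f hf
  have h : ∀ j ∈ Finset.range n, wInner N V (monicOP N V j) f /
      wInner N V (monicOP N V j) (monicOP N V j) = c j := fun j hj => by
    rw [div_eq_iff (wInner_monicOP_self_pos hmom j).ne']
    conv_lhs => rw [hc]
    rw [wInner_sum_right hmom, Finset.sum_eq_single j]
    · rw [wInner_smul_right hmom]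
    · intro i _ hi
      rw [wInner_smul_right hmom, wInner_monicOP_of_ne hmom hi.symm, mul_zero]
    · exact fun h => absurd hj h
  rw [Finset.sum_congr rfl fun j hj => by rw [h j hj]]
  exact hc

/-! ### The Cauchy transform -/

theorem ofReal_sub_ne_zero {q : ℂ} (hq : q.im ≠ 0) (x : ℝ) : (x : ℂ) - q ≠ 0 := fun h => hq (by
  have := congrArg Complex.im h
  simpa using this)

/-- The kernel is bounded by 1/|Im q|. -/
theorem integrable_cauchy
    (hmom : ∀ k : ℕ, Integrable (fun x : ℝ => x ^ k * Real.exp (-((N : ℝ) * V x)))) {q : ℂ}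
    (hq : q.im ≠ 0) (f : ℝ[X]) :
    Integrable fun x : ℝ => ((f.eval x : ℝ) : ℂ) / ((x : ℂ) - q) * (weight N V x : ℂ) := by
  have h := (integrable_eval_mul_weight hmom f).ofReal (𝕜 := ℂ)
  have hb : ∀ x : ℝ, ‖((x : ℂ) - q)⁻¹‖ ≤ |q.im|⁻¹ := fun x => by
    rw [norm_inv]
    refine inv_anti₀ (abs_pos.2 hq) ?_
    have := Complex.abs_im_le_norm ((x : ℂ) - q)
    simpa using this
  have hc : Continuous fun x : ℝ => ((x : ℂ) - q)⁻¹ :=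
    (Complex.continuous_ofReal.sub continuous_const).inv₀ fun x => ofReal_sub_ne_zero hq x
  refine (h.bdd_mul (c := |q.im|⁻¹) hc.aestronglyMeasurable
    (Filter.Eventually.of_forall hb)).congr (Filter.Eventually.of_forall fun x => ?_)
  simp only [RCLike.ofReal_mul, Complex.coe_algebraMap]
  ring

/-- The functional `f ↦ ∫ f(x) / (x - q) e^{-NV(x)} dx`. -/
def cauchyFunctional
    (hmom : ∀ k : ℕ, Integrable (fun x : ℝ => x ^ k * Real.exp (-((N : ℝ) * V x)))) {q : ℂ}
    (hq : q.im ≠ 0) : ℝ[X] →ₗ[ℝ] ℂ where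
  toFun f := ∫ x : ℝ, ((f.eval x : ℝ) : ℂ) / ((x : ℂ) - q) * (weight N V x : ℂ)
  map_add' f g := by
    rw [← integral_add (integrable_cauchy hmom hq f) (integrable_cauchy hmom hq g)]
    congr 1
    ext x
    rw [eval_add]
    push_cast
    ring
  map_smul' c f := by
    rw [RingHom.id_apply, Complex.real_smul, ← integral_const_mul]
    congr 1
    ext x
    rw [eval_smul, smul_eq_mul]
    push_cast
    ring

/-- Integrate x/(x - q) = q/(x - q) + 1. -/
theorem cauchyFunctional_mul_X
    (hmom : ∀ k : ℕ, Integrable (fun x : ℝ => x ^ k * Real.exp (-((N : ℝ) * V x)))) {q : ℂ}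
    (hq : q.im ≠ 0) (f : ℝ[X]) :
    cauchyFunctional hmom hq (f * X) =
      q * cauchyFunctional hmom hq f + (momentFunctional hmom f : ℂ) := by
  have h1 : ((momentFunctional hmom f : ℝ) : ℂ) = ∫ x : ℝ, ((f.eval x * weight N V x : ℝ) : ℂ) :=
    integral_ofReal.symm
  have h2 : Integrable fun x : ℝ => ((f.eval x * weight N V x : ℝ) : ℂ) :=
    (integrable_eval_mul_weight hmom f).ofReal
  rw [h1]
  simp only [cauchyFunctional, LinearMap.coe_mk, AddHom.coe_mk]
  rw [← integral_const_mul, ← integral_add ((integrable_cauchy hmom hq f).const_mul q) h2]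
  congr 1
  ext x
  have := ofReal_sub_ne_zero hq x
  simp only [eval_mul, eval_X]
  push_cast
  field_simp
  ring

/-- Raising the power from k to k + 1 adds the moment of π_n x^k, which vanishes for k < n. This
produces the Vandermonde factors next to h_n(q). -/
theorem cauchyFunctional_monicOP_mul_X_pow
    (hmom : ∀ k : ℕ, Integrable (fun x : ℝ => x ^ k * Real.exp (-((N : ℝ) * V x)))) {q : ℂ}
    (hq : q.im ≠ 0) {n k : ℕ} (hk : k ≤ n) :
    cauchyFunctional hmom hq (monicOP N V n * X ^ k) =
      q ^ k * cauchyFunctional hmom hq (monicOP N V n) := by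
  induction k with
  | zero => simp
  | succ k ih =>
    have h0 : momentFunctional hmom (monicOP N V n * X ^ k) = 0 := by
      rw [← wInner_eq_momentFunctional hmom]
      refine wInner_monicOP_of_degree_lt hmom ?_
      rw [degree_X_pow]
      exact_mod_cast hk
    rw [pow_succ, ← mul_assoc, cauchyFunctional_mul_X, ih (by omega), h0, Complex.ofReal_zero,
      add_zero, pow_succ]
    ring

theorem hFun_eq
    (hmom : ∀ k : ℕ, Integrable (fun x : ℝ => x ^ k * Real.exp (-((N : ℝ) * V x)))) {q : ℂ}
    (hq : q.im ≠ 0) (n : ℕ) :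
    hFun N V n q = 1 / (2 * (Real.pi : ℂ) * Complex.I) *
      cauchyFunctional hmom hq (monicOP N V n) := rfl

/-! ### The change of basis -/

theorem det_of_blockTriangular_injective {n : Type*} [Fintype n] [DecidableEq n]
    {M : Matrix n n ℂ} {b : n → ℕ} (hb : Function.Injective b) (h : M.BlockTriangular b) :
    M.det = ∏ i, M i i := by
  rw [h.det, Finset.prod_image hb.injOn]
  refine Finset.prod_congr rfl fun i _ => ?_
  let : Unique {a // b a = b i} := ⟨⟨⟨i, rfl⟩⟩, fun j => Subtype.ext (hb j.property)⟩
  exact (Matrix.det_unique _).trans rfl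

/-- The degrees `m + l - 1, …, m` and `m + l, …, m + 2l - 1`. -/
def pairDegree (m l : ℕ) : Fin l ⊕ Fin l → ℕ :=
  Sum.elim (fun k => m + (l - 1 - k)) fun k => m + l + k

/-- The polynomials `π_{m+l-1} x^k` and `π_{m+l} x^k`. -/
def shiftedOP (N : ℕ) (V : ℝ → ℝ) (m l : ℕ) : Fin l ⊕ Fin l → ℝ[X] :=
  Sum.elim (fun k => monicOP N V (m + l - 1) * X ^ (k : ℕ)) fun k => monicOP N V (m + l) * X ^ (k : ℕ)

/-- The coordinates of `shiftedOP` in the basis of orthogonal polynomials. -/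
def shiftedCoeff (N : ℕ) (V : ℝ → ℝ) (m l : ℕ) (c s : Fin l ⊕ Fin l) : ℝ :=
  wInner N V (monicOP N V (pairDegree m l c)) (shiftedOP N V m l s) /
    wInner N V (monicOP N V (pairDegree m l c)) (monicOP N V (pairDegree m l c))

theorem degree_monicOP_mul_X_pow (n k : ℕ) :
    (monicOP N V n * X ^ k).degree = ((n + k : ℕ) : WithBot ℕ) := by
  obtain ⟨hm, hd⟩ := monicOP_monic N V n
  rw [degree_eq_natDegree (hm.mul (monic_X_pow k)).ne_zero, hm.natDegree_mul (monic_X_pow k), hd,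
    natDegree_X_pow]

/-- Multiplication by x^k is symmetric for the inner product, so π_n x^k has components only in
degrees from n - k to n + k. -/
theorem wInner_shiftedOP_of_lt
    (hmom : ∀ k : ℕ, Integrable (fun x : ℝ => x ^ k * Real.exp (-((N : ℝ) * V x)))) {n j k : ℕ}
    (h : j + k < n ∨ n + k < j) :
    wInner N V (monicOP N V j) (monicOP N V n * X ^ k) = 0 := by
  rcases h with h | h
  · rw [wInner_comm, wInner_mul_left]
    refine wInner_monicOP_of_degree_lt hmom ?_
    rw [mul_comm, degree_monicOP_mul_X_pow]
    exact_mod_cast h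
  · refine wInner_monicOP_of_degree_lt hmom ?_
    rw [degree_monicOP_mul_X_pow]
    exact_mod_cast h

theorem wInner_shiftedOP_top
    (hmom : ∀ k : ℕ, Integrable (fun x : ℝ => x ^ k * Real.exp (-((N : ℝ) * V x)))) (n k : ℕ) :
    wInner N V (monicOP N V (n + k)) (monicOP N V n * X ^ k) =
      wInner N V (monicOP N V (n + k)) (monicOP N V (n + k)) := by
  obtain ⟨hm, hd⟩ := monicOP_monic N V n
  refine wInner_monicOP_of_monic hmom (hm.mul (monic_X_pow k)) ?_
  rw [hm.natDegree_mul (monic_X_pow k), hd, natDegree_X_pow]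

theorem wInner_shiftedOP_bot
    (hmom : ∀ k : ℕ, Integrable (fun x : ℝ => x ^ k * Real.exp (-((N : ℝ) * V x)))) (n k : ℕ) :
    wInner N V (monicOP N V n) (monicOP N V (n + k) * X ^ k) =
      wInner N V (monicOP N V (n + k)) (monicOP N V (n + k)) := by
  rw [wInner_comm, wInner_mul_left, mul_comm, wInner_shiftedOP_top hmom]

/-- With N = m + l, order the degrees as N-1, N, N-2, N+1, …, spreading out from the middle.
Multiplying by x widens the degree range by one on each side, so the change of basis is triangular.
The diagonal entries are ν_{N-1}/ν_{N-1-k} for π_{N-1}x^k, which newly reaches its lowest degree,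
and 1 for π_N x^k, which newly reaches its highest. -/
theorem det_shiftedCoeff
    (hmom : ∀ k : ℕ, Integrable (fun x : ℝ => x ^ k * Real.exp (-((N : ℝ) * V x)))) (m l : ℕ) :
    (Matrix.of fun c s => (shiftedCoeff N V m l c s : ℂ)).det =
      ∏ k : Fin l, ((wInner N V (monicOP N V (m + l - 1)) (monicOP N V (m + l - 1)) /
        wInner N V (monicOP N V (m + (l - 1 - k))) (monicOP N V (m + (l - 1 - k))) : ℝ) : ℂ) := by
  -- Ranks of the interleaved order: even for degrees N-1-k, odd for degrees N+k.
  set b : Fin l ⊕ Fin l → ℕ := Sum.elim (fun k => 2 * (k : ℕ)) fun k => 2 * (k : ℕ) + 1 with hb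
  have hbi : Function.Injective b := by
    rintro (i | i) (j | j) h <;> simp only [hb, Sum.elim_inl, Sum.elim_inr] at h
    · congr 1; ext; omega
    · omega
    · omega
    · congr 1; ext; omega
  have htri : (Matrix.of fun c s => (shiftedCoeff N V m l c s : ℂ)).BlockTriangular b := by
    intro c s h
    have h0 : wInner N V (monicOP N V (pairDegree m l c)) (shiftedOP N V m l s) = 0 := by
      rcases c with i | i <;> rcases s with j | j <;>
        simp only [hb, Sum.elim_inl, Sum.elim_inr] at h <;>
        refine wInner_shiftedOP_of_lt hmom ?_ <;>
        simp only [pairDegree, Sum.elim_inl, Sum.elim_inr] <;> omega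
    simp only [Matrix.of_apply, shiftedCoeff, h0, zero_div, Complex.ofReal_zero]
  rw [det_of_blockTriangular_injective hbi htri, Fintype.prod_sum_type]
  have h2 : ∀ k : Fin l, shiftedCoeff N V m l (Sum.inr k) (Sum.inr k) = 1 := fun k => by
    simp only [shiftedCoeff, pairDegree, shiftedOP, Sum.elim_inr]
    rw [wInner_shiftedOP_top hmom, div_self (wInner_monicOP_self_pos hmom _).ne']
  have h1 : ∀ k : Fin l, shiftedCoeff N V m l (Sum.inl k) (Sum.inl k) =
      wInner N V (monicOP N V (m + l - 1)) (monicOP N V (m + l - 1)) /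
        wInner N V (monicOP N V (m + (l - 1 - k))) (monicOP N V (m + (l - 1 - k))) := fun k => by
    simp only [shiftedCoeff, pairDegree, shiftedOP, Sum.elim_inl]
    have h3 : m + l - 1 = m + (l - 1 - k) + k := by omega
    have := wInner_shiftedOP_bot hmom (N := N) (V := V) (m + (l - 1 - k)) k
    rw [← h3] at this
    rw [this]
  simp only [Matrix.of_apply, h1, h2, Complex.ofReal_one, Finset.prod_const_one, mul_one]

/-- The bijection listing the degrees below `m + 2l`. -/
def degreeEquiv (m l : ℕ) : (Fin m ⊕ Fin l) ⊕ Fin l ≃ Fin (m + l + l) :=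
  ((revSumEquiv m l).sumCongr (Equiv.refl _)).trans finSumFinEquiv

theorem shiftedOP_eq_sum
    (hmom : ∀ k : ℕ, Integrable (fun x : ℝ => x ^ k * Real.exp (-((N : ℝ) * V x)))) (m l : ℕ)
    (s : Fin l ⊕ Fin l) :
    shiftedOP N V m l s =
      ∑ c, shiftedCoeff N V m l c s • monicOP N V (pairDegree m l c) := by
  have hdeg : (shiftedOP N V m l s).degree < ((m + l + l : ℕ) : WithBot ℕ) := by
    rcases s with k | k <;> simp only [shiftedOP, Sum.elim_inl, Sum.elim_inr] <;>
      rw [degree_monicOP_mul_X_pow] <;> exact Nat.cast_lt.2 (by omega)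
  -- The lowest degree reached is m + l - 1 - k ≥ m, because k < l.
  have hlow : ∀ a : Fin m, wInner N V (monicOP N V a) (shiftedOP N V m l s) = 0 := fun a => by
    rcases s with k | k <;> refine wInner_shiftedOP_of_lt hmom (Or.inl ?_) <;> omega
  have h := eq_sum_monicOP hmom _ _ hdeg
  rw [← Fin.sum_univ_eq_sum_range (fun j => (wInner N V (monicOP N V j) (shiftedOP N V m l s) /
      wInner N V (monicOP N V j) (monicOP N V j)) • monicOP N V j),
    ← (degreeEquiv m l).sum_comp, Fintype.sum_sum_type, Fintype.sum_sum_type] at h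
  have e1 : ∀ a : Fin m, ((degreeEquiv m l (Sum.inl (Sum.inl a)) : Fin _) : ℕ) = a := fun a => by
    simp [degreeEquiv]
  have e2 : ∀ k : Fin l, ((degreeEquiv m l (Sum.inl (Sum.inr k)) : Fin _) : ℕ) = m + (l - 1 - k) :=
    fun k => by simp [degreeEquiv]
  have e3 : ∀ k : Fin l, ((degreeEquiv m l (Sum.inr k) : Fin _) : ℕ) = m + l + k :=
    fun k => by simp [degreeEquiv]
  simp only [e1, e2, e3, hlow, zero_div, zero_smul, Finset.sum_const_zero, zero_add] at h
  rw [Fintype.sum_sum_type]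
  exact h

/-- Any family of functionals takes the basis `shiftedOP` to the basis of orthogonal polynomials
with the same change of basis matrix. -/
theorem det_functional_shiftedOP
    (hmom : ∀ k : ℕ, Integrable (fun x : ℝ => x ^ k * Real.exp (-((N : ℝ) * V x)))) (m l : ℕ)
    (Λ : Fin l ⊕ Fin l → ℝ[X] →ₗ[ℝ] ℂ) :
    (Matrix.of fun r s => Λ r (shiftedOP N V m l s)).det =
      (Matrix.of fun r c => Λ r (monicOP N V (pairDegree m l c))).det *
      ∏ k : Fin l, ((wInner N V (monicOP N V (m + l - 1)) (monicOP N V (m + l - 1)) /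
        wInner N V (monicOP N V (m + (l - 1 - k))) (monicOP N V (m + (l - 1 - k))) : ℝ) : ℂ) := by
  rw [← det_shiftedCoeff hmom, ← Matrix.det_mul]
  congr 1
  ext r s
  rw [Matrix.of_apply, shiftedOP_eq_sum hmom, map_sum, Matrix.mul_apply]
  refine Finset.sum_congr rfl fun c _ => ?_
  rw [map_smul, Complex.real_smul, mul_comm]
  rfl
/-! ### The normalizing constant and the expected ratio -/

theorem eval_map_ofReal (f : ℝ[X]) (x : ℝ) :
    (f.map (algebraMap ℝ ℂ)).eval (x : ℂ) = ((f.eval x : ℝ) : ℂ) := by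
  rw [eval_map, ← Complex.coe_algebraMap, eval₂_at_apply]

theorem monic_map_monicOP (n : ℕ) : ((monicOP N V n).map (algebraMap ℝ ℂ)).Monic :=
  (monicOP_monic N V n).1.map _

theorem natDegree_map_monicOP (n : ℕ) :
    ((monicOP N V n).map (algebraMap ℝ ℂ)).natDegree = n := by
  rw [(monicOP_monic N V n).1.natDegree_map, (monicOP_monic N V n).2]

theorem det_vandermonde_ofReal {n : ℕ} (x : Fin n → ℝ) :
    (Matrix.vandermonde fun i => (x i : ℂ)).det = ((Matrix.vandermonde x).det : ℂ) := by
  rw [Matrix.det_vandermonde, Matrix.det_vandermonde]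
  push_cast
  rfl

theorem integrable_wInner_ofReal
    (hmom : ∀ k : ℕ, Integrable (fun x : ℝ => x ^ k * Real.exp (-((N : ℝ) * V x)))) (f g : ℝ[X]) :
    Integrable fun t : ℝ => (weight N V t : ℂ) * ((f.eval t : ℝ) : ℂ) * ((g.eval t : ℝ) : ℂ) := by
  have h : Integrable fun t : ℝ => ((f.eval t * g.eval t * weight N V t : ℝ) : ℂ) :=
    (integrable_wInner hmom f g).ofReal
  refine h.congr (Filter.Eventually.of_forall fun t => ?_)
  push_cast
  ring

theorem integral_wInner_ofReal (f g : ℝ[X]) :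
    ∫ t : ℝ, (weight N V t : ℂ) * ((f.eval t : ℝ) : ℂ) * ((g.eval t : ℝ) : ℂ) =
      ((wInner N V f g : ℝ) : ℂ) := by
  have h : ((∫ t, (f.eval t * g.eval t * weight N V t) : ℝ) : ℂ) =
      ∫ t, ((f.eval t * g.eval t * weight N V t : ℝ) : ℂ) := integral_ofReal.symm
  rw [wInner, h]
  congr 1
  ext t
  push_cast
  ring

/-- Andréief's identity with no constant rows (κ = `Fin 0`): both determinants are Vandermonde, one
carrying the weights, and orthogonality makes the Gram matrix diagonal. -/
theorem eigenvalueDensity_integral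
    (hmom : ∀ k : ℕ, Integrable (fun x : ℝ => x ^ k * Real.exp (-((N : ℝ) * V x)))) (n : ℕ) :
    Integrable (fun x : Fin n → ℝ => (Matrix.vandermonde x).det ^ 2 * ∏ i, weight N V (x i)) ∧
    ∫ x : Fin n → ℝ, (Matrix.vandermonde x).det ^ 2 * ∏ i, weight N V (x i) =
      n.factorial * ∏ i : Fin n, wInner N V (monicOP N V i) (monicOP N V i) := by
  set d : Fin n ⊕ Fin 0 → ℕ := Sum.elim (fun a => a) fun k => k.elim0 with hd
  set φ : Fin n → ℝ → ℂ := fun a t => (weight N V t : ℂ) * (((monicOP N V a).eval t : ℝ) : ℂ)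
    with hφ
  set ψ : Fin n ⊕ Fin 0 → ℝ → ℂ := fun c t => (((monicOP N V (d c)).eval t : ℝ) : ℂ) with hψ
  set P : Fin 0 → Fin n ⊕ Fin 0 → ℂ := fun i => i.elim0
  obtain ⟨hi, hI⟩ := andreief φ ψ P fun a c =>
    integrable_wInner_ofReal hmom (monicOP N V a) (monicOP N V (d c))
  have hpt : ∀ y : Fin n → ℝ, (Matrix.of fun b a => φ a (y b)).det * (Matrix.of fun r c =>
      Sum.elim (fun b => ψ c (y b)) (fun i => P i c) r).det =
      (((Matrix.vandermonde y).det ^ 2 * ∏ i, weight N V (y i) : ℝ) : ℂ) := by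
    intro y
    have h1 := Matrix.det_mul_column (fun b => (weight N V (y b) : ℂ))
      (Matrix.of fun b a : Fin n => ((monicOP N V a).map (algebraMap ℝ ℂ)).eval (y b : ℂ))
    rw [det_eval_monic_family (Equiv.refl _) (fun b => (y b : ℂ)) _
      (fun a => monic_map_monicOP (a : ℕ)) fun a => natDegree_map_monicOP (a : ℕ)] at h1
    have h2 := det_eval_monic_family_sum (Equiv.refl (Fin n)) (fun b => (y b : ℂ))
      (fun i : Fin 0 => i.elim0) (fun c => (monicOP N V (d c)).map (algebraMap ℝ ℂ))
      (fun c => monic_map_monicOP _) (fun a => natDegree_map_monicOP _) (fun k => k.elim0)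
    have e1 : (Matrix.of fun b a => φ a (y b)) = Matrix.of fun i j => (weight N V (y i) : ℂ) *
        (Matrix.of fun b a : Fin n => ((monicOP N V a).map (algebraMap ℝ ℂ)).eval (y b : ℂ)) i j := by
      ext b a
      simp only [hφ, Matrix.of_apply, eval_map_ofReal]
    have e2 : (Matrix.of fun r c => Sum.elim (fun b => ψ c (y b)) (fun i => P i c) r) =
        Matrix.of fun r c => ((monicOP N V (d c)).map (algebraMap ℝ ℂ)).eval
          (Sum.elim (fun b => (y b : ℂ)) (fun i : Fin 0 => i.elim0) r) := by
      ext (b | i) c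
      · simp only [hψ, Matrix.of_apply, Sum.elim_inl, eval_map_ofReal]
      · exact i.elim0
    rw [e1, e2, h1, h2]
    simp only [Equiv.refl_symm, Equiv.refl_apply, det_vandermonde_ofReal, Finset.univ_eq_empty,
      Finset.prod_empty, Matrix.det_isEmpty, mul_one]
    push_cast
    ring
  have hG : (Matrix.of fun r c => Sum.elim (fun a => ∫ t, φ a t * ψ c t)
      (fun i => P i c) r).det =
      ((∏ i : Fin n, wInner N V (monicOP N V i) (monicOP N V i) : ℝ) : ℂ) := by
    have hdiag : (Matrix.of fun r c => Sum.elim (fun a => ∫ t, φ a t * ψ c t)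
        (fun i => P i c) r) = Matrix.diagonal (Sum.elim
          (fun a : Fin n => ((wInner N V (monicOP N V a) (monicOP N V a) : ℝ) : ℂ))
          fun i : Fin 0 => i.elim0) := by
      ext (a | i) (c | k)
      · simp only [hφ, hψ, hd, Matrix.of_apply, Sum.elim_inl, integral_wInner_ofReal]
        rcases eq_or_ne a c with rfl | h
        · simp
        · rw [Matrix.diagonal_apply_ne _ (by simpa using h),
            wInner_monicOP_of_ne hmom (fun h' => h (Fin.ext h')), Complex.ofReal_zero]
      · exact k.elim0
      · exact i.elim0
      · exact i.elim0
    rw [hdiag, Matrix.det_diagonal, Fintype.prod_sum_type]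
    simp
  rw [funext hpt] at hi hI
  have hre : ∫ y : Fin n → ℝ, (((Matrix.vandermonde y).det ^ 2 * ∏ i, weight N V (y i) : ℝ) : ℂ) =
      ((∫ y : Fin n → ℝ, (Matrix.vandermonde y).det ^ 2 * ∏ i, weight N V (y i) : ℝ) : ℂ) :=
    integral_ofReal
  rw [hG, hre, Fintype.card_fin] at hI
  exact ⟨hi.re, by exact_mod_cast hI⟩

/-- The functionals `f ↦ ∫ f(x) / (x - q_j) e^{-NV(x)} dx` and `f ↦ f(p_i)`. -/
def pairFunctional {l : ℕ} (p q : Fin l → ℂ)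
    (hmom : ∀ k : ℕ, Integrable (fun x : ℝ => x ^ k * Real.exp (-((N : ℝ) * V x))))
    (hq : ∀ j, (q j).im ≠ 0) : Fin l ⊕ Fin l → ℝ[X] →ₗ[ℝ] ℂ :=
  Sum.elim (fun j => cauchyFunctional hmom (hq j)) fun i => (aeval (p i)).toLinearMap

/-- The product of the two determinants in Andréief's identity is the density of the eigenvalues
times the ratio of characteristic polynomials. -/
theorem det_mul_det_eq_density_mul_ratio {m l : ℕ} (hl : 1 ≤ l) {p q : Fin l → ℂ}
    (hq : Function.Injective q) (hqim : ∀ j, (q j).im ≠ 0) (x : Fin (m + l) → ℝ) :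
    (Matrix.of fun b a : Fin m ⊕ Fin l => (weight N V (x (revSumEquiv m l b)) : ℂ) *
        Sum.elim (fun a : Fin m => (((monicOP N V a).eval (x (revSumEquiv m l b)) : ℝ) : ℂ))
          (fun j => ((x (revSumEquiv m l b) : ℂ) - q j)⁻¹) a).det *
      (Matrix.of fun r c : (Fin m ⊕ Fin l) ⊕ Fin l =>
        ((monicOP N V (degreeEquiv m l c)).map (algebraMap ℝ ℂ)).eval
          (Sum.elim (fun b => (x (revSumEquiv m l b) : ℂ)) p r)).det =
    ((-1) ^ l * (Matrix.vandermonde q).det * (Matrix.vandermonde p).det) *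
      ((((Matrix.vandermonde x).det ^ 2 * ∏ i, weight N V (x i) : ℝ) : ℂ) *
        ∏ k, ((∏ i, (p i - x k)) / ∏ j, (q j - x k))) := by
  set y : Fin m ⊕ Fin l → ℂ := fun b => (x (revSumEquiv m l b) : ℂ) with hy
  have hyq : ∀ b j, y b ≠ q j := fun b j => sub_ne_zero.1 (ofReal_sub_ne_zero (hqim j) _)
  have hcv := det_cauchy_vandermonde hq y hyq (fun a => (monicOP N V a).map (algebraMap ℝ ℂ))
    (fun a => monic_map_monicOP _) fun a => natDegree_map_monicOP _
  have hsw := det_vandermonde_swapSum hl fun i => (x i : ℂ)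
  rw [det_vandermonde_ofReal x] at hsw
  rw [show (fun i => y ((swapSumEquiv m l).symm i)) =
    fun i => (x (revSumEquiv m l ((swapSumEquiv m l).symm i)) : ℂ) from rfl, hsw] at hcv
  have hsum := det_eval_monic_family_sum (revSumEquiv m l) y p
    (fun c => (monicOP N V (degreeEquiv m l c)).map (algebraMap ℝ ℂ))
    (fun c => monic_map_monicOP _) (fun a => by rw [natDegree_map_monicOP]; simp [degreeEquiv])
    (fun k => by rw [natDegree_map_monicOP]; simp [degreeEquiv])
  have hyx : (fun i => y ((revSumEquiv m l).symm i)) = fun i => (x i : ℂ) := by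
    ext i
    simp [hy]
  rw [hyx, det_vandermonde_ofReal] at hsum
  rw [hsum]
  set Q : ℂ := ∏ b, ∏ j, (y b - q j) with hQ
  have hQ0 : Q ≠ 0 := Finset.prod_ne_zero_iff.2 fun b _ => Finset.prod_ne_zero_iff.2 fun j _ =>
    sub_ne_zero.2 (hyq b j)
  have hdet : (Matrix.of fun b a : Fin m ⊕ Fin l => (weight N V (x (revSumEquiv m l b)) : ℂ) *
        Sum.elim (fun a : Fin m => (((monicOP N V a).eval (x (revSumEquiv m l b)) : ℝ) : ℂ))
          (fun j => ((x (revSumEquiv m l b) : ℂ) - q j)⁻¹) a).det =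
      (∏ b, (weight N V (x (revSumEquiv m l b)) : ℂ)) * (Matrix.of fun b a : Fin m ⊕ Fin l =>
        Sum.elim (fun a : Fin m => ((monicOP N V a).map (algebraMap ℝ ℂ)).eval (y b))
          (fun j => (y b - q j)⁻¹) a).det := by
    rw [← Matrix.det_mul_column]
    congr 1
    ext b a
    simp only [Matrix.of_apply, hy, eval_map_ofReal]
  have hW : ∏ b, (weight N V (x (revSumEquiv m l b)) : ℂ) = ∏ i, (weight N V (x i) : ℂ) :=
    (revSumEquiv m l).prod_comp fun i => (weight N V (x i) : ℂ)
  have hP : ∏ k, ∏ i, (p i - (x k : ℂ)) = ∏ i, ∏ b, (p i - y b) := by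
    rw [Finset.prod_comm]
    exact Finset.prod_congr rfl fun i _ => ((revSumEquiv m l).prod_comp fun k => p i - (x k : ℂ)).symm
  -- The ratio has factors q_j - x_k, the Cauchy–Vandermonde identity x_k - q_j; there are l(m + l)
  -- sign changes.
  have hD : ∏ k, ∏ j, (q j - (x k : ℂ)) = (-1) ^ (l * (m + l)) * Q := by
    rw [← (revSumEquiv m l).prod_comp fun k => ∏ j, (q j - (x k : ℂ)), hQ]
    have : ∀ b, ∏ j, (q j - (x (revSumEquiv m l b) : ℂ)) = (-1) ^ l * ∏ j, (y b - q j) := fun b => by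
      have h1 : ((-1 : ℂ)) ^ l = ∏ _j : Fin l, (-1 : ℂ) := by simp
      rw [h1, ← Finset.prod_mul_distrib]
      exact Finset.prod_congr rfl fun j _ => by simp only [hy]; ring
    simp only [this, Finset.prod_mul_distrib, Finset.prod_const, Finset.card_univ,
      Fintype.card_sum, Fintype.card_fin]
    rw [← pow_mul]
  have hsign : (-1 : ℂ) ^ (m * l) * (-1) ^ (l * (m + l)) = (-1) ^ l := by
    have h : m * l + l * (m + l) = 2 * (m * l) + l * l := by ring
    rw [← pow_add, h, pow_add, pow_mul, neg_one_sq, one_pow, one_mul]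
    rcases Nat.even_or_odd l with h | h
    · rw [h.neg_one_pow, (h.mul_left l).neg_one_pow]
    · rw [h.neg_one_pow, (h.mul h).neg_one_pow]
  have hsq : ((-1 : ℂ) ^ (l * (m + l))) ≠ 0 := pow_ne_zero _ (by norm_num)
  generalize (Matrix.of fun b a : Fin m ⊕ Fin l =>
    Sum.elim (fun a : Fin m => ((monicOP N V a).map (algebraMap ℝ ℂ)).eval (y b))
      (fun j => (y b - q j)⁻¹) a).det = M at hdet hcv
  rw [hdet, hW, Finset.prod_div_distrib, hP, hD, ← hsign]
  push_cast
  field_simp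
  linear_combination ((∏ i, (weight N V (x i) : ℂ)) * ((Matrix.vandermonde x).det : ℂ) *
    (∏ i, ∏ b, (p i - y b)) * (Matrix.vandermonde p).det) * hcv

theorem measurePreserving_comp_equiv {ι ι' : Type*} [Fintype ι] [Fintype ι'] (e : ι ≃ ι') :
    MeasurePreserving (MeasurableEquiv.piCongrLeft (fun _ : ι => ℝ) e.symm) volume volume :=
  volume_measurePreserving_piCongrLeft (fun _ : ι => ℝ) e.symm

/-- Andréief's identity for the two determinants of `det_mul_det_eq_density_mul_ratio`, with the
evaluations at p as constant rows. The rows pairing with π_a, a < m, vanish on the columns of degree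
at least m, so ν_0 ⋯ ν_{m-1} splits off. -/
theorem ratio_integral {m l : ℕ} (hl : 1 ≤ l)
    (hmom : ∀ k : ℕ, Integrable (fun x : ℝ => x ^ k * Real.exp (-((N : ℝ) * V x))))
    {p q : Fin l → ℂ} (hp : Function.Injective p) (hq : Function.Injective q)
    (hqim : ∀ j, (q j).im ≠ 0) :
    Integrable (fun x : Fin (m + l) → ℝ =>
      (((Matrix.vandermonde x).det ^ 2 * ∏ i, weight N V (x i) : ℝ) : ℂ) *
        ∏ k, ((∏ i, (p i - x k)) / ∏ j, (q j - x k))) ∧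
    ∫ x : Fin (m + l) → ℝ, (((Matrix.vandermonde x).det ^ 2 * ∏ i, weight N V (x i) : ℝ) : ℂ) *
        ∏ k, ((∏ i, (p i - x k)) / ∏ j, (q j - x k)) =
      ((-1) ^ l * (Matrix.vandermonde q).det * (Matrix.vandermonde p).det)⁻¹ *
        ((m + l).factorial * ((∏ a : Fin m, (wInner N V (monicOP N V a) (monicOP N V a) : ℂ)) *
          (Matrix.of fun r c =>
            pairFunctional p q hmom hqim r (monicOP N V (pairDegree m l c))).det)) := by
  set φ : Fin m ⊕ Fin l → ℝ → ℂ := fun a t => (weight N V t : ℂ) *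
    Sum.elim (fun a : Fin m => (((monicOP N V a).eval t : ℝ) : ℂ)) (fun j => ((t : ℂ) - q j)⁻¹) a
    with hφ
  set ψ : (Fin m ⊕ Fin l) ⊕ Fin l → ℝ → ℂ := fun c t =>
    (((monicOP N V (degreeEquiv m l c)).eval t : ℝ) : ℂ) with hψ
  set P : Fin l → (Fin m ⊕ Fin l) ⊕ Fin l → ℂ := fun i c =>
    ((monicOP N V (degreeEquiv m l c)).map (algebraMap ℝ ℂ)).eval (p i) with hP
  have hcauchy : ∀ (j : Fin l) (f : ℝ[X]) (t : ℝ),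
      (weight N V t : ℂ) * ((t : ℂ) - q j)⁻¹ * ((f.eval t : ℝ) : ℂ) =
        ((f.eval t : ℝ) : ℂ) / ((t : ℂ) - q j) * (weight N V t : ℂ) := fun j f t => by ring
  have hint : ∀ a c, Integrable fun t => φ a t * ψ c t := by
    rintro (a | j) c
    · exact integrable_wInner_ofReal hmom _ _
    · simp only [hφ, hψ, Sum.elim_inr, hcauchy]
      exact integrable_cauchy hmom (hqim j) _
  obtain ⟨hi, hI⟩ := andreief φ ψ P hint
  set κ : ℂ := (-1) ^ l * (Matrix.vandermonde q).det * (Matrix.vandermonde p).det with hκ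
  have hκ0 : κ ≠ 0 := mul_ne_zero (mul_ne_zero (pow_ne_zero _ (by norm_num))
    (Matrix.det_vandermonde_ne_zero_iff.2 hq)) (Matrix.det_vandermonde_ne_zero_iff.2 hp)
  set f : (Fin m ⊕ Fin l → ℝ) → ℂ := fun y => (Matrix.of fun b a => φ a (y b)).det *
    (Matrix.of fun r c => Sum.elim (fun b => ψ c (y b)) (fun i => P i c) r).det with hf
  have hmp := measurePreserving_comp_equiv (revSumEquiv m l)
  have hcomp : ∀ x : Fin (m + l) → ℝ,
      f (MeasurableEquiv.piCongrLeft (fun _ => ℝ) (revSumEquiv m l).symm x) =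
      κ * ((((Matrix.vandermonde x).det ^ 2 * ∏ i, weight N V (x i) : ℝ) : ℂ) *
        ∏ k, ((∏ i, (p i - x k)) / ∏ j, (q j - x k))) := fun x => by
    have hx : (MeasurableEquiv.piCongrLeft (fun _ => ℝ) (revSumEquiv m l).symm x) =
        fun b => x (revSumEquiv m l b) := by
      funext b
      obtain ⟨j, rfl⟩ := (revSumEquiv m l).symm.surjective b
      simp [MeasurableEquiv.piCongrLeft, Equiv.piCongrLeft_apply_apply]
    rw [hx, ← det_mul_det_eq_density_mul_ratio hl hq hqim x]
    simp only [hf, hφ]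
    congr 2
    ext (b | i) c
    · simp only [Matrix.of_apply, Sum.elim_inl, hψ, eval_map_ofReal]
    · rfl
  have hint' := (hmp.integrable_comp_emb (MeasurableEquiv.measurableEmbedding _)).2 hi
  have hI' := hmp.integral_comp' f
  simp only [Function.comp_def] at hint'
  have hint'' := hint'.const_mul κ⁻¹
  have hG : (Matrix.of fun r c => Sum.elim (fun a => ∫ t, φ a t * ψ c t) (fun i => P i c) r).det =
      (∏ a : Fin m, (wInner N V (monicOP N V a) (monicOP N V a) : ℂ)) *
          (Matrix.of fun r c =>
            pairFunctional p q hmom hqim r (monicOP N V (pairDegree m l c))).det := by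
    -- Regroup the indices so that the q-rows and p-rows form one 2l-block beside the m
    -- orthogonality rows.
    rw [← Matrix.det_submatrix_equiv_self (Equiv.sumAssoc (Fin m) (Fin l) (Fin l)).symm]
    have hd1 : ∀ a : Fin m, ((degreeEquiv m l (Sum.inl (Sum.inl a)) : Fin _) : ℕ) = a :=
      fun a => by simp [degreeEquiv]
    have hd2 : ∀ c : Fin l ⊕ Fin l, ((degreeEquiv m l
        ((Equiv.sumAssoc (Fin m) (Fin l) (Fin l)).symm (Sum.inr c)) : Fin _) : ℕ) =
        pairDegree m l c := by
      rintro (k | k) <;> simp [degreeEquiv, pairDegree]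
    have hblock : (Matrix.of fun r c => Sum.elim (fun a => ∫ t, φ a t * ψ c t)
        (fun i => P i c) r).submatrix (Equiv.sumAssoc (Fin m) (Fin l) (Fin l)).symm
          (Equiv.sumAssoc (Fin m) (Fin l) (Fin l)).symm =
        Matrix.fromBlocks
          (Matrix.diagonal fun a : Fin m => (wInner N V (monicOP N V a) (monicOP N V a) : ℂ)) 0
          (Matrix.of fun (r : Fin l ⊕ Fin l) (a : Fin m) =>
            pairFunctional p q hmom hqim r (monicOP N V a))
          (Matrix.of fun r c =>
            pairFunctional p q hmom hqim r (monicOP N V (pairDegree m l c))) := by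
      have hrow : ∀ (r : Fin l ⊕ Fin l) (c : (Fin m ⊕ Fin l) ⊕ Fin l),
          Sum.elim (fun a => ∫ t, φ a t * ψ c t) (fun i => P i c)
            ((Equiv.sumAssoc (Fin m) (Fin l) (Fin l)).symm (Sum.inr r)) =
          pairFunctional p q hmom hqim r (monicOP N V (degreeEquiv m l c)) := by
        rintro (j | i) c
        · simp only [Equiv.sumAssoc_symm_apply_inr_inl, Sum.elim_inl, hφ, hψ, Sum.elim_inr, hcauchy]
          rfl
        · simp only [Equiv.sumAssoc_symm_apply_inr_inr, Sum.elim_inr, hP, pairFunctional,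
            AlgHom.toLinearMap_apply, eval_map_algebraMap]
      have htop : ∀ (a : Fin m) (c : (Fin m ⊕ Fin l) ⊕ Fin l),
          Sum.elim (fun a => ∫ t, φ a t * ψ c t) (fun i => P i c)
            ((Equiv.sumAssoc (Fin m) (Fin l) (Fin l)).symm (Sum.inl a)) =
          (wInner N V (monicOP N V a) (monicOP N V (degreeEquiv m l c)) : ℂ) := fun a c => by
        simp only [Equiv.sumAssoc_symm_apply_inl, Sum.elim_inl, hφ, hψ, integral_wInner_ofReal]
      ext (a | r) (c | c)
      · rw [Matrix.submatrix_apply, Matrix.of_apply, htop, Matrix.fromBlocks_apply₁₁,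
          Equiv.sumAssoc_symm_apply_inl, hd1]
        rcases eq_or_ne a c with rfl | h
        · simp
        · rw [Matrix.diagonal_apply_ne _ h,
            wInner_monicOP_of_ne hmom (fun h' => h (Fin.ext h')), Complex.ofReal_zero]
      · rw [Matrix.submatrix_apply, Matrix.of_apply, htop, Matrix.fromBlocks_apply₁₂, hd2,
          wInner_monicOP_of_ne hmom, Complex.ofReal_zero, Matrix.zero_apply]
        rcases c with k | k <;> simp only [pairDegree, Sum.elim_inl, Sum.elim_inr] <;> omega
      · rw [Matrix.submatrix_apply, Matrix.of_apply, hrow, Matrix.fromBlocks_apply₂₁,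
          Equiv.sumAssoc_symm_apply_inl, hd1, Matrix.of_apply]
      · rw [Matrix.submatrix_apply, Matrix.of_apply, hrow, Matrix.fromBlocks_apply₂₂, hd2,
          Matrix.of_apply]
    rw [hblock, Matrix.det_fromBlocks_zero₁₂, Matrix.det_diagonal]
  have hcancel : ∀ z : ℂ, κ⁻¹ * (κ * z) = z := fun z => inv_mul_cancel_left₀ hκ0 z
  constructor
  · refine hint''.congr (Filter.Eventually.of_forall fun x => ?_)
    change κ⁻¹ * f (MeasurableEquiv.piCongrLeft _ _ x) = _
    rw [hcomp, hcancel]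
  · rw [← hG]
    have hcard : Fintype.card (Fin m ⊕ Fin l) = m + l := by simp
    rw [hcard] at hI
    rw [← hI]
    change _ = κ⁻¹ * ∫ y, f y
    rw [← hI', ← integral_const_mul]
    congr 1
    ext x
    rw [hcomp, hcancel]

/-- The q-rows carry a factor 1/(2πi) and the first l columns a factor -2πi γ_{N-1}². Together they
contribute -γ_{N-1}² = -1/ν_{N-1} for each of the l indices. -/
theorem det_blockMatrix {m l : ℕ} (hl : 1 ≤ l)
    (hmom : ∀ k : ℕ, Integrable (fun x : ℝ => x ^ k * Real.exp (-(((m + l : ℕ) : ℝ) * V x))))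
    (p q : Fin l → ℂ) (hqim : ∀ j, (q j).im ≠ 0) :
    (blockMatrix (m + l) V p q).det =
      (-((wInner (m + l) V (monicOP (m + l) V (m + l - 1)) (monicOP (m + l) V (m + l - 1)) : ℝ) :
        ℂ)⁻¹) ^ l *
      (Matrix.of fun r s => pairFunctional p q hmom hqim r (shiftedOP (m + l) V m l s)).det := by
  have hpi : (2 * (Real.pi : ℂ) * Complex.I) ≠ 0 := by
    simp [Real.pi_ne_zero]
  set s₀ : ℂ := -2 * (Real.pi : ℂ) * Complex.I * (gam (m + l) V (m + l - 1) : ℂ) ^ 2 with hs₀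
  have hgam : (gam (m + l) V (m + l - 1) : ℂ) ^ 2 =
      ((wInner (m + l) V (monicOP (m + l) V (m + l - 1)) (monicOP (m + l) V (m + l - 1)) : ℝ) :
        ℂ)⁻¹ := by
    rw [← Complex.ofReal_pow, gam_sq hmom, Complex.ofReal_inv]
  set r₀ : Fin l ⊕ Fin l → ℂ :=
    Sum.elim (fun _ => 1 / (2 * (Real.pi : ℂ) * Complex.I)) fun _ => 1 with hr₀
  set c₀ : Fin l ⊕ Fin l → ℂ := Sum.elim (fun _ => s₀) fun _ => 1 with hc₀
  have hblock : blockMatrix (m + l) V p q = Matrix.of fun r s => r₀ r * (Matrix.of fun r s => c₀ s *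
      (Matrix.of fun r s => pairFunctional p q hmom hqim r (shiftedOP (m + l) V m l s)) r s) r s := by
    ext (j | i) (k | k)
    · simp only [blockMatrix, Matrix.fromBlocks_apply₁₁, diagVandermonde, Matrix.diagonal_mul,
        Matrix.vandermonde_apply, Matrix.of_apply, hr₀, hc₀, Sum.elim_inl, pairFunctional, shiftedOP,
        hTilde, hFun_eq hmom (hqim j)]
      rw [cauchyFunctional_monicOP_mul_X_pow hmom (hqim j) (by omega)]
      ring
    · simp only [blockMatrix, Matrix.fromBlocks_apply₁₂, diagVandermonde, Matrix.diagonal_mul,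
        Matrix.vandermonde_apply, Matrix.of_apply, hr₀, hc₀, Sum.elim_inl, Sum.elim_inr,
        pairFunctional, shiftedOP, hFun_eq hmom (hqim j)]
      rw [cauchyFunctional_monicOP_mul_X_pow hmom (hqim j) (by omega)]
      ring
    · simp only [blockMatrix, Matrix.fromBlocks_apply₂₁, diagVandermonde, Matrix.diagonal_mul,
        Matrix.vandermonde_apply, Matrix.of_apply, hr₀, hc₀, Sum.elim_inl, Sum.elim_inr,
        pairFunctional, shiftedOP, piTilde, piFun, AlgHom.toLinearMap_apply, map_mul, map_pow,
        aeval_X]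
      ring
    · simp only [blockMatrix, Matrix.fromBlocks_apply₂₂, diagVandermonde, Matrix.diagonal_mul,
        Matrix.vandermonde_apply, Matrix.of_apply, hr₀, hc₀, Sum.elim_inr,
        pairFunctional, shiftedOP, piFun, AlgHom.toLinearMap_apply, map_mul, map_pow, aeval_X]
      ring
  rw [hblock, Matrix.det_mul_column, Matrix.det_mul_row, Fintype.prod_sum_type,
    Fintype.prod_sum_type, ← mul_assoc]
  congr 1
  simp only [hr₀, hc₀, Sum.elim_inl, Sum.elim_inr, Finset.prod_const, Finset.card_univ,
    Fintype.card_fin, one_pow, mul_one]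
  rw [← mul_pow, ← hgam]
  congr 1
  rw [hs₀]
  field_simp

end UnitaryEnsemble

end

/-- Expectation of a balanced ratio of characteristic polynomials of the random Hermitian matrix
with law proportional to `e^{-N tr V(A)} dA`. -/
theorem lemma3p2 (N l : ℕ) (hl : 1 ≤ l) (hlN : l ≤ N)
    (V : ℝ → ℝ) (hV : Continuous V)
    (hmom : ∀ k : ℕ, Integrable (fun x : ℝ => x ^ k * Real.exp (-((N : ℝ) * V x))))
    (p q : Fin l → ℂ) (hp : Function.Injective p) (hq : Function.Injective q)
    (hpim : ∀ i, (p i).im ≠ 0) (hqim : ∀ j, (q j).im ≠ 0) :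
    IsProbabilityMeasure (UnitaryEnsemble.law N V) ∧
    Integrable (fun c => UnitaryEnsemble.charRatio p q (UnitaryEnsemble.toMatrix c))
      (UnitaryEnsemble.law N V) ∧
    ∫ c, UnitaryEnsemble.charRatio p q (UnitaryEnsemble.toMatrix c) ∂(UnitaryEnsemble.law N V) =
      1 / ((Matrix.vandermonde q).det * (Matrix.vandermonde p).det) *
        (UnitaryEnsemble.blockMatrix N V p q).det := by
  -- Here m = N - l counts the polynomial columns of the Cauchy–Vandermonde determinant.
  obtain ⟨m, rfl⟩ : ∃ m, N = m + l := ⟨N - l, by omega⟩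
  obtain ⟨hZi, hZ⟩ := UnitaryEnsemble.eigenvalueDensity_integral hmom (m + l)
  obtain ⟨hRi, hR⟩ := UnitaryEnsemble.ratio_integral (m := m) hl hmom hp hq hqim
  have hpos := UnitaryEnsemble.wInner_monicOP_self_pos hmom
  have hZ0 : 0 < ((m + l).factorial : ℝ) * ∏ i : Fin (m + l), UnitaryEnsemble.wInner (m + l) V
      (UnitaryEnsemble.monicOP (m + l) V i) (UnitaryEnsemble.monicOP (m + l) V i) :=
    mul_pos (by exact_mod_cast (m + l).factorial_pos) (Finset.prod_pos fun i _ => hpos i)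
  obtain ⟨h1, h2, h3⟩ := UnitaryEnsemble.law_charRatio hV p q hZ0 hZi hZ hRi hR
  refine ⟨h1, h2, h3.trans ?_⟩
  rw [UnitaryEnsemble.det_blockMatrix hl hmom p q hqim,
    UnitaryEnsemble.det_functional_shiftedOP hmom,
    -- Split ν_0 ⋯ ν_{N-1} at m: the lower part cancels against the orthogonality block, the upper
    -- part against the denominators ν_{N-1-k} of the change of basis.
    ← (UnitaryEnsemble.revSumEquiv m l).prod_comp, Fintype.prod_sum_type]
  simp only [UnitaryEnsemble.revSumEquiv_inl, UnitaryEnsemble.revSumEquiv_inr]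
  push_cast
  rw [Finset.prod_div_distrib]
  set nu : ℕ → ℂ := fun n => ((UnitaryEnsemble.wInner (m + l) V
    (UnitaryEnsemble.monicOP (m + l) V n) (UnitaryEnsemble.monicOP (m + l) V n) : ℝ) : ℂ) with hnu
  have hnu0 : ∀ n, nu n ≠ 0 := fun n => Complex.ofReal_ne_zero.2 (hpos n).ne'
  have hA : ∏ a : Fin m, nu a ≠ 0 := Finset.prod_ne_zero_iff.2 fun a _ => hnu0 a
  have hB : ∏ k : Fin l, nu (m + (l - 1 - k)) ≠ 0 := Finset.prod_ne_zero_iff.2 fun a _ => hnu0 _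
  have hD := Matrix.det_vandermonde_ne_zero_iff.2 hq
  have hD' := Matrix.det_vandermonde_ne_zero_iff.2 hp
  have hf : ((m + l).factorial : ℂ) ≠ 0 := by exact_mod_cast (m + l).factorial_ne_zero
  have hn := hnu0 (m + l - 1)
  have hs : ((-1 : ℂ) ^ l) ^ 2 = 1 := by rw [← pow_mul']; simp
  simp only [Finset.prod_const, Finset.card_univ, Fintype.card_fin]
  have hneg : (-(nu (m + l - 1))⁻¹) ^ l = (-1) ^ l * (nu (m + l - 1) ^ l)⁻¹ := by
    rw [neg_pow, inv_pow]
  simp only [hnu] at hA hB hn hneg ⊢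
  rw [hneg]
  field_simp
  -- The sign from the Cauchy denominators meets the sign from the tilde normalization.
  rw [hs, one_mul]
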